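/- **Definitions.** Graphs are finite, simple and undirected. A *branch decomposition* $(T,\delta)$ of a graph $G$ is a tree $T$ of maximum degree at most $3$ together with a bijection $\delta$ from the leaves of $T$ to $V(G)$ (the node of a one-node tree counts as a leaf). Each edge $e$ of $T$ induces a cut $(A,\overline A)$ of $G$, where $A$ and $\overline A=V(G)\setminus A$ are the sets of vertices mapped from the leaves of the two components of $T-e$. A cut $(A,\overline A)$ is a *split* of $G$ if $|A|\ge 2$, $|\overline A|\ge 2$ and all vertices of $A$ that have a neighbour in $\overline A$ have the same neighbourhood in $\overline A$. For $A\subseteq V(G)$ let $\operatorname{sm}(A)=1$ if $(A,\overline A)$ is a split of $G$, and otherwise let $\operatorname{sm}(A)$ be the maximum size of a matching of the bipartite graph $G[A,\overline A]$ consisting of the edges of $G$ between $A$ and $\overline A$. The *sm-width* of $(T,\delta)$ is the maximum of $\operatorname{sm}(A)$ over all cuts $(A,\overline A)$ induced by the edges of $T$ (and $0$ if $T$ has no edges). **Theorem.** There is an algorithm that, given a graph $G$ and a branch decomposition $(T,\delta)$ of $G$, computes the chromatic number $\chi(G)$ in time $\mathcal O^*(k^{5k})$, where $k$ is the sm-width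 of $(T,\delta)$. That is, there are absolute constants $c,d$ such that on every such input the algorithm outputs $\chi(G)$ after at most $c\cdot N^{d}\cdot k^{5k}$ elementary steps, where $N=|V(G)|+|V(T)|$ and $0^0=1$. (Time is measured on while-programs over binary trees built from $\mathtt{nil}$ by pairing, where forming a pair, taking a component of a pair, testing for $\mathtt{nil}$ and copying a reference each cost one step; each such step takes constant time on a random access machine. Graphs are given by adjacency matrices, $\delta$ by a table, and numbers in unary.) -/

import Mathlib

/-! ### Branch decompositions and split-matching-width -/

namespace SplitMatching

/-- `(A, Aᶜ)` is a split of `G`: both sides have at least two vertices, and all vertices of `A` that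
have a neighbour outside `A` have the same neighbourhood outside `A`. No connectedness of `G` is
asked for, so the notion makes sense for every graph. -/
def IsSplit {V : Type*} (G : SimpleGraph V) (A : Set V) : Prop :=
  2 ≤ A.ncard ∧ 2 ≤ Aᶜ.ncard ∧
    ∀ u ∈ A, ∀ v ∈ A, (G.neighborSet u ∩ Aᶜ).Nonempty → (G.neighborSet v ∩ Aᶜ).Nonempty →
      G.neighborSet u ∩ Aᶜ = G.neighborSet v ∩ Aᶜ

/-- The maximum number of edges of a matching of the bipartite graph `G[A, Aᶜ]`. -/
noncomputable def mm {V : Type*} (G : SimpleGraph V) (A : Set V) : ℕ :=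
  sSup {j | ∃ M : (G.between A Aᶜ).Subgraph, M.IsMatching ∧ M.edgeSet.ncard = j}

open Classical in
/-- The split-matching cut function. -/
noncomputable def sm {V : Type*} (G : SimpleGraph V) (A : Set V) : ℕ :=
  if IsSplit G A then 1 else mm G A

/-- A leaf of a tree: a node with at most one neighbour. In a tree with at least two nodes this is a
node of degree one; the only node of a one-node tree counts as a leaf. -/
def IsLeaf {W : Type*} (T : SimpleGraph W) (x : W) : Prop :=
  (T.neighborSet x).ncard ≤ 1

/-- A branch decomposition, with tree nodes `W`, of a graph with vertex set `V`. -/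
structure BranchDecomposition (V W : Type*) where
  /-- the tree -/
  tree : SimpleGraph W
  isTree : tree.IsTree
  degree_le : ∀ x, (tree.neighborSet x).ncard ≤ 3
  /-- the bijection from the leaves to the vertices of the graph -/
  leafEquiv : {x : W // IsLeaf tree x} ≃ V

/-- For an edge `ab` of the tree: the vertices mapped from the leaves in the component of `a` after
the edge `ab` is removed. -/
def BranchDecomposition.cut {V W : Type*} (D : BranchDecomposition V W) (a b : W) : Set V :=
  {v | (D.tree.deleteEdges {s(a, b)}).Reachable a (D.leafEquiv.symm v : W)}

/-- The sm-width of a branch decomposition of `G`: the maximum of `sm` over the cuts induced by the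
edges of the tree (`0` if the tree has no edge). -/
noncomputable def BranchDecomposition.smWidth {V W : Type*} (D : BranchDecomposition V W)
    (G : SimpleGraph V) : ℕ :=
  sSup {j | ∃ a b, D.tree.Adj a b ∧ sm G (D.cut a b) = j}

end SplitMatching

/-! ### The model of computation

The language of while-programs over binary trees built from `nil` and `cons` (N. D. Jones's WHILE
language). A program has finitely many variables, each holding (a pointer to) a tree. Building a pair,
taking the left or right component, testing for `nil` and copying a pointer each cost one step; there
is no arithmetic and no comparison of trees in one step. Every step takes constant time on a
random access machine or pointer machine, so time bounds carry over to these. -/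

namespace WhileLang

/-- Data values. -/
inductive Dat : Type
  | nil : Dat
  | cons : Dat → Dat → Dat

/-- Left component; `nil` on `nil`. -/
def Dat.hd : Dat → Dat
  | .nil => .nil
  | .cons x _ => x

/-- Right component; `nil` on `nil`. -/
def Dat.tl : Dat → Dat
  | .nil => .nil
  | .cons _ y => y

/-- The contents of the variables. -/
abbrev Store : Type := ℕ → Dat

/-- Expressions. -/
inductive Exp : Type
  | var : ℕ → Exp
  | nil : Exp
  | cons : Exp → Exp → Exp
  | hd : Exp → Exp
  | tl : Exp → Exp

/-- The value of an expression. -/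
def Exp.eval (s : Store) : Exp → Dat
  | .var i => s i
  | .nil => .nil
  | .cons e f => .cons (e.eval s) (f.eval s)
  | .hd e => (e.eval s).hd
  | .tl e => (e.eval s).tl

/-- The number of steps for evaluating an expression: one for each of its operations. -/
def Exp.cost : Exp → ℕ
  | .var _ => 1
  | .nil => 1
  | .cons e f => e.cost + f.cost + 1
  | .hd e => e.cost + 1
  | .tl e => e.cost + 1

/-- Programs. -/
inductive Prog : Type
  | assign : ℕ → Exp → Prog
  | seq : Prog → Prog → Prog
  | ite : Exp → Prog → Prog → Prog
  | loop : Exp → Prog → Prog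

/-- `Runs p s t s'`: started in store `s`, the program `p` halts after exactly `t` steps in store
`s'`. A test is passed if the value of its expression is not `nil`; `loop e p` repeats `p` as long as
the test of `e` is passed. -/
inductive Runs : Prog → Store → ℕ → Store → Prop
  | assign (i : ℕ) (e : Exp) (s : Store) :
      Runs (.assign i e) s (e.cost + 1) (Function.update s i (e.eval s))
  | seq {p q : Prog} {s s' s'' : Store} {t t' : ℕ} :
      Runs p s t s' → Runs q s' t' s'' → Runs (.seq p q) s (t + t') s''
  | ite_pass {e : Exp} {p q : Prog} {s s' : Store} {t : ℕ} :
      e.eval s ≠ .nil → Runs p s t s' → Runs (.ite e p q) s (e.cost + 1 + t) s'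
  | ite_fail {e : Exp} {p q : Prog} {s s' : Store} {t : ℕ} :
      e.eval s = .nil → Runs q s t s' → Runs (.ite e p q) s (e.cost + 1 + t) s'
  | loop_fail {e : Exp} {p : Prog} {s : Store} :
      e.eval s = .nil → Runs (.loop e p) s (e.cost + 1) s
  | loop_pass {e : Exp} {p : Prog} {s s' s'' : Store} {t t' : ℕ} :
      e.eval s ≠ .nil → Runs p s t s' → Runs (.loop e p) s' t' s'' →
        Runs (.loop e p) s (e.cost + 1 + t + t') s''

/-- The semantics is deterministic. -/
theorem Runs.deterministic {p : Prog} {s s₁ s₂ : Store} {t₁ t₂ : ℕ}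
    (h₁ : Runs p s t₁ s₁) (h₂ : Runs p s t₂ s₂) : t₁ = t₂ ∧ s₁ = s₂ := by
  induction h₁ generalizing t₂ s₂ with
  | assign i e s => cases h₂; exact ⟨rfl, rfl⟩
  | seq _ _ ih ih' =>
    cases h₂ with
    | seq a b =>
      obtain ⟨rfl, rfl⟩ := ih a
      obtain ⟨rfl, rfl⟩ := ih' b
      exact ⟨rfl, rfl⟩
  | ite_pass h _ ih =>
    cases h₂ with
    | ite_pass _ a => obtain ⟨rfl, rfl⟩ := ih a; exact ⟨rfl, rfl⟩
    | ite_fail h' _ => exact absurd h' h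
  | ite_fail h _ ih =>
    cases h₂ with
    | ite_pass h' _ => exact absurd h h'
    | ite_fail _ a => obtain ⟨rfl, rfl⟩ := ih a; exact ⟨rfl, rfl⟩
  | loop_fail h =>
    cases h₂ with
    | loop_fail _ => exact ⟨rfl, rfl⟩
    | loop_pass h' _ _ => exact absurd h h'
  | loop_pass h _ _ ih ih' =>
    cases h₂ with
    | loop_fail h' => exact absurd h' h
    | loop_pass _ a b =>
      obtain ⟨rfl, rfl⟩ := ih a
      obtain ⟨rfl, rfl⟩ := ih' b
      exact ⟨rfl, rfl⟩

/-- On input `x`, placed in variable `0` with all other variables `nil`, the program `p` halts after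
at most `T` steps with the value `y` in variable `0`. -/
def Prog.OutputsWithin (p : Prog) (x y : Dat) (T : ℕ) : Prop :=
  ∃ (t : ℕ) (s : Store), t ≤ T ∧ Runs p (fun i => if i = 0 then x else .nil) t s ∧ s 0 = y

/-- A finite list of values as one value. -/
def Dat.ofList : List Dat → Dat
  | [] => .nil
  | x :: l => .cons x (Dat.ofList l)

/-- A natural number, in unary. -/
def Dat.ofNat (j : ℕ) : Dat := Dat.ofList (List.replicate j .nil)

open Classical in
/-- A truth value. -/
noncomputable def Dat.ofProp (P : Prop) : Dat := if P then .cons .nil .nil else .nil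

/-- A graph on `{0, …, n - 1}`, as its adjacency matrix, row by row. -/
noncomputable def Dat.ofGraph {n : ℕ} (G : SimpleGraph (Fin n)) : Dat :=
  Dat.ofList (List.ofFn fun i => Dat.ofList (List.ofFn fun j => Dat.ofProp (G.Adj i j)))

open Classical in
/-- A branch decomposition: the tree, and for each node of the tree, in order, the one-element list of
the vertex to which it is mapped if it is a leaf, and the empty list if it is not. -/
noncomputable def Dat.ofBranchDecomposition {n m : ℕ}
    (D : SplitMatching.BranchDecomposition (Fin n) (Fin m)) : Dat :=
  .cons (Dat.ofGraph D.tree)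
    (Dat.ofList (List.ofFn fun x =>
      if h : SplitMatching.IsLeaf D.tree x then
        Dat.ofList [Dat.ofNat (D.leafEquiv ⟨x, h⟩ : ℕ)]
      else Dat.ofList []))

end WhileLang

/-! ### Timed computations on encoded data -/

namespace WhileLang

/-- The number of nodes of a value. -/
def Dat.size : Dat → ℕ
  | .nil => 1
  | .cons x y => x.size + y.size + 1

/-- Types whose elements are represented by values. -/
class Code (α : Type) where
  /-- the representation -/
  enc : α → Dat

open Code

instance : Code Unit := ⟨fun _ => .nil⟩
instance : Code ℕ := ⟨Dat.ofNat⟩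
instance : Code Bool := ⟨fun b => bif b then .cons .nil .nil else .nil⟩
instance {α : Type} [Code α] : Code (List α) := ⟨fun l => Dat.ofList (l.map enc)⟩
instance {α β : Type} [Code α] [Code β] : Code (α × β) := ⟨fun x => .cons (enc x.1) (enc x.2)⟩

@[simp] theorem enc_false : enc false = .nil := rfl
@[simp] theorem enc_true : enc true = .cons .nil .nil := rfl
@[simp] theorem enc_unit (x : Unit) : enc x = .nil := rfl
@[simp] theorem enc_zero : enc (0 : ℕ) = .nil := rfl
@[simp] theorem enc_succ (j : ℕ) : enc (j + 1) = .cons .nil (enc j) := rfl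

/-- The cost of a left fold, given the cost of one step. -/
def foldCost {α γ σ : Type} (step : γ × σ × α → σ) (T : γ × σ × α → ℕ) (x : γ) : σ → List α → ℕ
  | _, [] => 30
  | s, a :: l => T (x, s, a) + 30 + foldCost step T x (step (x, s, a)) l

/-- A bound on the cost of a left fold from an invariant of its states. -/
theorem foldCost_le {α γ σ : Type} (step : γ × σ × α → σ) (T : γ × σ × α → ℕ) (x : γ) (B : ℕ)
    (I : List α → σ → Prop) (l : List α) (s : σ) (h0 : I l s)
    (hI : ∀ a l s, I (a :: l) s → I l (step (x, s, a)) ∧ T (x, s, a) ≤ B) :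
    foldCost step T x s l ≤ l.length * (B + 30) + 30 := by
  induction l generalizing s with
  | nil => simp [foldCost]
  | cons a l ih =>
    obtain ⟨h1, h2⟩ := hI a l s h0
    have := ih _ h1
    simp only [foldCost, List.length_cons, Nat.succ_mul]
    omega

section

variable {α β γ δ σ : Type} [Code α] [Code β] [Code γ] [Code δ] [Code σ]

@[simp] theorem enc_pair (x : α) (y : β) : enc (x, y) = .cons (enc x) (enc y) := rfl
@[simp] theorem enc_list_nil : enc ([] : List α) = .nil := rfl
@[simp] theorem enc_list_cons (x : α) (l : List α) : enc (x :: l) = .cons (enc x) (enc l) := rfl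

theorem enc_replicate_unit (j : ℕ) : enc (List.replicate j ()) = enc j := by
  induction j with
  | zero => rfl
  | succ j ih => simp [List.replicate_succ, ih]

theorem Runs.assign_of_eq {i : ℕ} {e : Exp} {s : Store} {v : Dat} (h : e.eval s = v) :
    Runs (.assign i e) s (e.cost + 1) (Function.update s i v) :=
  h ▸ .assign i e s

/-- The function `f` is computed by a program, from an input in variable `0` to an output in
variable `0`, within `T a` steps on input `a`. The program works from arbitrary contents of the other
variables, and leaves all but finitely many variables untouched. -/
def Comp (f : α → β) (T : α → ℕ) : Prop :=
  ∃ (p : Prog) (w : ℕ), ∀ (s : Store) (a : α), s 0 = enc a →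
    ∃ t s', Runs p s t s' ∧ t ≤ T a ∧ s' 0 = enc (f a) ∧ ∀ i, w < i → s' i = s i

theorem Comp.mono {f : α → β} {T T' : α → ℕ} (h : Comp f T) (hT : ∀ a, T a ≤ T' a) :
    Comp f T' := by
  obtain ⟨p, w, h⟩ := h
  refine ⟨p, w, fun s a hs => ?_⟩
  obtain ⟨t, s', h1, h2, h3⟩ := h s a hs
  exact ⟨t, s', h1, h2.trans (hT a), h3⟩

theorem Comp.of_exp {f : α → β} (e : Exp)
    (h : ∀ (s : Store) (a : α), s 0 = enc a → e.eval s = enc (f a)) :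
    Comp f (fun _ => e.cost + 1) := by
  refine ⟨.assign 0 e, 0, fun s a hs => ⟨_, _, .assign 0 e s, le_rfl, by simp [h s a hs], ?_⟩⟩
  intro i hi
  simp [Function.update_of_ne hi.ne']

theorem Comp.of_test {f : α → β} (c e e' : Exp)
    (h : ∀ (s : Store) (a : α), s 0 = enc a →
      (c.eval s ≠ .nil → e.eval s = enc (f a)) ∧ (c.eval s = .nil → e'.eval s = enc (f a))) :
    Comp f (fun _ => c.cost + 1 + (e.cost + 1) + (e'.cost + 1)) := by
  refine ⟨.ite c (.assign 0 e) (.assign 0 e'), 0, fun s a hs => ?_⟩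
  by_cases hc : c.eval s = .nil
  · refine ⟨_, _, .ite_fail hc (.assign 0 e' s), by dsimp only; omega, by simp [(h s a hs).2 hc], ?_⟩
    intro i hi
    simp [Function.update_of_ne hi.ne']
  · refine ⟨_, _, .ite_pass hc (.assign 0 e s), by dsimp only; omega, by simp [(h s a hs).1 hc], ?_⟩
    intro i hi
    simp [Function.update_of_ne hi.ne']

theorem Comp.comp {g : β → γ} {f : α → β} {Tg : β → ℕ} {Tf : α → ℕ} (hg : Comp g Tg)
    (hf : Comp f Tf) : Comp (fun a => g (f a)) (fun a => Tf a + Tg (f a)) := by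
  obtain ⟨p, w, hp⟩ := hf
  obtain ⟨q, v, hq⟩ := hg
  refine ⟨.seq p q, max w v, fun s a hs => ?_⟩
  obtain ⟨t, s', h1, h2, h3, h4⟩ := hp s a hs
  obtain ⟨t', s'', h1', h2', h3', h4'⟩ := hq s' (f a) h3
  refine ⟨_, _, .seq h1 h1', add_le_add h2 h2', h3', fun i hi => ?_⟩
  rw [h4' i (lt_of_le_of_lt (le_max_right _ _) hi), h4 i (lt_of_le_of_lt (le_max_left _ _) hi)]

theorem Comp.pair {f : α → β} {g : α → γ} {Tf Tg : α → ℕ} (hf : Comp f Tf) (hg : Comp g Tg) :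
    Comp (fun a => (f a, g a)) (fun a => Tf a + Tg a + 10) := by
  obtain ⟨p, w, hp⟩ := hf
  obtain ⟨q, v, hq⟩ := hg
  obtain ⟨m, hwm, hvm⟩ : ∃ m, w ≤ m ∧ v ≤ m := ⟨max w v, le_max_left _ _, le_max_right _ _⟩
  refine ⟨.seq (.assign (m + 1) (.var 0)) (.seq p (.seq (.assign (m + 2) (.var 0))
    (.seq (.assign 0 (.var (m + 1))) (.seq q (.assign 0 (.cons (.var (m + 2)) (.var 0))))))),
    m + 2, fun s a hs => ?_⟩
  obtain ⟨t, s', h1, h2, h3, h4⟩ := hp (Function.update s (m + 1) (s 0)) a (by simp [hs])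
  have e1 : s' (m + 1) = enc a := by rw [h4 _ (by omega)]; simp [hs]
  obtain ⟨t', s'', h1', h2', h3', h4'⟩ :=
    hq (Function.update (Function.update s' (m + 2) (s' 0)) 0 (s' (m + 1))) a (by simp [e1])
  have e2 : s'' (m + 2) = enc (f a) := by rw [h4' _ (by omega)]; simp [h3]
  refine ⟨_, _, .seq (.assign_of_eq rfl) (.seq h1 (.seq (.assign_of_eq rfl)
    (.seq (.assign_of_eq (by simp [Exp.eval])) (.seq h1' (.assign_of_eq rfl))))), ?_, ?_, ?_⟩
  · simp only [Exp.cost]; omega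
  · simp [Exp.eval, e2, h3']
  · intro i hi
    rw [Function.update_of_ne (by omega), h4' i (by omega), Function.update_of_ne (by omega),
      Function.update_of_ne (by omega), h4 i (by omega), Function.update_of_ne (by omega)]

theorem Comp.cond {c : α → Bool} {f g : α → β} {Tc Tf Tg : α → ℕ} (hc : Comp c Tc)
    (hf : Comp f Tf) (hg : Comp g Tg) :
    Comp (fun a => bif c a then f a else g a)
      (fun a => Tc a + (bif c a then Tf a else Tg a) + 10) := by
  obtain ⟨r, u, hr⟩ := hc
  obtain ⟨p, w, hp⟩ := hf
  obtain ⟨q, v, hq⟩ := hg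
  obtain ⟨m, hum, hwm, hvm⟩ : ∃ m, u ≤ m ∧ w ≤ m ∧ v ≤ m :=
    ⟨max u (max w v), by simp, by simp, by simp⟩
  refine ⟨.seq (.assign (m + 1) (.var 0)) (.seq r (.seq (.assign (m + 2) (.var 0))
    (.seq (.assign 0 (.var (m + 1))) (.ite (.var (m + 2)) p q)))), m + 2, fun s a hs => ?_⟩
  obtain ⟨t, s', h1, h2, h3, h4⟩ := hr (Function.update s (m + 1) (s 0)) a (by simp [hs])
  have e1 : s' (m + 1) = enc a := by rw [h4 _ (by omega)]; simp [hs]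
  set s2 := Function.update (Function.update s' (m + 2) (s' 0)) 0 (s' (m + 1)) with hs2
  have e0 : s2 0 = enc a := by simp [hs2, e1]
  have e2 : s2 (m + 2) = enc (c a) := by simp [hs2, h3]
  have e3 : ∀ i, m + 2 < i → s2 i = s i := by
    intro i hi
    rw [hs2, Function.update_of_ne (by omega), Function.update_of_ne (by omega), h4 i (by omega),
      Function.update_of_ne (by omega)]
  cases hca : c a
  · obtain ⟨t', s'', h1', h2', h3', h4'⟩ := hq s2 a e0
    refine ⟨_, s'', .seq (.assign_of_eq rfl) (.seq h1 (.seq (.assign_of_eq rfl)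
      (.seq (.assign_of_eq (by simp [Exp.eval])) (.ite_fail ?_ h1')))), ?_, ?_, ?_⟩
    · simp [Exp.eval, h3, hca]
    · simp only [Exp.cost, hca, cond_false]; omega
    · simp [h3', hca]
    · intro i hi; rw [h4' i (by omega), e3 i hi]
  · obtain ⟨t', s'', h1', h2', h3', h4'⟩ := hp s2 a e0
    refine ⟨_, s'', .seq (.assign_of_eq rfl) (.seq h1 (.seq (.assign_of_eq rfl)
      (.seq (.assign_of_eq (by simp [Exp.eval])) (.ite_pass ?_ h1')))), ?_, ?_, ?_⟩
    · simp [Exp.eval, h3, hca]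
    · simp only [Exp.cost, hca, cond_true]; omega
    · simp [h3', hca]
    · intro i hi; rw [h4' i (by omega), e3 i hi]

theorem Comp.foldl {step : γ × σ × α → σ} {T : γ × σ × α → ℕ} (h : Comp step T) :
    Comp (fun q : γ × σ × List α => q.2.2.foldl (fun s a => step (q.1, s, a)) q.2.1)
      (fun q => foldCost step T q.1 q.2.1 q.2.2) := by
  obtain ⟨p, w, hp⟩ := h
  have key : ∀ (l : List α) (x : γ) (s0 : σ) (s : Store), s 0 = enc s0 → s (w + 1) = enc x →
      s (w + 2) = enc l → ∃ t s', Runs (.loop (.var (w + 2)) (.seq (.assign 0 (.cons (.var (w + 1))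
        (.cons (.var 0) (.hd (.var (w + 2)))))) (.seq (.assign (w + 2) (.tl (.var (w + 2)))) p)))
        s t s' ∧ t + 20 ≤ foldCost step T x s0 l ∧
        s' 0 = enc (l.foldl (fun s a => step (x, s, a)) s0) ∧ ∀ i, w + 2 < i → s' i = s i := by
    intro l
    induction l with
    | nil =>
      intro x s0 s h0 h1 h2
      exact ⟨_, s, .loop_fail (by simpa [Exp.eval] using h2), by simp [foldCost, Exp.cost], h0,
        fun _ _ => rfl⟩
    | cons a l ih =>
      intro x s0 s h0 h1 h2
      obtain ⟨t, s', r1, r2, r3, r4⟩ := hp (Function.update (Function.update s 0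
        (enc (x, s0, a))) (w + 2) (enc l)) (x, s0, a) (by simp)
      obtain ⟨t', s'', q1, q2, q3, q4⟩ := ih x (step (x, s0, a)) s' r3
        (by rw [r4 _ (by omega)]; simp [h1]) (by rw [r4 _ (by omega)]; simp)
      refine ⟨_, s'', .loop_pass ?_ (.seq (.assign_of_eq ?_) (.seq (.assign_of_eq ?_) r1)) q1, ?_,
        q3, ?_⟩
      · simp [Exp.eval, h2]
      · simp [Exp.eval, h0, h1, h2, Dat.hd]
      · simp [Exp.eval, h2, Dat.tl]
      · simp only [foldCost, Exp.cost]; omega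
      · intro i hi
        rw [q4 i hi, r4 i (by omega), Function.update_of_ne (by omega),
          Function.update_of_ne (by omega)]
  refine ⟨.seq (.assign (w + 1) (.hd (.var 0))) (.seq (.assign (w + 2) (.tl (.tl (.var 0))))
    (.seq (.assign 0 (.hd (.tl (.var 0)))) (.loop (.var (w + 2)) (.seq (.assign 0 (.cons (.var (w + 1))
        (.cons (.var 0) (.hd (.var (w + 2)))))) (.seq (.assign (w + 2) (.tl (.var (w + 2)))) p))))),
    w + 2, fun s q hs => ?_⟩
  obtain ⟨x, s0, l⟩ := q
  obtain ⟨t, s', r1, r2, r3, r4⟩ := key l x s0 (Function.update (Function.update (Function.update s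
    (w + 1) (enc x)) (w + 2) (enc l)) 0 (enc s0)) (by simp) (by simp) (by simp)
  refine ⟨_, s', .seq (.assign_of_eq ?_) (.seq (.assign_of_eq ?_) (.seq (.assign_of_eq ?_) r1)), ?_,
    r3, fun i hi => ?_⟩
  · simp [Exp.eval, hs, Dat.hd]
  · simp [Exp.eval, hs, Dat.tl]
  · simp [Exp.eval, hs, Dat.hd, Dat.tl]
  · simp only [Exp.cost]; omega
  · rw [r4 i hi, Function.update_of_ne (by omega), Function.update_of_ne (by omega),
      Function.update_of_ne (by omega)]

end

end WhileLang

/-! ### Polynomial time -/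

namespace WhileLang

open Code

section

variable {α β γ δ σ : Type} [Code α] [Code β] [Code γ] [Code δ] [Code σ]

/-- The size of the representation. -/
def sz (a : α) : ℕ := (enc a).size

@[simp] theorem sz_pair (x : α) (y : β) : sz (x, y) = sz x + sz y + 1 := rfl
@[simp] theorem sz_nil : sz ([] : List α) = 1 := rfl
@[simp] theorem sz_cons (x : α) (l : List α) : sz (x :: l) = sz x + sz l + 1 := rfl
@[simp] theorem sz_zero : sz (0 : ℕ) = 1 := rfl
theorem sz_nat (j : ℕ) : sz j = 2 * j + 1 := by
  induction j with
  | zero => rfl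
  | succ j ih =>
    have : sz (j + 1) = sz j + 2 := by simp only [sz, enc_succ, Dat.size]; omega
    omega
theorem sz_bool_le (b : Bool) : sz b ≤ 3 := by cases b <;> decide
theorem sz_pos (a : α) : 1 ≤ sz a := by
  unfold sz; cases enc a <;> simp [Dat.size]

theorem sz_append (l l' : List α) : sz (l ++ l') + 1 = sz l + sz l' := by
  induction l with
  | nil => simp [add_comm]
  | cons a l ih => simp only [List.cons_append, sz_cons]; omega

theorem sz_reverse (l : List α) : sz l.reverse = sz l := by
  induction l with
  | nil => rfl
  | cons a l ih => have := sz_append l.reverse [a]; simp at *; omega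

theorem length_lt_sz (l : List α) : l.length < sz l := by
  induction l with
  | nil => simp
  | cons a l ih => simp only [sz_cons, List.length_cons]; omega

theorem sz_le_of_mem {a : α} {l : List α} (h : a ∈ l) : sz a < sz l := by
  induction l with
  | nil => simp at h
  | cons b l ih =>
    rcases List.mem_cons.1 h with rfl | h
    · simp only [sz_cons]; omega
    · have := ih h; simp only [sz_cons]; omega

theorem sz_le_of_forall {l : List α} {B : ℕ} (h : ∀ a ∈ l, sz a ≤ B) :
    sz l ≤ l.length * (B + 1) + 1 := by
  induction l with
  | nil => simp
  | cons b l ih =>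
    have := ih fun a ha => h a (List.mem_cons_of_mem _ ha)
    have := h b (by simp)
    simp only [sz_cons, List.length_cons, Nat.succ_mul]; omega

theorem sz_le_of_sublist {l l' : List α} (h : l.Sublist l') : sz l ≤ sz l' := by
  induction h with
  | slnil => rfl
  | cons a _ ih => simp only [sz_cons]; omega
  | cons_cons a _ ih => simp only [sz_cons]; omega

/-- A function bounded by a polynomial in the size of its argument. -/
def PolyBd (T : α → ℕ) : Prop := ∃ c, ∀ a, T a ≤ (sz a + 2) ^ c

theorem PolyBd.mono {T T' : α → ℕ} (h : PolyBd T') (hT : ∀ a, T a ≤ T' a) : PolyBd T := by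
  obtain ⟨c, h⟩ := h
  exact ⟨c, fun a => (hT a).trans (h a)⟩

theorem PolyBd.const (k : ℕ) : PolyBd (fun _ : α => k) :=
  ⟨k, fun _ => (Nat.lt_two_pow_self).le.trans (Nat.pow_le_pow_left (by omega) _)⟩

theorem PolyBd.size : PolyBd (fun a : α => sz a) := ⟨1, fun a => by simp⟩

theorem PolyBd.add {T T' : α → ℕ} (h : PolyBd T) (h' : PolyBd T') :
    PolyBd (fun a => T a + T' a) := by
  obtain ⟨c, h⟩ := h
  obtain ⟨d, h'⟩ := h'
  refine ⟨c + d + 1, fun a => ?_⟩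
  have h1 := (h a).trans (Nat.pow_le_pow_right (n := sz a + 2) (by omega) (Nat.le_add_right c d))
  have h2 := (h' a).trans (Nat.pow_le_pow_right (n := sz a + 2) (by omega) (Nat.le_add_left d c))
  rw [pow_succ]
  nlinarith [Nat.zero_le ((sz a + 2) ^ (c + d)), Nat.zero_le (sz a)]

theorem PolyBd.mul {T T' : α → ℕ} (h : PolyBd T) (h' : PolyBd T') :
    PolyBd (fun a => T a * T' a) := by
  obtain ⟨c, h⟩ := h
  obtain ⟨d, h'⟩ := h'
  exact ⟨c + d, fun a => by rw [pow_add]; exact Nat.mul_le_mul (h a) (h' a)⟩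

theorem PolyBd.pow {T : α → ℕ} (h : PolyBd T) (c : ℕ) : PolyBd (fun a => T a ^ c) := by
  obtain ⟨d, h⟩ := h
  exact ⟨d * c, fun a => by rw [pow_mul]; exact Nat.pow_le_pow_left (h a) c⟩

theorem PolyBd.comp {T : β → ℕ} {f : α → β} (h : PolyBd T) (hf : PolyBd (fun a => sz (f a))) :
    PolyBd (fun a => T (f a)) := by
  obtain ⟨c, h⟩ := h
  exact ((hf.add (.const 2)).pow c).mono fun a => h (f a)

/-- Functions computable in polynomial time with results of polynomial size. -/
@[fun_prop]
def Poly (f : α → β) : Prop :=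
  (∃ T, Comp f T ∧ PolyBd T) ∧ PolyBd (fun a => sz (f a))

theorem Poly.of_comp {f : α → β} {T : α → ℕ} (h : Comp f T) (hT : PolyBd T)
    (hf : PolyBd (fun a => sz (f a))) : Poly f := ⟨⟨T, h, hT⟩, hf⟩

theorem Poly.congr_fun {f g : α → β} (h : Poly f) (e : ∀ x, f x = g x) : Poly g :=
  funext e ▸ h

@[fun_prop]
theorem Poly.id : Poly (fun a : α => a) :=
  .of_comp (.of_exp (.var 0) fun _ _ h => h) (.const _) .size

/-- An expression for a constant. -/
def Dat.toExp : Dat → Exp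
  | .nil => .nil
  | .cons x y => .cons x.toExp y.toExp

theorem Dat.eval_toExp (s : Store) (x : Dat) : x.toExp.eval s = x := by
  induction x with
  | nil => rfl
  | cons x y hx hy => simp [toExp, Exp.eval, hx, hy]

@[fun_prop]
theorem Poly.const (b : β) : Poly (fun _ : α => b) :=
  .of_comp (.of_exp (enc b).toExp fun _ _ _ => Dat.eval_toExp _ _) (.const _) (.const _)

@[fun_prop]
theorem Poly.comp {g : β → γ} {f : α → β} (hg : Poly g) (hf : Poly f) :
    Poly (fun a => g (f a)) := by
  obtain ⟨⟨T, h1, h2⟩, h3⟩ := hg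
  obtain ⟨⟨T', h1', h2'⟩, h3'⟩ := hf
  exact .of_comp (h1.comp h1') (h2'.add (h2.comp h3')) (h3.comp h3')

@[fun_prop]
theorem Poly.prodMk {f : α → β} {g : α → γ} (hf : Poly f) (hg : Poly g) :
    Poly (fun a => (f a, g a)) := by
  obtain ⟨⟨T, h1, h2⟩, h3⟩ := hf
  obtain ⟨⟨T', h1', h2'⟩, h3'⟩ := hg
  exact .of_comp (h1.pair h1') ((h2.add h2').add (.const _)) ((h3.add h3').add (.const 1))

theorem comp_fst : Comp (fun q : α × β => q.1) (fun _ => 3) :=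
  .of_exp (.hd (.var 0)) fun s a h => by simp [Exp.eval, h, enc, Dat.hd]

theorem comp_snd : Comp (fun q : α × β => q.2) (fun _ => 3) :=
  .of_exp (.tl (.var 0)) fun s a h => by simp [Exp.eval, h, enc, Dat.tl]

@[fun_prop]
theorem Poly.fst {f : α → β × γ} (hf : Poly f) : Poly (fun a => (f a).1) :=
  .comp (.of_comp comp_fst (.const _) (.mono .size fun a => by
    obtain ⟨x, y⟩ := a; simp only [sz_pair]; omega)) hf

@[fun_prop]
theorem Poly.snd {f : α → β × γ} (hf : Poly f) : Poly (fun a => (f a).2) :=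
  .comp (.of_comp comp_snd (.const _) (.mono .size fun a => by
    obtain ⟨x, y⟩ := a; simp only [sz_pair]; omega)) hf

@[fun_prop]
theorem Poly.cond {c : α → Bool} {f g : α → β} (hc : Poly c) (hf : Poly f) (hg : Poly g) :
    Poly (fun a => bif c a then f a else g a) := by
  obtain ⟨⟨T, h1, h2⟩, h3⟩ := hf
  obtain ⟨⟨T', h1', h2'⟩, h3'⟩ := hg
  obtain ⟨⟨T'', h1'', h2''⟩, -⟩ := hc
  refine .of_comp (h1''.cond h1 h1') (((h2''.add (h2.add h2')).add (.const 10)).mono fun a => ?_)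
    ((h3.add h3').mono fun a => ?_)
  · cases c a <;> simp only [cond_true, cond_false] <;> omega
  · cases c a <;> simp

theorem comp_cons : Comp (fun q : α × List α => q.1 :: q.2) (fun _ => 2) :=
  .of_exp (.var 0) fun s a h => by obtain ⟨x, l⟩ := a; simpa [Exp.eval] using h

@[fun_prop]
theorem Poly.cons {f : γ → α} {l : γ → List α} (hf : Poly f) (hl : Poly l) :
    Poly (fun x => f x :: l x) :=
  .comp (g := fun q : α × List α => q.1 :: q.2) (.of_comp comp_cons (.const _) .size) (hf.prodMk hl)

theorem comp_tail : Comp (fun l : List α => l.tail) (fun _ => 3) :=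
  .of_exp (.tl (.var 0)) fun s l h => by cases l <;> simp [Exp.eval, h, Dat.tl]

@[fun_prop]
theorem Poly.tail {l : γ → List α} (hl : Poly l) : Poly (fun x => (l x).tail) :=
  .comp (g := fun l : List α => l.tail) (.of_comp comp_tail (.const _)
    (.mono .size fun l => by cases l <;> simp only [List.tail_nil, List.tail_cons, sz_cons] <;> omega)) hl

theorem comp_headD : Comp (fun q : α × List α => q.2.headD q.1) (fun _ => 11) :=
  (Comp.of_test (.tl (.var 0)) (.hd (.tl (.var 0))) (.hd (.var 0)) fun s q h => by
    obtain ⟨x, l⟩ := q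
    cases l <;> simp [Exp.eval, h, Dat.tl, Dat.hd]).mono fun _ => by simp [Exp.cost]

@[fun_prop]
theorem Poly.headD {l : γ → List α} {d : γ → α} (hl : Poly l) (hd : Poly d) :
    Poly (fun x => (l x).headD (d x)) :=
  .comp (g := fun q : α × List α => q.2.headD q.1) (.of_comp comp_headD (.const _)
    (.mono .size fun q => by
      obtain ⟨x, l⟩ := q
      cases l <;> simp only [sz_pair, sz_cons, List.headD_nil, List.headD_cons] <;> omega))
    (hd.prodMk hl)

theorem comp_isEmpty : Comp (fun l : List α => l.isEmpty) (fun _ => 8) :=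
  (Comp.of_test (.var 0) .nil (.cons .nil .nil) fun s l h => by
    cases l <;> simp [Exp.eval, h]).mono fun _ => by simp [Exp.cost]

@[fun_prop]
theorem Poly.isEmpty {l : γ → List α} (hl : Poly l) : Poly (fun x => (l x).isEmpty) :=
  .comp (g := fun l : List α => l.isEmpty) (.of_comp comp_isEmpty (.const _)
    (.mono (.const 3) fun _ => sz_bool_le _)) hl

theorem Poly.foldl {l : γ → List α} {s : γ → σ} {step : γ → σ → α → σ} {B : γ → ℕ}
    (hl : Poly l) (hs : Poly s) (hstep : Poly (fun q : γ × σ × α => step q.1 q.2.1 q.2.2))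
    (hB : PolyBd B) (h : ∀ x l', l' <+: l x → sz (l'.foldl (step x) (s x)) ≤ B x) :
    Poly (fun x => (l x).foldl (step x) (s x)) := by
  refine ⟨?_, hB.mono fun x => h x _ (List.prefix_refl _)⟩
  obtain ⟨⟨T, h1, c, h2⟩, h3⟩ := hstep
  obtain ⟨⟨U, u1, u2⟩, u3⟩ := (Poly.id (α := γ)).prodMk (hs.prodMk hl)
  refine ⟨_, (Comp.foldl h1).comp u1, u2.add ?_⟩
  have hlb := hl.2
  refine PolyBd.mono (((hlb.mul ((((PolyBd.size.add hB).add hlb).add (.const 4)).pow c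
    |>.add (.const 30)))).add (.const 30)) fun x => ?_
  refine (foldCost_le _ _ _ ((sz x + B x + sz (l x) + 4) ^ c)
    (fun rest t => ∃ pre, pre ++ rest = l x ∧ t = pre.foldl (step x) (s x)) _ _ ⟨[], by simp⟩ ?_).trans ?_
  · rintro a rest t ⟨pre, hp, rfl⟩
    refine ⟨⟨pre ++ [a], by simp [hp]⟩, (h2 _).trans (Nat.pow_le_pow_left ?_ c)⟩
    have e1 := h x pre ⟨_, hp⟩
    have e2 := sz_le_of_mem (a := a) (l := l x) (by simp [← hp])
    simp only [sz_pair]; omega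
  · have := (length_lt_sz (l x)).le
    gcongr

end

end WhileLang

namespace WhileLang

open Code

theorem foldl_cons_map {α β : Type} (f : α → β) (l : List α) (s : List β) :
    l.foldl (fun s a => f a :: s) s = (l.map f).reverse ++ s := by
  induction l generalizing s with
  | nil => rfl
  | cons a l ih => simp [ih]

theorem foldl_cons_filter {α : Type} (p : α → Bool) (l : List α) (s : List α) :
    l.foldl (fun s a => bif p a then a :: s else s) s = (l.filter p).reverse ++ s := by
  induction l generalizing s with
  | nil => rfl
  | cons a l ih => cases h : p a <;> simp [ih, h]

theorem foldl_or_any {α : Type} (p : α → Bool) (l : List α) (s : Bool) :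
    l.foldl (fun s a => s || p a) s = (s || l.any p) := by
  induction l generalizing s with
  | nil => simp
  | cons a l ih => simp [ih, Bool.or_assoc]

theorem foldl_units {α : Type} (f : α → α) (j : ℕ) (s : α) :
    (List.replicate j ()).foldl (fun s _ => f s) s = f^[j] s := by
  induction j generalizing s with
  | zero => rfl
  | succ j ih => simp [List.replicate_succ, ih]

section

variable {α β γ δ σ : Type} [Code α] [Code β] [Code γ] [Code δ] [Code σ]

@[fun_prop]
theorem Poly.not {f : γ → Bool} (hf : Poly f) : Poly (fun x => !(f x)) :=
  (hf.cond (.const false) (.const true)).congr_fun fun x => by cases f x <;> rfl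

@[fun_prop]
theorem Poly.and {f g : γ → Bool} (hf : Poly f) (hg : Poly g) : Poly (fun x => f x && g x) :=
  (hf.cond hg (.const false)).congr_fun fun x => by cases f x <;> rfl

@[fun_prop]
theorem Poly.or {f g : γ → Bool} (hf : Poly f) (hg : Poly g) : Poly (fun x => f x || g x) :=
  (hf.cond (.const true) hg).congr_fun fun x => by cases f x <;> rfl

@[fun_prop]
theorem Poly.reverse {l : γ → List α} (hl : Poly l) : Poly (fun x => (l x).reverse) := by
  refine (Poly.foldl (step := fun _ (s : List α) (a : α) => a :: s) hl (.const [])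
    (by fun_prop) hl.2 fun x l' h => ?_).congr_fun fun x => ?_
  · rw [List.foldl_flip_cons_eq_append', List.append_nil, sz_reverse]
    exact sz_le_of_sublist h.sublist
  · rw [List.foldl_flip_cons_eq_append', List.append_nil]

@[fun_prop]
theorem Poly.map {l : γ → List α} {f : γ → α → β} (hl : Poly l)
    (hf : Poly (fun q : γ × α => f q.1 q.2)) : Poly (fun x => (l x).map (f x)) := by
  obtain ⟨c, hc⟩ := hf.2
  refine (Poly.foldl (step := fun x (s : List β) (a : α) => f x a :: s)
    (B := fun x => sz (l x) * ((sz x + sz (l x) + 3) ^ c + 1) + 1) hl (.const [])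
    ((hf.comp (f := fun q : γ × List β × α => (q.1, q.2.2)) (by fun_prop)).cons (by fun_prop))
    ((hl.2.mul ((((PolyBd.size.add hl.2).add (.const 3)).pow c).add (.const 1))).add (.const 1))
    fun x l' h => ?_).reverse.congr_fun fun x => ?_
  · rw [foldl_cons_map, List.append_nil, sz_reverse]
    refine (sz_le_of_forall (B := (sz x + sz (l x) + 3) ^ c) fun b hb => ?_).trans ?_
    · obtain ⟨a, ha, rfl⟩ := List.mem_map.1 hb
      refine (hc (x, a)).trans (Nat.pow_le_pow_left ?_ c)
      have := sz_le_of_mem (h.subset ha)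
      simp only [sz_pair]; omega
    · rw [List.length_map]
      have := h.length_le.trans (length_lt_sz (l x)).le
      gcongr
  · simp

@[fun_prop]
theorem Poly.filter {l : γ → List α} {p : γ → α → Bool} (hl : Poly l)
    (hp : Poly (fun q : γ × α => p q.1 q.2)) : Poly (fun x => (l x).filter (p x)) := by
  refine (Poly.foldl (step := fun x (s : List α) (a : α) => bif p x a then a :: s else s) hl
    (.const []) ((hp.comp (f := fun q : γ × List α × α => (q.1, q.2.2)) (by fun_prop)).cond
      (by fun_prop) (by fun_prop)) hl.2
    fun x l' h => ?_).reverse.congr_fun fun x => ?_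
  · rw [foldl_cons_filter, List.append_nil, sz_reverse]
    exact sz_le_of_sublist ((List.filter_sublist).trans h.sublist)
  · simp [foldl_cons_filter]

@[fun_prop]
theorem Poly.any {l : γ → List α} {p : γ → α → Bool} (hl : Poly l)
    (hp : Poly (fun q : γ × α => p q.1 q.2)) : Poly (fun x => (l x).any (p x)) := by
  refine (Poly.foldl (step := fun x (s : Bool) (a : α) => s || p x a) hl
    (.const false) (.or (by fun_prop) (hp.comp (f := fun q : γ × Bool × α => (q.1, q.2.2))
      (by fun_prop))) (PolyBd.const 3) fun x l' h => sz_bool_le _).congr_fun fun x => ?_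
  simp [foldl_or_any]

@[fun_prop]
theorem Poly.all {l : γ → List α} {p : γ → α → Bool} (hl : Poly l)
    (hp : Poly (fun q : γ × α => p q.1 q.2)) : Poly (fun x => (l x).all (p x)) :=
  (Poly.not (.any hl (p := fun x a => !p x a) (.not hp))).congr_fun fun x => by
    simp [List.not_any_eq_all_not]

@[fun_prop]
theorem Poly.append {l l' : γ → List α} (hl : Poly l) (hl' : Poly l') :
    Poly (fun x => l x ++ l' x) := by
  refine (Poly.foldl (step := fun _ (s : List α) (a : α) => a :: s) hl.reverse hl'
    (by fun_prop) (hl.2.add hl'.2) fun x m h => ?_).congr_fun fun x => ?_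
  · rw [List.foldl_flip_cons_eq_append']
    have h1 := sz_append m.reverse (l' x)
    have h2 := sz_le_of_sublist h.sublist
    rw [sz_reverse] at h1 h2
    omega
  · rw [List.foldl_flip_cons_eq_append', List.reverse_reverse]

@[fun_prop]
theorem Poly.flatMap {l : γ → List α} {f : γ → α → List β} (hl : Poly l)
    (hf : Poly (fun q : γ × α => f q.1 q.2)) : Poly (fun x => (l x).flatMap (f x)) := by
  obtain ⟨c, hc⟩ := hf.2
  refine (Poly.foldl (step := fun x (s : List β) (a : α) => s ++ f x a)
    (B := fun x => sz (l x) * ((sz x + sz (l x) + 3) ^ c + 1) + 1) hl (.const [])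
    (.append (by fun_prop) (hf.comp (f := fun q : γ × List β × α => (q.1, q.2.2)) (by fun_prop)))
    ((hl.2.mul ((((PolyBd.size.add hl.2).add (.const 3)).pow c).add (.const 1))).add (.const 1))
    fun x l' h => ?_).congr_fun fun x => ?_
  · rw [← List.flatMap_eq_foldl]
    have key : ∀ m : List α, (∀ a ∈ m, a ∈ l x) →
        sz (m.flatMap (f x)) ≤ m.length * ((sz x + sz (l x) + 3) ^ c + 1) + 1 := by
      intro m
      induction m with
      | nil => simp
      | cons a m ih =>
        intro hm
        have h1 := ih fun b hb => hm b (List.mem_cons_of_mem _ hb)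
        have h2 := sz_append (f x a) (m.flatMap (f x))
        have h3 : sz (f x a) ≤ (sz x + sz (l x) + 3) ^ c := by
          refine (hc (x, a)).trans (Nat.pow_le_pow_left ?_ c)
          have := sz_le_of_mem (hm a (by simp))
          simp only [sz_pair]; omega
        rw [List.flatMap_cons, List.length_cons, Nat.succ_mul]
        omega
    refine (key l' fun a ha => h.subset ha).trans ?_
    have := h.length_le.trans (length_lt_sz (l x)).le
    gcongr
  · rw [← List.flatMap_eq_foldl]

theorem poly_units : Poly (fun j : ℕ => List.replicate j ()) :=
  .of_comp (.of_exp (.var 0) fun s a h => by rw [enc_replicate_unit]; exact h) (.const _)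
    (.mono .size fun a => by simp [sz, enc_replicate_unit])

@[fun_prop]
theorem Poly.units {f : γ → ℕ} (hf : Poly f) : Poly (fun x => List.replicate (f x) ()) :=
  poly_units.comp hf

theorem poly_succ : Poly (fun j : ℕ => j + 1) :=
  .of_comp (.of_exp (.cons .nil (.var 0)) fun s a h => by simp [Exp.eval, h]) (.const _)
    (.mono (PolyBd.size.add (.const 2)) fun a => by simp only [sz_nat]; omega)

theorem poly_pred : Poly (fun j : ℕ => j - 1) :=
  .of_comp (.of_exp (.tl (.var 0)) fun s a h => by cases a <;> simp [Exp.eval, h, Dat.tl]) (.const _)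
    (.mono PolyBd.size fun a => by simp only [sz_nat]; omega)

theorem initial_units {l : List Unit} {j : ℕ} (h : l <+: List.replicate j ()) :
    ∃ i ≤ j, l = List.replicate i () :=
  ⟨l.length, by simpa using h.length_le, by
    rw [List.eq_replicate_iff]; exact ⟨rfl, fun _ _ => rfl⟩⟩

@[fun_prop]
theorem Poly.add {f g : γ → ℕ} (hf : Poly f) (hg : Poly g) : Poly (fun x => f x + g x) := by
  refine (Poly.foldl (step := fun _ (s : ℕ) (_ : Unit) => s + 1) hg.units hf
    (poly_succ.comp (by fun_prop)) (hf.2.add hg.2) fun x m h => ?_).congr_fun fun x => ?_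
  · obtain ⟨i, hi, rfl⟩ := initial_units h
    rw [foldl_units (fun s => s + 1), Nat.succ_iterate]
    simp only [sz_nat]; omega
  · rw [foldl_units (fun s => s + 1), Nat.succ_iterate]

@[fun_prop]
theorem Poly.sub {f g : γ → ℕ} (hf : Poly f) (hg : Poly g) : Poly (fun x => f x - g x) := by
  have e : ∀ i j : ℕ, (fun s => s - 1)^[i] j = j - i := fun i j => Nat.pred_iterate j i
  refine (Poly.foldl (step := fun _ (s : ℕ) (_ : Unit) => s - 1) hg.units hf
    (poly_pred.comp (by fun_prop)) (hf.2.add hg.2) fun x m h => ?_).congr_fun fun x => ?_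
  · obtain ⟨i, hi, rfl⟩ := initial_units h
    rw [foldl_units (fun s => s - 1), e]
    simp only [sz_nat]; omega
  · rw [foldl_units (fun s => s - 1), e]

@[fun_prop]
theorem Poly.ble {f g : γ → ℕ} (hf : Poly f) (hg : Poly g) :
    Poly (fun x => Nat.ble (f x) (g x)) :=
  (((hf.sub hg).units).isEmpty).congr_fun fun x => by
    rw [Bool.eq_iff_iff, Nat.ble_eq]
    simp [Nat.sub_eq_zero_iff_le]

@[fun_prop]
theorem Poly.beq {f g : γ → ℕ} (hf : Poly f) (hg : Poly g) : Poly (fun x => f x == g x) :=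
  ((hf.ble hg).and (hg.ble hf)).congr_fun fun x => by
    rw [Bool.eq_iff_iff, Bool.and_eq_true, Nat.ble_eq, Nat.ble_eq, beq_iff_eq]
    omega

@[fun_prop]
theorem Poly.min {f g : γ → ℕ} (hf : Poly f) (hg : Poly g) : Poly (fun x => Min.min (f x) (g x)) :=
  ((hf.ble hg).cond hf hg).congr_fun fun x => by
    cases h : Nat.ble (f x) (g x)
    · rw [← Bool.not_eq_true, Nat.ble_eq] at h; simp; omega
    · rw [Nat.ble_eq] at h; simp [h]

@[fun_prop]
theorem Poly.max {f g : γ → ℕ} (hf : Poly f) (hg : Poly g) : Poly (fun x => Max.max (f x) (g x)) :=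
  ((hf.ble hg).cond hg hf).congr_fun fun x => by
    cases h : Nat.ble (f x) (g x)
    · rw [← Bool.not_eq_true, Nat.ble_eq] at h; simp; omega
    · rw [Nat.ble_eq] at h; simp [h]

theorem poly_length : Poly (fun l : List α => l.length) := by
  refine (Poly.foldl (l := fun l : List α => l) (step := fun _ (s : ℕ) (_ : α) => s + 1) .id
    (.const 0) (by fun_prop) (B := fun l => 2 * sz l) ((PolyBd.const 2).mul .size)
    fun x m h => ?_).congr_fun fun x => ?_
  · rw [List.foldl_add_const, sz_nat]
    have := h.length_le
    have := length_lt_sz x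
    omega
  · rw [List.foldl_add_const]; omega

@[fun_prop]
theorem Poly.length {l : γ → List α} (hl : Poly l) : Poly (fun x => (l x).length) :=
  poly_length.comp hl

theorem poly_range : Poly List.range := by
  have e : ∀ i : ℕ, (fun s : List ℕ => s.length :: s)^[i] [] = (List.range i).reverse := by
    intro i
    induction i with
    | zero => rfl
    | succ i ih => rw [Function.iterate_succ_apply', ih]; simp [List.range_succ]
  refine (Poly.foldl (step := fun _ (s : List ℕ) (_ : Unit) => s.length :: s) poly_units
    (.const []) (by fun_prop) (B := fun j => j * (2 * j + 1 + 1) + 1) ?_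
    fun x m h => ?_).reverse.congr_fun fun x => ?_
  · have h : PolyBd (fun j : ℕ => j) := PolyBd.size.mono fun a => by simp only [sz_nat]; omega
    exact (h.mul ((((PolyBd.const 2).mul h).add (.const 1)).add (.const 1))).add (.const 1)
  · obtain ⟨i, hi, rfl⟩ := initial_units h
    rw [foldl_units (fun s : List ℕ => s.length :: s), e, sz_reverse]
    refine (sz_le_of_forall (B := 2 * x + 1) fun a ha => ?_).trans ?_
    · rw [List.mem_range] at ha; rw [sz_nat]; omega
    · rw [List.length_range]; gcongr
  · rw [foldl_units (fun s : List ℕ => s.length :: s), e, List.reverse_reverse]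

@[fun_prop]
theorem Poly.range {f : γ → ℕ} (hf : Poly f) : Poly (fun x => List.range (f x)) :=
  poly_range.comp hf

@[fun_prop]
theorem Poly.drop {l : γ → List α} {f : γ → ℕ} (hl : Poly l) (hf : Poly f) :
    Poly (fun x => (l x).drop (f x)) := by
  have e : ∀ (i : ℕ) (l : List α), List.tail^[i] l = l.drop i := by
    intro i
    induction i with
    | zero => intro l; rfl
    | succ i ih => intro l; rw [Function.iterate_succ_apply, ih, List.drop_tail]
  refine (Poly.foldl (step := fun _ (s : List α) (_ : Unit) => s.tail) hf.units hl
    (by fun_prop) hl.2 fun x m h => ?_).congr_fun fun x => ?_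
  · obtain ⟨i, hi, rfl⟩ := initial_units h
    rw [foldl_units List.tail, e]
    exact sz_le_of_sublist (List.drop_sublist _ _)
  · rw [foldl_units List.tail, e]

@[fun_prop]
theorem Poly.getD {l : γ → List α} {f : γ → ℕ} {d : γ → α} (hl : Poly l) (hf : Poly f)
    (hd : Poly d) : Poly (fun x => (l x).getD (f x) (d x)) :=
  ((hl.drop hf).headD hd).congr_fun fun x => by
    rw [List.headD_eq_head?_getD, List.head?_drop, List.getD_eq_getElem?_getD]

@[fun_prop]
theorem Poly.idxOf {l : γ → List ℕ} {f : γ → ℕ} (hl : Poly l) (hf : Poly f) :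
    Poly (fun x => (l x).idxOf (f x)) := by
  have e : ∀ (l : List ℕ) (v : ℕ), ((List.range l.length).filter fun i => l.getD i 0 == v).headD
      l.length = l.idxOf v := by
    intro l v
    induction l with
    | nil => rfl
    | cons a l ih =>
      rw [List.length_cons, List.range_succ_eq_map, List.filter_cons, List.idxOf_cons, ← ih]
      by_cases h : a = v
      · simp [h]
      · have h' : (a == v) = false := by simpa using h
        simp only [List.getD_cons_zero, h', Bool.false_eq_true, if_false, cond_false,
          List.filter_map, List.headD_eq_head?_getD, List.head?_map, Function.comp_def,
          List.getD_cons_succ]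
        cases (List.filter (fun x => l.getD x 0 == v) (List.range l.length)).head? <;> simp
  exact (Poly.headD (Poly.filter (p := fun x i => (l x).getD i 0 == f x)
    (Poly.range (Poly.length hl)) (by fun_prop)) (Poly.length hl)).congr_fun fun x => e _ _

@[fun_prop]
theorem Poly.beq_list {l l' : γ → List ℕ} (hl : Poly l) (hl' : Poly l') :
    Poly (fun x => l x == l' x) := by
  refine (Poly.and (Poly.beq (Poly.length hl) (Poly.length hl')) (Poly.all
    (p := fun x i => (l x).getD i 0 == (l' x).getD i 0) (Poly.range (Poly.length hl))
    (by fun_prop))).congr_fun fun x => ?_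
  rw [Bool.eq_iff_iff]
  simp only [Bool.and_eq_true, beq_iff_eq, List.all_eq_true, List.mem_range]
  constructor
  · rintro ⟨h1, h2⟩
    refine List.ext_getElem h1 fun i hi hi' => ?_
    simpa [List.getD_eq_getElem, hi, hi'] using h2 i hi
  · intro h; simp [h]

@[fun_prop]
theorem Poly.contains {l : γ → List ℕ} {f : γ → ℕ} (hl : Poly l) (hf : Poly f) :
    Poly (fun x => (l x).contains (f x)) :=
  (Poly.any hl (p := fun x a => f x == a) (by fun_prop)).congr_fun fun x => by
    rw [List.contains_eq_any_beq]

end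

end WhileLang

/-! ### The algorithm -/

namespace WhileLang

open Code

/-- Graphs as adjacency matrices. -/
abbrev Mat : Type := List (List Bool)

/-- Adjacency in a graph given by its matrix. -/
def adj (g : Mat) (u v : ℕ) : Bool := (g.getD u []).getD v false

/-- The neighbours of `u` outside `A`. -/
def outNbrs (g : Mat) (A : List ℕ) (u : ℕ) : List ℕ :=
  (List.range g.length).filter fun w => !A.contains w && adj g u w

/-- The edges between `A` and its complement. -/
def cutEdges (g : Mat) (A : List ℕ) : List (ℕ × ℕ) :=
  A.flatMap fun u => (outNbrs g A u).map fun w => (u, w)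

/-- The vertices of `A` with a neighbour outside `A`. -/
def bdry (g : Mat) (A : List ℕ) : List ℕ := A.filter fun u => !(outNbrs g A u).isEmpty

/-- The edges between `A` and its complement form a complete bipartite graph. -/
def isJoin (g : Mat) (A : List ℕ) : Bool :=
  (bdry g A).all fun u => (bdry g A).all fun v => (outNbrs g A u).all fun w => adj g v w

/-- The part of a node that is relevant for its parent, apart from its table: a set `A` of vertices,
the cover, the boundary if the cut is a split that has no small cover, and a number of colours. -/
abbrev Side : Type := List ℕ × List ℕ × List ℕ × ℕ

/-- The data used for evaluating one colouring at a node: the graph, the number of colours, the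
number of colours of the bag, the two children and the node. -/
abbrev Env : Type := Mat × ℕ × ℕ × Side × Side × Side

/-- The graph. -/
def Env.g (e : Env) : Mat := e.1
/-- The number of colours. -/
def Env.t (e : Env) : ℕ := e.2.1
/-- The number of colours of the bag. -/
def Env.q (e : Env) : ℕ := e.2.2.1
/-- The left child. -/
def Env.l (e : Env) : Side := e.2.2.2.1
/-- The right child. -/
def Env.r (e : Env) : Side := e.2.2.2.2.1
/-- The node. -/
def Env.x (e : Env) : Side := e.2.2.2.2.2

/-- The set of vertices. -/
def Side.set (s : Side) : List ℕ := s.1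
/-- The cover. -/
def Side.cov (s : Side) : List ℕ := s.2.1
/-- The boundary, for splits. -/
def Side.bd (s : Side) : List ℕ := s.2.2.1
/-- The number of colours on the boundary. -/
def Side.num (s : Side) : ℕ := s.2.2.2

/-- The bag of a node. -/
def Env.bag (e : Env) : List ℕ := e.x.cov ++ (e.l.cov ++ e.r.cov)

/-- The colour of `v` in a colouring of the bag. -/
def Env.look (e : Env) (f : List ℕ) (v : ℕ) : ℕ := f.getD (e.bag.idxOf v) 0

/-- The colours of the vertices in `S`. -/
def Env.cols (e : Env) (f S : List ℕ) : List ℕ :=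
  (List.range e.q).filter fun c => S.any fun v => e.look f v == c

/-- The colours forbidden for the boundary of a child. -/
def Env.forb (e : Env) (f : List ℕ) (s : Side) : List ℕ :=
  e.cols f (e.bag.filter fun v => !s.set.contains v && s.bd.any fun u => adj e.g u v)

/-- The colours of the bag on the boundary of the node. -/
def Env.outer (e : Env) (f : List ℕ) : List ℕ :=
  e.cols f (e.bag.filter fun v => e.x.bd.contains v)

/-- The boundaries of the children are adjacent. -/
def Env.joined (e : Env) : Bool := e.l.bd.any fun u => e.r.bd.any fun v => adj e.g u v

/-- The number of colours of the boundary of a child that lies on the boundary of the node. -/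
def Env.part (e : Env) (s : Side) : ℕ := bif s.bd.any fun u => e.x.bd.contains u then s.num else 0

/-- The conditions on a colouring of the bag that do not concern the tables. -/
def Env.consistent (e : Env) (f : List ℕ) : Bool :=
  (e.bag.all fun u => e.bag.all fun v => !(adj e.g u v && e.look f u == e.look f v)) &&
  (Nat.ble (e.l.num + (e.forb f e.l).length) e.t && (Nat.ble (e.r.num + (e.forb f e.r).length) e.t &&
    (!e.joined || Nat.ble (e.l.num + e.r.num +
      ((e.forb f e.l).filter fun c => (e.forb f e.r).contains c).length) e.t)))

/-- The number of colours on the boundary of the node, for a colouring of the bag. -/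
def Env.val (e : Env) (f : List ℕ) : ℕ :=
  min e.t (bif e.joined then e.part e.l + e.part e.r else
    (e.outer f).length +
      max (e.part e.l - ((e.outer f).filter fun c => !(e.forb f e.l).contains c).length)
        (e.part e.r - ((e.outer f).filter fun c => !(e.forb f e.r).contains c).length))

/-- A table of colourings of a cover. -/
abbrev Table : Type := List (List ℕ)

/-- The table contains the restriction of a colouring to a cover. -/
def Env.inTable (e : Env) (f : List ℕ) (C : List ℕ) (T : Table) : Bool :=
  T.foldl (fun b h => b || C.map (e.look f) == h) false

/-- The colouring of the bag comes from a colouring of the vertices below the node. -/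
def Env.feas (e : Env) (TL TR : Table) (f : List ℕ) : Bool :=
  bif e.consistent f then (bif e.inTable f e.l.cov TL then e.inTable f e.r.cov TR else false) else false

/-- All words of a given length, in the letters `0, …, q - 1`. -/
def words (q : ℕ) (j : ℕ) : Table :=
  (List.replicate j ()).foldl (fun acc _ => acc.foldl (fun out f =>
    (List.range q).foldl (fun out c => (c :: f) :: out) out) []) [[]]

/-- One step of the search for covers: the sets that do not cover the edge are extended. -/
def coverStep (κ : ℕ) (L : Table) (uv : ℕ × ℕ) : Table :=
  L.foldl (fun out C => bif C.contains uv.1 || C.contains uv.2 then C :: out else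
    bif Nat.ble κ C.length then out else (uv.1 :: C) :: (uv.2 :: C) :: out) []

/-- A list of covers with at most `κ` elements of a list of edges, among them all minimal ones. -/
def covers (κ : ℕ) (E : List (ℕ × ℕ)) : Table := E.foldl (coverStep κ) [[]]

/-- A cover is preferred if it is smaller, or of the same size with fewer elements outside `A`. -/
def prefers (A C C' : List ℕ) : Bool :=
  !Nat.ble C'.length C.length || (C.length == C'.length &&
    !Nat.ble (C'.filter fun v => !A.contains v).length (C.filter fun v => !A.contains v).length)

/-- The preferred cover of a list. -/
def best (A : List ℕ) (L : Table) : List ℕ :=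
  L.foldl (fun b C => bif prefers A C b then C else b) (L.headD [])

/-- The cover of the cut of `A` if it has at most `κ` elements, else the boundary if the cut is a
complete bipartite graph; the last component says that one of the two is the case. -/
def cutInfo (g : Mat) (κ : ℕ) (A : List ℕ) : List ℕ × List ℕ × Bool :=
  bif (covers κ (cutEdges g A)).isEmpty then
    (bif isJoin g A then ([], bdry g A, true) else ([], [], false))
  else (best A (covers κ (cutEdges g A)), [], true)

/-- The parameters: the graph, the size of covers, the number of colours, and that of the bags. -/
abbrev Par : Type := Mat × ℕ × ℕ × ℕ

/-- A node with its table. -/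
abbrev Node : Type := Side × Table

/-- The environment of a node. -/
def mkEnv (p : Par) (a b : Side) (A : List ℕ) (i : List ℕ × List ℕ × Bool) : Env :=
  (p.1, p.2.2.1, p.2.2.2, a, b, (A, i.1, i.2.1, 0))

/-- The node of a leaf. -/
def leafNode (p : Par) (v : ℕ) : Node :=
  (([v], (cutInfo p.1 p.2.1 [v]).1, [], 0), words p.2.2.2 (cutInfo p.1 p.2.1 [v]).1.length)

/-- The table of a node, from the tables of its children. -/
def nodeTable (e : Env) (TL TR : Table) (W W' : Table) : Table :=
  W.foldl (fun out f => bif W'.foldl (fun b f' => b || e.feas TL TR (f ++ f')) false then f :: out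
    else out) []

/-- The number of colours of the boundary of a node, from the tables of its children. -/
def nodeNum (e : Env) (TL TR : Table) (W' : Table) : ℕ :=
  bif e.x.bd.isEmpty then 0 else
    W'.foldl (fun j f' => bif e.feas TL TR f' then min j (e.val f') else j) e.t

/-- The computation at a node with environment `e`. -/
def finishNode (e : Env) (ok : Bool) (TL TR : Table) : Node :=
  ((e.x.set, e.x.cov, e.x.bd, nodeNum e TL TR (words e.q (e.l.cov ++ e.r.cov).length)),
    bif ok then nodeTable e TL TR (words e.q e.x.cov.length)
      (words e.q (e.l.cov ++ e.r.cov).length) else [])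

/-- The node with two given children. -/
def joinNode (p : Par) (a b : Node) : Node :=
  finishNode (mkEnv p a.1 b.1 (a.1.set ++ b.1.set) (cutInfo p.1 p.2.1 (a.1.set ++ b.1.set)))
    (cutInfo p.1 p.2.1 (a.1.set ++ b.1.set)).2.2 a.2 b.2

/-- A dummy node. -/
def noNode : Node := (([], [], [], 0), [])

/-- One step of the evaluation of a tree in postorder. -/
def evalStep (p : Par) (st : List Node) (i : List ℕ) : List Node :=
  bif i.isEmpty then joinNode p (st.headD noNode) (st.tail.headD noNode) :: st.tail.tail
  else leafNode p (i.headD 0) :: st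

/-- Decides whether a graph can be coloured with `t` colours, given a decomposition in postorder
all of whose cuts are complete bipartite or have a cover of at most `κ` vertices. -/
def decideCol (g : Mat) (items : List (List ℕ)) (κ t : ℕ) : Bool :=
  !((items.foldl (evalStep (g, κ, t, min t (κ + κ + κ))) []).headD noNode).2.isEmpty

/-- One step of the traversal of a tree, with a stack of nodes together with their parents. -/
def visit (T : Mat) (d : List (List ℕ)) (s : List (ℕ × ℕ) × List (List ℕ)) :
    List (ℕ × ℕ) × List (List ℕ) :=
  bif s.1.isEmpty then s else
    let x := (s.1.headD (0, 0)).1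
    let p := (s.1.headD (0, 0)).2
    let kids := (List.range T.length).filter fun y => adj T x y && !(y == p)
    let lf := d.getD x []
    (kids.map (fun y => (y, x)) ++ s.1.tail, (bif lf.isEmpty then [] else [lf]) ++
      ((bif kids.length + lf.length == 2 then [[]] else []) ++ s.2))

/-- The postorder of a branch decomposition. -/
def postorder (T : Mat) (d : List (List ℕ)) : List (List ℕ) :=
  let r := ((List.range T.length).filter fun x => !(d.getD x []).isEmpty).headD 0
  ((List.replicate T.length ()).foldl (fun s _ => visit T d s) ([(r, r)], [])).2

/-- The candidates for the size of covers and for the number of colours. -/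
def candidates (n : ℕ) : List (ℕ × ℕ) :=
  (List.range n).flatMap fun κ => (List.range n).map fun t => (κ + 1, t + 1)

/-- The chromatic number. -/
def chromatic (g : Mat) (items : List (List ℕ)) (l : List (ℕ × ℕ)) : ℕ :=
  l.foldl (fun (r : ℕ) c => bif !Nat.ble r 0 then r else
    bif decideCol g items c.1 c.2 then c.2 else 0) 0

/-- The algorithm. -/
def solve (inp : Mat × Mat × List (List ℕ)) : ℕ :=
  chromatic inp.1 (postorder inp.2.1 inp.2.2) (candidates inp.1.length)

section

variable {γ : Type} [Code γ]

@[fun_prop]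
theorem poly_adj {g : γ → Mat} {u : γ → ℕ} {v : γ → ℕ}
    (hg : Poly g) (hu : Poly u) (hv : Poly v) : Poly (fun x => adj (g x) (u x) (v x)) := by
  unfold adj; fun_prop

@[fun_prop]
theorem poly_outNbrs {g : γ → Mat} {A : γ → List ℕ} {u : γ → ℕ}
    (hg : Poly g) (hA : Poly A) (hu : Poly u) : Poly (fun x => outNbrs (g x) (A x) (u x)) := by
  unfold outNbrs; fun_prop

@[fun_prop]
theorem poly_cutEdges {g : γ → Mat} {A : γ → List ℕ}
    (hg : Poly g) (hA : Poly A) : Poly (fun x => cutEdges (g x) (A x)) := by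
  unfold cutEdges; fun_prop

@[fun_prop]
theorem poly_bdry {g : γ → Mat} {A : γ → List ℕ}
    (hg : Poly g) (hA : Poly A) : Poly (fun x => bdry (g x) (A x)) := by
  unfold bdry; fun_prop

@[fun_prop]
theorem poly_isJoin {g : γ → Mat} {A : γ → List ℕ}
    (hg : Poly g) (hA : Poly A) : Poly (fun x => isJoin (g x) (A x)) := by
  unfold isJoin; fun_prop

@[fun_prop]
theorem poly_prefers {A : γ → List ℕ} {C : γ → List ℕ} {D : γ → List ℕ}
    (hA : Poly A) (hC : Poly C) (hD : Poly D) : Poly (fun x => prefers (A x) (C x) (D x)) := by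
  unfold prefers; fun_prop

@[fun_prop]
theorem poly_g {e : γ → Env}
    (he : Poly e) : Poly (fun x => Env.g (e x)) := by
  unfold Env.g; fun_prop

@[fun_prop]
theorem poly_t {e : γ → Env}
    (he : Poly e) : Poly (fun x => Env.t (e x)) := by
  unfold Env.t; fun_prop

@[fun_prop]
theorem poly_q {e : γ → Env}
    (he : Poly e) : Poly (fun x => Env.q (e x)) := by
  unfold Env.q; fun_prop

@[fun_prop]
theorem poly_l {e : γ → Env}
    (he : Poly e) : Poly (fun x => Env.l (e x)) := by
  unfold Env.l; fun_prop

@[fun_prop]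
theorem poly_r {e : γ → Env}
    (he : Poly e) : Poly (fun x => Env.r (e x)) := by
  unfold Env.r; fun_prop

@[fun_prop]
theorem poly_x {e : γ → Env}
    (he : Poly e) : Poly (fun x => Env.x (e x)) := by
  unfold Env.x; fun_prop

@[fun_prop]
theorem poly_set {s : γ → Side}
    (hs : Poly s) : Poly (fun x => Side.set (s x)) := by
  unfold Side.set; fun_prop

@[fun_prop]
theorem poly_cov {s : γ → Side}
    (hs : Poly s) : Poly (fun x => Side.cov (s x)) := by
  unfold Side.cov; fun_prop

@[fun_prop]
theorem poly_bd {s : γ → Side}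
    (hs : Poly s) : Poly (fun x => Side.bd (s x)) := by
  unfold Side.bd; fun_prop

@[fun_prop]
theorem poly_num {s : γ → Side}
    (hs : Poly s) : Poly (fun x => Side.num (s x)) := by
  unfold Side.num; fun_prop

@[fun_prop]
theorem poly_bag {e : γ → Env}
    (he : Poly e) : Poly (fun x => Env.bag (e x)) := by
  unfold Env.bag; fun_prop

@[fun_prop]
theorem poly_look {e : γ → Env} {f : γ → List ℕ} {v : γ → ℕ}
    (he : Poly e) (hf : Poly f) (hv : Poly v) : Poly (fun x => Env.look (e x) (f x) (v x)) := by
  unfold Env.look; fun_prop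

@[fun_prop]
theorem poly_cols {e : γ → Env} {f : γ → List ℕ} {S : γ → List ℕ}
    (he : Poly e) (hf : Poly f) (hS : Poly S) : Poly (fun x => Env.cols (e x) (f x) (S x)) := by
  unfold Env.cols; fun_prop

@[fun_prop]
theorem poly_forb {e : γ → Env} {f : γ → List ℕ} {s : γ → Side}
    (he : Poly e) (hf : Poly f) (hs : Poly s) : Poly (fun x => Env.forb (e x) (f x) (s x)) := by
  unfold Env.forb; fun_prop

@[fun_prop]
theorem poly_outer {e : γ → Env} {f : γ → List ℕ}
    (he : Poly e) (hf : Poly f) : Poly (fun x => Env.outer (e x) (f x)) := by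
  unfold Env.outer; fun_prop

@[fun_prop]
theorem poly_joined {e : γ → Env}
    (he : Poly e) : Poly (fun x => Env.joined (e x)) := by
  unfold Env.joined; fun_prop

@[fun_prop]
theorem poly_part {e : γ → Env} {s : γ → Side}
    (he : Poly e) (hs : Poly s) : Poly (fun x => Env.part (e x) (s x)) := by
  unfold Env.part; fun_prop

@[fun_prop]
theorem poly_consistent {e : γ → Env} {f : γ → List ℕ}
    (he : Poly e) (hf : Poly f) : Poly (fun x => Env.consistent (e x) (f x)) := by
  unfold Env.consistent; fun_prop

@[fun_prop]
theorem poly_val {e : γ → Env} {f : γ → List ℕ}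
    (he : Poly e) (hf : Poly f) : Poly (fun x => Env.val (e x) (f x)) := by
  unfold Env.val; fun_prop

@[fun_prop]
theorem poly_visit {T : γ → Mat} {d : γ → List (List ℕ)} {s : γ → List (ℕ × ℕ) × List (List ℕ)}
    (hT : Poly T) (hd : Poly d) (hs : Poly s) : Poly (fun x => visit (T x) (d x) (s x)) := by
  unfold visit; fun_prop

@[fun_prop]
theorem poly_candidates {n : γ → ℕ}
    (hn : Poly n) : Poly (fun x => candidates (n x)) := by
  unfold candidates; fun_prop

end

end WhileLang

/-! ### Covers of cuts -/

namespace SplitMatching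

section

variable {r : ℕ → ℕ → Prop} {A B X C D : Finset ℕ} {κ : ℕ}

/-- `C` meets every edge between `A` and its complement. -/
def IsCov (r : ℕ → ℕ → Prop) (A C : Finset ℕ) : Prop :=
  ∀ u ∈ A, ∀ w, w ∉ A → r u w → u ∈ C ∨ w ∈ C

/-- `C` is a smallest cover, and among these it has the fewest elements outside `A`. -/
structure IsBest (r : ℕ → ℕ → Prop) (A C : Finset ℕ) : Prop where
  cov : IsCov r A C
  le : ∀ D, IsCov r A D → C.card ≤ D.card
  out_le : ∀ D, IsCov r A D → D.card = C.card → (C \ A).card ≤ (D \ A).card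

theorem card_split (C A : Finset ℕ) : C.card = (C ∩ A).card + (C \ A).card :=
  (Finset.card_inter_add_card_sdiff C A).symm

theorem IsBest.inter_le (h : IsBest r A C) (hD : IsCov r A D) (e : D.card = C.card) :
    (D ∩ A).card ≤ (C ∩ A).card := by
  have := h.out_le D hD e
  have := card_split C A
  have := card_split D A
  omega

theorem IsBest.erase (h : IsBest r A C) {u : ℕ} (hu : u ∈ C) : ¬ IsCov r A (C.erase u) := by
  intro hc
  have := h.le _ hc
  rw [Finset.card_erase_of_mem hu] at this
  have := Finset.card_pos.2 ⟨u, hu⟩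
  omega

theorem IsBest.exists_out (h : IsBest r A C) {u : ℕ} (hu : u ∈ C) (hA : u ∈ A) :
    ∃ w, w ∉ A ∧ r u w ∧ w ∉ C := by
  by_contra! hc
  refine h.erase hu fun v hv w hw e => ?_
  rcases h.cov v hv w hw e with h1 | h1
  · by_cases hvu : v = u
    · subst hvu
      exact Or.inr (Finset.mem_erase.2 ⟨fun e' => hw (e' ▸ hA), hc w hw e⟩)
    · exact Or.inl (Finset.mem_erase.2 ⟨hvu, h1⟩)
  · exact Or.inr (Finset.mem_erase.2 ⟨fun e' => hw (e' ▸ hA), h1⟩)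

theorem IsBest.exists_in (h : IsBest r A C) {w : ℕ} (hw : w ∈ C) (hA : w ∉ A) :
    ∃ u, u ∈ A ∧ r u w ∧ u ∉ C := by
  by_contra! hc
  refine h.erase hw fun v hv w' hw' e => ?_
  have hvw : v ≠ w := fun e' => hA (e' ▸ hv)
  rcases h.cov v hv w' hw' e with h1 | h1
  · exact Or.inl (Finset.mem_erase.2 ⟨hvw, h1⟩)
  · by_cases hww : w' = w
    · subst hww
      exact Or.inl (Finset.mem_erase.2 ⟨hvw, hc v hv e⟩)
    · exact Or.inr (Finset.mem_erase.2 ⟨hww, h1⟩)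

theorem card_union_three {P Q R : Finset ℕ} (h1 : Disjoint P Q) (h2 : Disjoint P R)
    (h3 : Disjoint Q R) : (P ∪ Q ∪ R).card = P.card + Q.card + R.card := by
  rw [Finset.card_union_of_disjoint (Finset.disjoint_union_left.2 ⟨h2, h3⟩),
    Finset.card_union_of_disjoint h1]

/-- Uncrossing the best covers of nested cuts. -/
theorem IsBest.nested (hAX : A ⊆ X) (h1 : IsBest r A C) (h2 : IsBest r X D) :
    D ∩ A ⊆ C ∧ C \ X ⊆ D := by
  set C' := ((C ∪ D) ∩ A) ∪ (C ∩ (X \ A)) ∪ ((C ∩ D) \ X) with hC'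
  set D' := ((C ∩ D) ∩ A) ∪ (D ∩ (X \ A)) ∪ ((C ∪ D) \ X) with hD'
  have k1 : IsCov r A C' := by
    intro u hu w hw e
    have h3 := h1.cov u hu w hw e
    have h4 : w ∉ X → u ∈ D ∨ w ∈ D := fun h => h2.cov u (hAX hu) w h e
    clear_value C' D'
    subst hC'
    simp only [Finset.mem_union, Finset.mem_inter, Finset.mem_sdiff]
    clear hD' h1 h2
    grind
  have k2 : IsCov r X D' := by
    intro u hu w hw e
    have h3 := h2.cov u hu w hw e
    have h4 : u ∈ A → u ∈ C ∨ w ∈ C := fun h => h1.cov u h w (fun h => hw (hAX h)) e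
    clear_value C' D'
    subst hD'
    simp only [Finset.mem_union, Finset.mem_inter, Finset.mem_sdiff]
    clear hC' h1 h2 k1
    grind
  have dis : ∀ P Q R : Finset ℕ, (P ∩ A ∪ Q ∩ (X \ A) ∪ R \ X).card =
      (P ∩ A).card + (Q ∩ (X \ A)).card + (R \ X).card := by
    intro P Q R
    apply card_union_three <;> rw [Finset.disjoint_left] <;> intro a ha hb <;>
      simp only [Finset.mem_inter, Finset.mem_sdiff] at ha hb
    · exact hb.2.2 ha.2
    · exact hb.2 (hAX ha.2)
    · exact hb.2 ha.2.1
  have split3 : ∀ P : Finset ℕ, P.card = (P ∩ A).card + (P ∩ (X \ A)).card + (P \ X).card := by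
    intro P
    rw [← dis P P P]
    congr 1
    ext a
    have := @hAX a
    simp only [Finset.mem_union, Finset.mem_inter, Finset.mem_sdiff]
    clear * - this
    grind
  have e1 : C'.card = _ := dis (C ∪ D) C (C ∩ D)
  have e2 : D'.card = _ := dis (C ∩ D) D (C ∪ D)
  have e3 := split3 C
  have e4 := split3 D
  have m1 : ((C ∪ D) ∩ A).card + (C ∩ D ∩ A).card = (C ∩ A).card + (D ∩ A).card := by
    rw [Finset.union_inter_distrib_right, Finset.inter_inter_distrib_right]
    exact Finset.card_union_add_card_inter _ _
  have m2 : ((C ∪ D) \ X).card + ((C ∩ D) \ X).card = (C \ X).card + (D \ X).card := by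
    rw [Finset.union_sdiff_distrib, show (C ∩ D) \ X = (C \ X) ∩ (D \ X) by
      ext a; simp only [Finset.mem_inter, Finset.mem_sdiff]; clear * -; grind]
    exact Finset.card_union_add_card_inter _ _
  have l1 := h1.le _ k1
  have l2 := h2.le _ k2
  have l3 : C'.card = C.card := by omega
  have l4 := h1.inter_le k1 l3
  have l5 : C' ∩ A = (C ∪ D) ∩ A := by
    ext a
    have := @hAX a
    simp only [hC', Finset.mem_union, Finset.mem_inter, Finset.mem_sdiff]
    clear * - this
    grind
  rw [l5] at l4
  have l6 : C ∩ A = (C ∪ D) ∩ A :=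
    Finset.eq_of_subset_of_card_le (Finset.inter_subset_inter_right Finset.subset_union_left) l4
  have l7 : (C ∩ D) \ X = C \ X := by
    refine Finset.eq_of_subset_of_card_le (Finset.sdiff_subset_sdiff Finset.inter_subset_left
      (le_refl _)) ?_
    rw [l6] at e3
    omega
  constructor
  · intro a ha
    have : a ∈ (C ∪ D) ∩ A := by
      simp only [Finset.mem_union, Finset.mem_inter] at ha ⊢; tauto
    rw [← l6] at this
    exact (Finset.mem_inter.1 this).1
  · intro a ha
    rw [← l7] at ha
    simp only [Finset.mem_inter, Finset.mem_sdiff] at ha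
    exact ha.1.2

/-- Uncrossing the best covers of disjoint cuts. -/
theorem IsBest.disjoint (hr : ∀ u v, r u v → r v u) (hAB : Disjoint A B) (h1 : IsBest r A C)
    (h2 : IsBest r B D) : D ∩ A ⊆ C := by
  rw [Finset.disjoint_left] at hAB
  set C' := ((C ∪ D) ∩ A) ∪ ((C ∩ D) ∩ B) ∪ (C \ (A ∪ B)) with hC'
  set D' := ((C ∩ D) ∩ A) ∪ ((C ∪ D) ∩ B) ∪ (D \ (A ∪ B)) with hD'
  have k1 : IsCov r A C' := by
    intro u hu w hw e
    have h3 := h1.cov u hu w hw e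
    have h4 : w ∈ B → w ∈ D ∨ u ∈ D := fun h => h2.cov w h u (hAB hu) (hr _ _ e)
    clear_value C' D'
    subst hC'
    simp only [Finset.mem_union, Finset.mem_inter, Finset.mem_sdiff]
    clear hD' h1 h2 hAB
    grind
  have k2 : IsCov r B D' := by
    intro u hu w hw e
    have h3 := h2.cov u hu w hw e
    have h4 : w ∈ A → w ∈ C ∨ u ∈ C := fun h => h1.cov w h u (fun h => hAB h hu) (hr _ _ e)
    clear_value C' D'
    subst hD'
    simp only [Finset.mem_union, Finset.mem_inter, Finset.mem_sdiff]
    clear hC' h1 h2 hAB k1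
    grind
  have dis : ∀ P Q R : Finset ℕ, (P ∩ A ∪ Q ∩ B ∪ R \ (A ∪ B)).card =
      (P ∩ A).card + (Q ∩ B).card + (R \ (A ∪ B)).card := by
    intro P Q R
    apply card_union_three <;> rw [Finset.disjoint_left] <;> intro a ha hb <;>
      simp only [Finset.mem_inter, Finset.mem_sdiff, Finset.mem_union] at ha hb
    · exact hAB ha.2 hb.2
    · exact hb.2 (Or.inl ha.2)
    · exact hb.2 (Or.inr ha.2)
  have split3 : ∀ P : Finset ℕ, P.card = (P ∩ A).card + (P ∩ B).card + (P \ (A ∪ B)).card := by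
    intro P
    rw [← dis P P P]
    congr 1
    ext a
    simp only [Finset.mem_union, Finset.mem_inter, Finset.mem_sdiff]
    clear * -
    grind
  have e1 : C'.card = _ := dis (C ∪ D) (C ∩ D) C
  have e2 : D'.card = _ := dis (C ∩ D) (C ∪ D) D
  have e3 := split3 C
  have e4 := split3 D
  have m : ∀ Y : Finset ℕ, ((C ∪ D) ∩ Y).card + (C ∩ D ∩ Y).card = (C ∩ Y).card + (D ∩ Y).card := by
    intro Y
    rw [Finset.union_inter_distrib_right, Finset.inter_inter_distrib_right]
    exact Finset.card_union_add_card_inter _ _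
  have m1 := m A
  have m2 := m B
  have l1 := h1.le _ k1
  have l2 := h2.le _ k2
  have l3 : C'.card = C.card := by omega
  have l4 := h1.inter_le k1 l3
  have l5 : C' ∩ A = (C ∪ D) ∩ A := by
    ext a
    have := @hAB a
    simp only [hC', Finset.mem_union, Finset.mem_inter, Finset.mem_sdiff]
    clear * - this
    grind
  rw [l5] at l4
  have l6 : C ∩ A = (C ∪ D) ∩ A :=
    Finset.eq_of_subset_of_card_le (Finset.inter_subset_inter_right Finset.subset_union_left) l4
  intro a ha
  have : a ∈ (C ∪ D) ∩ A := by
    simp only [Finset.mem_union, Finset.mem_inter] at ha ⊢; tauto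
  rw [← l6] at this
  exact (Finset.mem_inter.1 this).1

end

end SplitMatching

/-! ### Combining colourings at a node -/

namespace SplitMatching

section

variable {r : ℕ → ℕ → Prop} {A B X C D CA CB CX BA BB BX : Finset ℕ} {κ t : ℕ}

/-- A proper colouring of `S` with the colours `0, …, t - 1`. -/
def ColOn (r : ℕ → ℕ → Prop) (t : ℕ) (S : Finset ℕ) (g : ℕ → ℕ) : Prop :=
  (∀ u ∈ S, g u < t) ∧ ∀ u ∈ S, ∀ v ∈ S, r u v → g u ≠ g v

theorem ColOn.mono {S S' : Finset ℕ} {g : ℕ → ℕ} (h : ColOn r t S g) (hS : S' ⊆ S) :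
    ColOn r t S' g :=
  ⟨fun u hu => h.1 u (hS hu), fun u hu v hv => h.2 u (hS hu) v (hS hv)⟩

theorem ColOn.perm {S : Finset ℕ} {g : ℕ → ℕ} (h : ColOn r t S g) (π : Equiv.Perm ℕ)
    (hπ : ∀ x, x < t → π x < t) : ColOn r t S (fun v => π (g v)) :=
  ⟨fun u hu => hπ _ (h.1 u hu), fun u hu v hv e e' => h.2 u hu v hv e (π.injective e')⟩

/-- The vertices of `A` with a neighbour outside `A`. -/
def IsBdry (r : ℕ → ℕ → Prop) (A B : Finset ℕ) : Prop :=
  ∀ v, v ∈ B ↔ v ∈ A ∧ ∃ w, w ∉ A ∧ r v w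

/-- The edges between `A` and its complement form a complete bipartite graph. -/
def IsJoin (r : ℕ → ℕ → Prop) (A : Finset ℕ) : Prop :=
  ∀ u ∈ A, ∀ v ∈ A, ∀ w x, w ∉ A → x ∉ A → r u w → r v x → r v w

/-- A cut with a small best cover `C`, or with a complete bipartite graph of edges but no small
cover, and with boundary `B`. -/
def Kind (r : ℕ → ℕ → Prop) (κ : ℕ) (A C B : Finset ℕ) : Prop :=
  (IsBest r A C ∧ C.card ≤ κ ∧ B = ∅) ∨
    (C = ∅ ∧ IsBdry r A B ∧ IsJoin r A ∧ ∀ D, IsCov r A D → κ < D.card)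

theorem Kind.card_le (h : Kind r κ A C B) : C.card ≤ κ := by
  rcases h with h | h
  · exact h.2.1
  · simp [h.1]

theorem lt_card_bdry (h : IsBdry r A B) (h' : ∀ D, IsCov r A D → κ < D.card) : κ < B.card :=
  h' B fun u hu w hw e => Or.inl ((h u).2 ⟨hu, w, hw, e⟩)

theorem Kind.bd_subset (h : Kind r κ A C B) : B ⊆ A := by
  rcases h with ⟨-, -, rfl⟩ | ⟨-, h, -⟩
  · simp
  · exact fun v hv => ((h v).1 hv).1

theorem Kind.cov_eq_empty (h : Kind r κ A C B) (hB : B.Nonempty) : C = ∅ := by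
  rcases h with ⟨-, -, rfl⟩ | ⟨h, -⟩
  · simp at hB
  · exact h

theorem Kind.covered (h : Kind r κ A C B) {u w : ℕ} (hu : u ∈ A) (hw : w ∉ A) (e : r u w) :
    u ∈ C ∨ w ∈ C ∨ u ∈ B := by
  rcases h with ⟨h, -⟩ | ⟨-, h, -⟩
  · rcases h.cov u hu w hw e with h | h <;> simp [h]
  · exact Or.inr (Or.inr ((h u).2 ⟨hu, w, hw, e⟩))

theorem Kind.twins (h : Kind r κ A C B) {u v w : ℕ} (hu : u ∈ B) (hv : v ∈ B) (hw : w ∉ A)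
    (e : r u w) : r v w := by
  rcases h with ⟨-, -, rfl⟩ | ⟨-, h, h', -⟩
  · simp at hu
  · obtain ⟨hv1, x, hx, e'⟩ := (h v).1 hv
    exact h' u ((h u).1 hu).1 v hv1 w x hw hx e e'

theorem Kind.cov_inter (hX : A ⊆ X) (h1 : Kind r κ A CA BA) (h2 : Kind r κ X CX BX) {v : ℕ}
    (hv : v ∈ CX) (hvA : v ∈ A) : v ∈ CA := by
  rcases h2 with ⟨h2, h3, -⟩ | ⟨rfl, -⟩
  · rcases h1 with ⟨h1, -⟩ | ⟨-, h4, h5, h6⟩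
    · exact (h1.nested hX h2).1 (Finset.mem_inter.2 ⟨hv, hvA⟩)
    · obtain ⟨w, hw, e, hwC⟩ := h2.exists_out hv (hX hvA)
      have hwA : w ∉ A := fun h => hw (hX h)
      have : BA ⊆ CX := by
        intro u hu
        obtain ⟨hu1, x, hx, e'⟩ := (h4 u).1 hu
        exact (h2.cov u (hX hu1) w hw (h5 v hvA u hu1 w x hwA hx e e')).resolve_right hwC
      have := Finset.card_le_card this
      have := lt_card_bdry h4 h6
      omega
  · simp at hv

theorem Kind.cov_out (hX : A ⊆ X) (h1 : Kind r κ A CA BA) (h2 : Kind r κ X CX BX) {v : ℕ}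
    (hv : v ∈ CA) (hvX : v ∉ X) : v ∈ CX := by
  rcases h1 with ⟨h1, h3, -⟩ | ⟨rfl, -⟩
  · rcases h2 with ⟨h2, -⟩ | ⟨-, -, h5, h6⟩
    · exact (h1.nested hX h2).2 (Finset.mem_sdiff.2 ⟨hv, hvX⟩)
    · obtain ⟨u, hu, e, huC⟩ := h1.exists_in hv fun h => hvX (hX h)
      exfalso
      have : IsCov r X CA := by
        intro x hx w hw e'
        exact Or.inr ((h1.cov u hu w (fun h => hw (hX h))
          (h5 x hx u (hX hu) w v hw hvX e' e)).resolve_left huC)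
      have := h6 _ this
      omega
  · simp at hv

theorem Kind.cross (hr : ∀ u v, r u v → r v u) (hAB : Disjoint A B) (h1 : Kind r κ A CA BA)
    (h2 : Kind r κ B CB BB) {u w : ℕ} (hu : u ∈ A) (hw : w ∈ B) (e : r u w) :
    u ∈ CA ∨ w ∈ CB ∨ (u ∈ BA ∧ w ∈ BB) := by
  have hwA : w ∉ A := fun h => (Finset.disjoint_left.1 hAB) h hw
  have huB : u ∉ B := (Finset.disjoint_left.1 hAB) hu
  have key : ∀ {A B CB BA : Finset ℕ} {u w : ℕ}, IsBdry r A BA → IsJoin r A →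
      (∀ D, IsCov r A D → κ < D.card) → IsBest r B CB → CB.card ≤ κ → Disjoint A B → u ∈ A → w ∈ B →
      r u w → w ∈ CB := by
    intro A B CB BA u w h4 h5 h6 h7 h8 hAB hu hw e
    by_contra hwC
    have hwA : w ∉ A := fun h => (Finset.disjoint_left.1 hAB) h hw
    have : BA ⊆ CB := by
      intro v hv
      obtain ⟨hv1, x, hx, e'⟩ := (h4 v).1 hv
      exact (h7.cov w hw v ((Finset.disjoint_left.1 hAB) hv1)
        (hr _ _ (h5 u hu v hv1 w x hwA hx e e'))).resolve_left hwC
    have := Finset.card_le_card this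
    have := lt_card_bdry h4 h6
    omega
  rcases h1 with ⟨h1, h3, -⟩ | ⟨-, h4, h5, h6⟩ <;> rcases h2 with ⟨h2, h3', -⟩ | ⟨-, h4', h5', h6'⟩
  · by_contra! hc
    have hw' := (h1.cov u hu w hwA e).resolve_left hc.1
    exact hc.2.1 (h2.disjoint hr hAB.symm h1 (Finset.mem_inter.2 ⟨hw', hw⟩))
  · exact Or.inl (key h4' h5' h6' h1 h3 hAB.symm hw hu (hr _ _ e))
  · exact Or.inr (Or.inl (key h4 h5 h6 h2 h3' hAB hu hw e))
  · exact Or.inr (Or.inr ⟨(h4 u).2 ⟨hu, w, hwA, e⟩, (h4' w).2 ⟨hw, u, huB, hr _ _ e⟩⟩)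

theorem Kind.bd_inter (hX : A ⊆ X) (h1 : Kind r κ A CA BA) (h2 : Kind r κ X CX BX) {v : ℕ}
    (hv : v ∈ BX) (hvA : v ∈ A) : v ∈ CA ∨ v ∈ BA := by
  rcases h2 with ⟨-, -, rfl⟩ | ⟨-, h4, h5, h6⟩
  · simp at hv
  obtain ⟨hvX, x, hx, e'⟩ := (h4 v).1 hv
  have hxA : x ∉ A := fun h => hx (hX h)
  rcases h1 with ⟨h1, h3, -⟩ | ⟨-, h3, -⟩
  · left
    by_contra hvC
    have : IsCov r X CA := by
      intro u hu w hw e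
      exact Or.inr ((h1.cov v hvA w (fun h => hw (hX h)) (h5 u hu v hvX w x hw hx e e')).resolve_left
        hvC)
    have := h6 _ this
    omega
  · exact Or.inr ((h3 v).2 ⟨hvA, x, hxA, e'⟩)

theorem Kind.bd_subset_of_mem (hX : A ⊆ X) (h1 : Kind r κ A CA BA) (h2 : Kind r κ X CX BX) {v : ℕ}
    (hv : v ∈ BA) (hvX : v ∈ BX) : BA ⊆ BX := by
  intro u hu
  have hB := h1.bd_subset
  rcases h2 with ⟨-, -, rfl⟩ | ⟨-, h4, -, -⟩
  · simp at hvX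
  obtain ⟨-, w, hw, e⟩ := (h4 v).1 hvX
  exact (h4 u).2 ⟨hX (hB hu), w, hw, h1.twins hv hu (fun h => hw (hX h)) e⟩

/-- A permutation of the colours that maps one set of colours to another one, with prescribed fixed
points. -/
theorem exists_perm (P Q F : Finset ℕ) (hFP : F ⊆ P) (hFQ : F ⊆ Q) (hP : ∀ x ∈ P, x < t)
    (hQ : ∀ x ∈ Q, x < t) (h : P.card = Q.card) :
    ∃ π : Equiv.Perm ℕ, (∀ x, x < t → π x < t) ∧ (∀ x ∈ F, π x = x) ∧ P.image π = Q := by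
  induction hn : (P \ Q).card generalizing P with
  | zero =>
    have : P ⊆ Q := by
      rw [Finset.card_eq_zero, Finset.sdiff_eq_empty_iff_subset] at hn; exact hn
    refine ⟨1, by simp, by simp, ?_⟩
    rw [Finset.eq_of_subset_of_card_le this h.ge]
    simp
  | succ n ih =>
    obtain ⟨p, hp⟩ : (P \ Q).Nonempty := Finset.card_pos.1 (by omega)
    obtain ⟨s, hs⟩ : (Q \ P).Nonempty := Finset.card_pos.1 (by
      rw [← Finset.card_sdiff_comm h]; omega)
    rw [Finset.mem_sdiff] at hp hs
    have e : P.image (Equiv.swap p s) = insert s (P.erase p) := by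
      ext x
      simp only [Finset.mem_image, Finset.mem_insert, Finset.mem_erase]
      constructor
      · rintro ⟨y, hy, rfl⟩
        by_cases hyp : y = p
        · simp [hyp]
        · have : y ≠ s := fun h => hs.2 (h ▸ hy)
          rw [Equiv.swap_apply_of_ne_of_ne hyp this]
          exact Or.inr ⟨hyp, hy⟩
      · rintro (rfl | ⟨h1, h2⟩)
        · exact ⟨p, hp.1, Equiv.swap_apply_left _ _⟩
        · exact ⟨x, h2, Equiv.swap_apply_of_ne_of_ne h1 fun h => hs.2 (h ▸ h2)⟩
    obtain ⟨π, h1, h2, h3⟩ := ih (insert s (P.erase p))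
      (fun x hx => Finset.mem_insert_of_mem (Finset.mem_erase.2 ⟨fun h => hp.2 (h ▸ hFQ hx), hFP hx⟩))
      (fun x hx => by
        rcases Finset.mem_insert.1 hx with rfl | hx
        · exact hQ _ hs.1
        · exact hP _ (Finset.mem_of_mem_erase hx))
      (by rw [← e, Finset.card_image_of_injective _ (Equiv.injective _), h])
      (by
        have : insert s (P.erase p) \ Q = (P \ Q).erase p := by
          ext x
          have : x = s → x ∈ Q := fun h => h ▸ hs.1
          simp only [Finset.mem_sdiff, Finset.mem_insert, Finset.mem_erase]
          tauto
        rw [this, Finset.card_erase_of_mem (Finset.mem_sdiff.2 hp), hn]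
        rfl)
    refine ⟨(Equiv.swap p s).trans π, fun x hx => ?_, fun x hx => ?_, ?_⟩
    · apply h1
      rw [Equiv.swap_apply_def]
      split_ifs
      · exact hQ _ hs.1
      · exact hP _ hp.1
      · exact hx
    · rw [Equiv.trans_apply, Equiv.swap_apply_of_ne_of_ne, h2 x hx]
      · exact fun h => hp.2 (h ▸ hFQ hx)
      · exact fun h => hs.2 (h ▸ hFP hx)
    · rw [← h3, ← e, Finset.image_image]
      rfl

theorem exists_colours (F O : Finset ℕ) (a : ℕ) (hF : F ⊆ Finset.range t) (hO : O ⊆ Finset.range t)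
    (h : a + F.card ≤ t) : ∃ S ⊆ Finset.range t, S.card = a ∧ Disjoint S F ∧
      (O ∪ S).card ≤ O.card + (a - (O \ F).card) := by
  have hU : (Finset.range t \ F).card = t - F.card := by
    rw [Finset.card_sdiff_of_subset hF, Finset.card_range]
  have hOF : O \ F ⊆ Finset.range t \ F := Finset.sdiff_subset_sdiff hO (le_refl _)
  rcases le_total a (O \ F).card with h1 | h1
  · obtain ⟨S, hS, hc⟩ := Finset.exists_subset_card_eq h1
    refine ⟨S, hS.trans (Finset.sdiff_subset.trans hO), hc, ?_, ?_⟩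
    · exact Finset.disjoint_of_subset_left hS Finset.sdiff_disjoint
    · rw [Finset.union_eq_left.2 (hS.trans Finset.sdiff_subset)]; omega
  · obtain ⟨S, hS1, hS2, hc⟩ := Finset.exists_subsuperset_card_eq hOF h1 (by omega)
    refine ⟨S, hS2.trans Finset.sdiff_subset, hc,
      Finset.disjoint_of_subset_left hS2 Finset.sdiff_disjoint, ?_⟩
    have e : O ∪ S = O ∪ (S \ (O \ F)) := by
      ext x
      simp only [Finset.mem_union, Finset.mem_sdiff]
      tauto
    rw [e]
    refine (Finset.card_union_le _ _).trans ?_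
    rw [Finset.card_sdiff_of_subset hS1, hc]

open Classical in
/-- The choice of the colours for the boundaries of two children. -/
theorem exists_two_colours (FA FB O : Finset ℕ) (a b : ℕ) (J pA pB : Prop)
    (hFA : FA ⊆ Finset.range t) (hFB : FB ⊆ Finset.range t) (hO : O ⊆ Finset.range t)
    (ha : a + FA.card ≤ t) (hb : b + FB.card ≤ t) (hJ : J → a + b + (FA ∩ FB).card ≤ t)
    (hJO : J → O = ∅) (hp : pA → pB → FA = ∅ ∧ FB = ∅ ∧ O = ∅) :
    ∃ SA ⊆ Finset.range t, ∃ SB ⊆ Finset.range t, SA.card = a ∧ SB.card = b ∧ Disjoint SA FA ∧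
      Disjoint SB FB ∧ (J → Disjoint SA SB) ∧
      (O ∪ (if pA then SA else ∅) ∪ (if pB then SB else ∅)).card ≤
        if J then (if pA then a else 0) + (if pB then b else 0) else
          O.card + max ((if pA then a else 0) - (O \ FA).card)
            ((if pB then b else 0) - (O \ FB).card) := by
  by_cases hj : J
  · have hO' := hJO hj
    have key : ∃ SA ⊆ Finset.range t, ∃ SB ⊆ Finset.range t, SA.card = a ∧ SB.card = b ∧
        Disjoint SA FA ∧ Disjoint SB FB ∧ Disjoint SA SB := by
      have hBA : FB \ FA ⊆ Finset.range t \ FA := Finset.sdiff_subset_sdiff hFB (le_refl _)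
      have hU : (Finset.range t \ FA).card = t - FA.card := by
        rw [Finset.card_sdiff_of_subset hFA, Finset.card_range]
      have hV : (Finset.range t \ FB).card = t - FB.card := by
        rw [Finset.card_sdiff_of_subset hFB, Finset.card_range]
      rcases le_total a (FB \ FA).card with h1 | h1
      · obtain ⟨S, hS, hc⟩ := Finset.exists_subset_card_eq h1
        obtain ⟨S', hS', hc'⟩ := Finset.exists_subset_card_eq (s := Finset.range t \ FB) (n := b)
          (by omega)
        refine ⟨S, hS.trans (Finset.sdiff_subset.trans hFB), S', hS'.trans Finset.sdiff_subset, hc,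
          hc', Finset.disjoint_of_subset_left hS Finset.sdiff_disjoint,
          Finset.disjoint_of_subset_left hS' Finset.sdiff_disjoint, ?_⟩
        exact (Finset.disjoint_of_subset_left hS' Finset.sdiff_disjoint).symm.mono_left
          (hS.trans Finset.sdiff_subset)
      · obtain ⟨S, hS1, hS2, hc⟩ := Finset.exists_subsuperset_card_eq hBA h1 (by omega)
        have hSt : S ⊆ Finset.range t := hS2.trans Finset.sdiff_subset
        have hcard : (FB ∪ S).card ≤ (FA ∩ FB).card + a := by
          have : FB ∪ S ⊆ (FA ∩ FB) ∪ S := by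
            intro x hx
            have := @hS1 x
            simp only [Finset.mem_union, Finset.mem_inter, Finset.mem_sdiff] at *
            tauto
          exact (Finset.card_le_card this).trans ((Finset.card_union_le _ _).trans (by rw [hc]))
        have hW : (Finset.range t \ (FB ∪ S)).card = t - (FB ∪ S).card := by
          rw [Finset.card_sdiff_of_subset (Finset.union_subset hFB hSt), Finset.card_range]
        obtain ⟨S', hS', hc'⟩ := Finset.exists_subset_card_eq
          (s := Finset.range t \ (FB ∪ S)) (n := b) (by have := hJ hj; omega)
        have hd : Disjoint S' (FB ∪ S) :=
          Finset.disjoint_of_subset_left hS' Finset.sdiff_disjoint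
        refine ⟨S, hSt, S', hS'.trans Finset.sdiff_subset, hc, hc',
          Finset.disjoint_of_subset_left hS2 Finset.sdiff_disjoint,
          hd.mono_right Finset.subset_union_left, (hd.mono_right Finset.subset_union_right).symm⟩
    obtain ⟨SA, h1, SB, h2, h3, h4, h5, h6, h7⟩ := key
    refine ⟨SA, h1, SB, h2, h3, h4, h5, h6, fun _ => h7, ?_⟩
    rw [if_pos hj, hO', Finset.empty_union]
    refine (Finset.card_union_le _ _).trans (add_le_add ?_ ?_)
    · split_ifs <;> simp [h3]
    · split_ifs <;> simp [h4]
  · by_cases hpp : pA ∧ pB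
    · obtain ⟨rfl, rfl, rfl⟩ := hp hpp.1 hpp.2
      refine ⟨Finset.range a, ?_, Finset.range b, ?_, by simp, by simp, by simp, by simp,
        fun h => absurd h hj, ?_⟩
      · exact Finset.range_subset_range.2 (by simpa using ha)
      · exact Finset.range_subset_range.2 (by simpa using hb)
      · rw [if_neg hj, if_pos hpp.1, if_pos hpp.2, if_pos hpp.1, if_pos hpp.2]
        have : ∅ ∪ Finset.range a ∪ Finset.range b ⊆ Finset.range (max a b) := by
          intro x
          simp
        exact (Finset.card_le_card this).trans (by simp)
    · obtain ⟨SA, h1, h2, h3, h4⟩ := exists_colours FA O a hFA hO ha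
      obtain ⟨SB, h1', h2', h3', h4'⟩ := exists_colours FB O b hFB hO hb
      refine ⟨SA, h1, SB, h1', h2, h2', h3, h3', fun h => absurd h hj, ?_⟩
      rw [if_neg hj]
      by_cases hpA : pA
      · have hpB : ¬ pB := fun h => hpp ⟨hpA, h⟩
        simp only [hpA, hpB, if_true, if_false, Finset.union_empty]
        exact h4.trans (by simp)
      · by_cases hpB : pB
        · simp only [hpA, hpB, if_true, if_false, Finset.union_empty]
          exact h4'.trans (by simp)
        · simp [hpA, hpB]

end

end SplitMatching

namespace SplitMatching

section

variable {r : ℕ → ℕ → Prop} {A B X C D CA CB CX BA BB BX : Finset ℕ} {κ t : ℕ}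

theorem Kind.exists_col (h : Kind r κ A C B) {φ : ℕ → ℕ} {a : ℕ}
    (hg : ∃ g, ColOn r t (A ∪ C) g ∧ (∀ v ∈ C, g v = φ v) ∧ (B.image g).card = a) {S : Finset ℕ}
    (hS : S ⊆ Finset.range t) (hSa : S.card = a) :
    ∃ g, ColOn r t (A ∪ C) g ∧ (∀ v ∈ C, g v = φ v) ∧ ∀ v ∈ B, g v ∈ S := by
  obtain ⟨g, h1, h2, h3⟩ := hg
  by_cases hB : B.Nonempty
  · have hC := h.cov_eq_empty hB
    obtain ⟨π, p1, -, p3⟩ := exists_perm (t := t) (B.image g) S ∅ (by simp) (by simp)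
      (fun x hx => by
        obtain ⟨v, hv, rfl⟩ := Finset.mem_image.1 hx
        exact h1.1 v (Finset.mem_union_left _ (h.bd_subset hv)))
      (fun x hx => Finset.mem_range.1 (hS hx)) (h3.trans hSa.symm)
    refine ⟨_, h1.perm π p1, by simp [hC], fun v hv => ?_⟩
    rw [← p3]
    exact Finset.mem_image_of_mem _ (Finset.mem_image_of_mem _ hv)
  · rw [Finset.not_nonempty_iff_eq_empty] at hB
    exact ⟨g, h1, h2, by simp [hB]⟩

open Classical in
/-- The number of colours on the boundary of a node. -/
noncomputable def outNum (FA FB O : Finset ℕ) (a b : ℕ) (J pA pB : Prop) : ℕ :=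
  if J then (if pA then a else 0) + (if pB then b else 0) else
    O.card + max ((if pA then a else 0) - (O \ FA).card) ((if pB then b else 0) - (O \ FB).card)

/-- The sets of colours and the relations between the boundaries that are used at a node with children
`A` and `B`. -/
structure Bag (r : ℕ → ℕ → Prop) (A B CA CB CX BA BB BX : Finset ℕ) (φ : ℕ → ℕ)
    (FA FB O : Finset ℕ) (J pA pB : Prop) : Prop where
  mem_FA : ∀ c, c ∈ FA ↔ ∃ v ∈ CX ∪ (CA ∪ CB), v ∉ A ∧ (∃ u ∈ BA, r u v) ∧ φ v = c
  mem_FB : ∀ c, c ∈ FB ↔ ∃ v ∈ CX ∪ (CA ∪ CB), v ∉ B ∧ (∃ u ∈ BB, r u v) ∧ φ v = c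
  mem_O : ∀ c, c ∈ O ↔ ∃ v ∈ CX ∪ (CA ∪ CB), v ∈ BX ∧ φ v = c
  joined : J ↔ ∃ u ∈ BA, ∃ w ∈ BB, r u w
  left : pA ↔ ∃ v ∈ BA, v ∈ BX
  right : pB ↔ ∃ v ∈ BB, v ∈ BX

variable {φ : ℕ → ℕ} {FA FB O : Finset ℕ} {J pA pB : Prop} {a b : ℕ}

theorem combine_sound (hr : ∀ u v, r u v → r v u) (hAB : Disjoint A B) (kA : Kind r κ A CA BA)
    (kB : Kind r κ B CB BB) (kX : Kind r κ (A ∪ B) CX BX)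
    (hφ : ColOn r t (CX ∪ (CA ∪ CB)) φ)
    (hA : ∃ g, ColOn r t (A ∪ CA) g ∧ (∀ v ∈ CA, g v = φ v) ∧ (BA.image g).card = a)
    (hB : ∃ g, ColOn r t (B ∪ CB) g ∧ (∀ v ∈ CB, g v = φ v) ∧ (BB.image g).card = b)
    (hb : Bag r A B CA CB CX BA BB BX φ FA FB O J pA pB) (h1 : a + FA.card ≤ t)
    (h2 : b + FB.card ≤ t) (h3 : J → a + b + (FA ∩ FB).card ≤ t) :
    ∃ g, ColOn r t (A ∪ B ∪ CX) g ∧ (∀ v ∈ CX, g v = φ v) ∧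
      (BX.image g).card ≤ outNum FA FB O a b J pA pB := by
  classical
  have hAX : A ⊆ A ∪ B := Finset.subset_union_left
  have hBX : B ⊆ A ∪ B := Finset.subset_union_right
  have hFA : FA ⊆ Finset.range t := fun c hc => by
    obtain ⟨v, hv, -, -, rfl⟩ := (hb.mem_FA c).1 hc
    exact Finset.mem_range.2 (hφ.1 v hv)
  have hFB : FB ⊆ Finset.range t := fun c hc => by
    obtain ⟨v, hv, -, -, rfl⟩ := (hb.mem_FB c).1 hc
    exact Finset.mem_range.2 (hφ.1 v hv)
  have hO : O ⊆ Finset.range t := fun c hc => by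
    obtain ⟨v, hv, -, rfl⟩ := (hb.mem_O c).1 hc
    exact Finset.mem_range.2 (hφ.1 v hv)
  have empty : BA.Nonempty → BB.Nonempty → BX.Nonempty → FA = ∅ ∧ FB = ∅ ∧ O = ∅ := by
    intro n1 n2 n3
    have e1 := kA.cov_eq_empty n1
    have e2 := kB.cov_eq_empty n2
    have e3 := kX.cov_eq_empty n3
    refine ⟨?_, ?_, ?_⟩ <;> rw [Finset.eq_empty_iff_forall_notMem] <;> intro c hc
    · obtain ⟨v, hv, -⟩ := (hb.mem_FA c).1 hc
      simp [e1, e2, e3] at hv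
    · obtain ⟨v, hv, -⟩ := (hb.mem_FB c).1 hc
      simp [e1, e2, e3] at hv
    · obtain ⟨v, hv, -⟩ := (hb.mem_O c).1 hc
      simp [e1, e2, e3] at hv
  obtain ⟨SA, sA, SB, sB, cA, cB, dA, dB, dAB, hval⟩ := exists_two_colours (t := t) FA FB O a b J pA pB
    hFA hFB hO h1 h2 h3
    (fun hJ => by
      obtain ⟨u, hu, w, hw, -⟩ := hb.joined.1 hJ
      rw [Finset.eq_empty_iff_forall_notMem]
      intro c hc
      obtain ⟨v, -, hv, -⟩ := (hb.mem_O c).1 hc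
      rw [(empty ⟨u, hu⟩ ⟨w, hw⟩ ⟨v, hv⟩).2.2] at hc
      simp at hc)
    (fun p1 p2 => by
      obtain ⟨u, hu, hu'⟩ := hb.left.1 p1
      obtain ⟨w, hw, -⟩ := hb.right.1 p2
      exact empty ⟨u, hu⟩ ⟨w, hw⟩ ⟨u, hu'⟩)
  obtain ⟨gA, a1, a2, a3⟩ := kA.exists_col hA sA cA
  obtain ⟨gB, b1, b2, b3⟩ := kB.exists_col hB sB cB
  have key1 : ∀ u ∈ A, ∀ w ∈ CX ∪ (CA ∪ CB), w ∉ A → r u w → gA u ≠ φ w := by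
    intro u hu w hw hwA e
    rcases kA.covered hu hwA e with h | h | h
    · rw [a2 u h]
      exact hφ.2 u (by simp [h]) w hw e
    · rw [← a2 w h]
      exact a1.2 u (by simp [hu]) w (by simp [h]) e
    · intro h'
      exact Finset.disjoint_left.1 dA (a3 u h) ((hb.mem_FA _).2 ⟨w, hw, hwA, ⟨u, h, e⟩, h'.symm⟩)
  have key2 : ∀ u ∈ B, ∀ w ∈ CX ∪ (CA ∪ CB), w ∉ B → r u w → gB u ≠ φ w := by
    intro u hu w hw hwA e
    rcases kB.covered hu hwA e with h | h | h
    · rw [b2 u h]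
      exact hφ.2 u (by simp [h]) w hw e
    · rw [← b2 w h]
      exact b1.2 u (by simp [hu]) w (by simp [h]) e
    · intro h'
      exact Finset.disjoint_left.1 dB (b3 u h) ((hb.mem_FB _).2 ⟨w, hw, hwA, ⟨u, h, e⟩, h'.symm⟩)
  have key3 : ∀ u ∈ A, ∀ w ∈ B, r u w → gA u ≠ gB w := by
    intro u hu w hw e
    have hwA : w ∉ A := fun h => (Finset.disjoint_left.1 hAB) h hw
    have huB : u ∉ B := (Finset.disjoint_left.1 hAB) hu
    rcases kA.cross hr hAB kB hu hw e with h | h | ⟨h, h'⟩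
    · rw [a2 u h]
      exact (key2 w hw u (by simp [h]) huB (hr _ _ e)).symm
    · rw [b2 w h]
      exact key1 u hu w (by simp [h]) hwA e
    · intro e'
      exact Finset.disjoint_left.1 (dAB (hb.joined.2 ⟨u, h, w, h', e⟩)) (a3 u h) (e' ▸ b3 w h')
  set g : ℕ → ℕ := fun v => if v ∈ A then gA v else if v ∈ B then gB v else φ v with hg
  have gA' : ∀ v ∈ A, g v = gA v := fun v hv => by simp [hg, hv]
  have gB' : ∀ v ∈ B, g v = gB v := fun v hv => by
    have : v ∉ A := fun h => (Finset.disjoint_left.1 hAB) h hv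
    simp [hg, hv, this]
  have gC' : ∀ v ∈ CX, g v = φ v := by
    intro v hv
    by_cases hvA : v ∈ A
    · rw [gA' v hvA, a2 v (kA.cov_inter hAX kX hv hvA)]
    · by_cases hvB : v ∈ B
      · rw [gB' v hvB, b2 v (kB.cov_inter hBX kX hv hvB)]
      · simp [hg, hvA, hvB]
  have cases3 : ∀ v ∈ A ∪ B ∪ CX, v ∈ A ∨ v ∈ B ∨ (v ∈ CX ∧ v ∉ A ∧ v ∉ B) := by
    intro v hv
    simp only [Finset.mem_union] at hv
    tauto
  refine ⟨g, ⟨fun u hu => ?_, fun u hu v hv e => ?_⟩, gC', ?_⟩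
  · rcases cases3 u hu with h | h | ⟨h, -⟩
    · rw [gA' u h]; exact a1.1 u (by simp [h])
    · rw [gB' u h]; exact b1.1 u (by simp [h])
    · rw [gC' u h]; exact hφ.1 u (by simp [h])
  · rcases cases3 u hu with h | h | ⟨h, hn, hn'⟩ <;> rcases cases3 v hv with k | k | ⟨k, kn, kn'⟩
    · rw [gA' u h, gA' v k]; exact a1.2 u (by simp [h]) v (by simp [k]) e
    · rw [gA' u h, gB' v k]; exact key3 u h v k e
    · rw [gA' u h, gC' v k]; exact key1 u h v (by simp [k]) kn e
    · rw [gB' u h, gA' v k]; exact (key3 v k u h (hr _ _ e)).symm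
    · rw [gB' u h, gB' v k]; exact b1.2 u (by simp [h]) v (by simp [k]) e
    · rw [gB' u h, gC' v k]; exact key2 u h v (by simp [k]) kn' e
    · rw [gC' u h, gA' v k]; exact (key1 v k u (by simp [h]) hn (hr _ _ e)).symm
    · rw [gC' u h, gB' v k]; exact (key2 v k u (by simp [h]) hn' (hr _ _ e)).symm
    · rw [gC' u h, gC' v k]; exact hφ.2 u (by simp [h]) v (by simp [k]) e
  · refine (Finset.card_le_card ?_).trans hval
    intro c hc
    obtain ⟨v, hv, rfl⟩ := Finset.mem_image.1 hc
    rcases Finset.mem_union.1 (kX.bd_subset hv) with h | h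
    · rw [gA' v h]
      rcases kA.bd_inter hAX kX hv h with h' | h'
      · rw [a2 v h']
        have : φ v ∈ O := (hb.mem_O _).2 ⟨v, by simp [h'], hv, rfl⟩
        simp [this]
      · have : pA := hb.left.2 ⟨v, h', hv⟩
        simp [this, a3 v h']
    · rw [gB' v h]
      rcases kB.bd_inter hBX kX hv h with h' | h'
      · rw [b2 v h']
        have : φ v ∈ O := (hb.mem_O _).2 ⟨v, by simp [h'], hv, rfl⟩
        simp [this]
      · have : pB := hb.right.2 ⟨v, h', hv⟩
        simp [this, b3 v h']

theorem bag_subset (kA : Kind r κ A CA BA) (kB : Kind r κ B CB BB) (kX : Kind r κ (A ∪ B) CX BX) :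
    CX ∪ (CA ∪ CB) ⊆ A ∪ B ∪ CX := by
  intro v hv
  by_cases h : v ∈ A ∪ B
  · exact Finset.mem_union_left _ h
  · refine Finset.mem_union_right _ ?_
    rcases Finset.mem_union.1 hv with hv | hv
    · exact hv
    rcases Finset.mem_union.1 hv with hv | hv
    · exact kA.cov_out Finset.subset_union_left kX hv h
    · exact kB.cov_out Finset.subset_union_right kX hv h

theorem combine_complete (hr : ∀ u v, r u v → r v u) (hAB : Disjoint A B) (kA : Kind r κ A CA BA)
    (kB : Kind r κ B CB BB) (kX : Kind r κ (A ∪ B) CX BX) (hφ : ColOn r t (A ∪ B ∪ CX) φ)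
    (hb : Bag r A B CA CB CX BA BB BX φ FA FB O J pA pB) (ha : a ≤ (BA.image φ).card)
    (hb' : b ≤ (BB.image φ).card) :
    a + FA.card ≤ t ∧ b + FB.card ≤ t ∧ (J → a + b + (FA ∩ FB).card ≤ t) ∧
      outNum FA FB O a b J pA pB ≤ (BX.image φ).card := by
  have hAX : A ⊆ A ∪ B := Finset.subset_union_left
  have hBX : B ⊆ A ∪ B := Finset.subset_union_right
  have hbag := bag_subset kA kB kX
  have hBA : ∀ u ∈ BA, u ∈ A ∪ B ∪ CX := fun u hu =>
    Finset.mem_union_left _ (hAX (kA.bd_subset hu))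
  have hBB : ∀ u ∈ BB, u ∈ A ∪ B ∪ CX := fun u hu =>
    Finset.mem_union_left _ (hBX (kB.bd_subset hu))
  have hFA : FA ⊆ Finset.range t := fun c hc => by
    obtain ⟨v, hv, -, -, rfl⟩ := (hb.mem_FA c).1 hc
    exact Finset.mem_range.2 (hφ.1 v (hbag hv))
  have hFB : FB ⊆ Finset.range t := fun c hc => by
    obtain ⟨v, hv, -, -, rfl⟩ := (hb.mem_FB c).1 hc
    exact Finset.mem_range.2 (hφ.1 v (hbag hv))
  have iA : BA.image φ ⊆ Finset.range t := fun c hc => by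
    obtain ⟨v, hv, rfl⟩ := Finset.mem_image.1 hc
    exact Finset.mem_range.2 (hφ.1 v (hBA v hv))
  have iB : BB.image φ ⊆ Finset.range t := fun c hc => by
    obtain ⟨v, hv, rfl⟩ := Finset.mem_image.1 hc
    exact Finset.mem_range.2 (hφ.1 v (hBB v hv))
  have dA : Disjoint (BA.image φ) FA := by
    rw [Finset.disjoint_left]
    intro c hc hc'
    obtain ⟨u, hu, rfl⟩ := Finset.mem_image.1 hc
    obtain ⟨v, hv, hvA, ⟨u', hu', e⟩, h⟩ := (hb.mem_FA _).1 hc'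
    exact hφ.2 u (hBA u hu) v (hbag hv) (kA.twins hu' hu hvA e) h.symm
  have dB : Disjoint (BB.image φ) FB := by
    rw [Finset.disjoint_left]
    intro c hc hc'
    obtain ⟨u, hu, rfl⟩ := Finset.mem_image.1 hc
    obtain ⟨v, hv, hvA, ⟨u', hu', e⟩, h⟩ := (hb.mem_FB _).1 hc'
    exact hφ.2 u (hBB u hu) v (hbag hv) (kB.twins hu' hu hvA e) h.symm
  have dAB : J → Disjoint (BA.image φ) (BB.image φ) := by
    intro hJ
    obtain ⟨u, hu, w, hw, e⟩ := hb.joined.1 hJ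
    rw [Finset.disjoint_left]
    intro c hc hc'
    obtain ⟨u', hu', rfl⟩ := Finset.mem_image.1 hc
    obtain ⟨w', hw', h⟩ := Finset.mem_image.1 hc'
    have hwA : w ∉ A := fun h => (Finset.disjoint_left.1 hAB) h (kB.bd_subset hw)
    have huB : u' ∉ B := (Finset.disjoint_left.1 hAB) (kA.bd_subset hu')
    exact hφ.2 w' (hBB w' hw') u' (hBA u' hu')
      (kB.twins hw hw' huB (hr _ _ (kA.twins hu hu' hwA e))) h
  have le_t : ∀ {P Q : Finset ℕ}, P ⊆ Finset.range t → Q ⊆ Finset.range t → Disjoint P Q →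
      P.card + Q.card ≤ t := by
    intro P Q hP hQ hPQ
    rw [← Finset.card_union_of_disjoint hPQ]
    simpa using Finset.card_le_card (Finset.union_subset hP hQ)
  have oX : O ⊆ BX.image φ := fun c hc => by
    obtain ⟨v, -, hv, rfl⟩ := (hb.mem_O c).1 hc
    exact Finset.mem_image_of_mem _ hv
  have iAX : pA → BA.image φ ⊆ BX.image φ := fun h => by
    obtain ⟨v, hv, hv'⟩ := hb.left.1 h
    exact Finset.image_subset_image (kA.bd_subset_of_mem hAX kX hv hv')
  have iBX : pB → BB.image φ ⊆ BX.image φ := fun h => by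
    obtain ⟨v, hv, hv'⟩ := hb.right.1 h
    exact Finset.image_subset_image (kB.bd_subset_of_mem hBX kX hv hv')
  have count : ∀ {P F : Finset ℕ}, P ⊆ BX.image φ → Disjoint P F →
      O.card + (P.card - (O \ F).card) ≤ (BX.image φ).card := by
    intro P F hP hPF
    have h1 : (O ∪ P).card ≤ (BX.image φ).card := Finset.card_le_card (Finset.union_subset oX hP)
    have h2 := Finset.card_union_add_card_inter O P
    have h3 : (O ∩ P).card ≤ (O \ F).card := Finset.card_le_card fun c hc => by
      rw [Finset.mem_inter] at hc
      exact Finset.mem_sdiff.2 ⟨hc.1, Finset.disjoint_left.1 hPF hc.2⟩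
    have h4 := Finset.card_le_card oX
    omega
  refine ⟨?_, ?_, fun hJ => ?_, ?_⟩
  · have := le_t iA hFA dA; omega
  · have := le_t iB hFB dB; omega
  · have h1 := Finset.card_union_of_disjoint (dAB hJ)
    have h2 := le_t (Finset.union_subset iA iB) (Finset.inter_subset_left.trans hFA)
      (Q := FA ∩ FB) (Finset.disjoint_union_left.2 ⟨dA.mono_right Finset.inter_subset_left,
        dB.mono_right Finset.inter_subset_right⟩)
    omega
  · classical
    unfold outNum
    have h0 := Finset.card_le_card oX
    by_cases hJ : J
    · have h1 := Finset.card_union_of_disjoint (dAB hJ)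
      simp only [hJ, if_true]
      by_cases hA : pA <;> by_cases hB : pB <;> simp only [hA, hB, if_true, if_false]
      · have := Finset.card_le_card (Finset.union_subset (iAX hA) (iBX hB)); omega
      · have := Finset.card_le_card (iAX hA); omega
      · have := Finset.card_le_card (iBX hB); omega
      · omega
    · simp only [hJ, if_false]
      have h1 : O.card + ((if pA then a else 0) - (O \ FA).card) ≤ (BX.image φ).card := by
        split_ifs with h
        · have := count (iAX h) dA; omega
        · omega
      have h2 : O.card + ((if pB then b else 0) - (O \ FB).card) ≤ (BX.image φ).card := by
        split_ifs with h
        · have := count (iBX h) dB; omega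
        · omega
      omega

/-- The colours can be permuted such that the bag has colours below `q`. -/
theorem exists_small_col {S bag : Finset ℕ} {q : ℕ} {g : ℕ → ℕ} (h : ColOn r t S g) (hS : bag ⊆ S)
    (hC : C ⊆ bag) (hq : bag.card ≤ q ∨ t ≤ q) (hqt : q ≤ t) (hg : ∀ v ∈ C, g v < q) :
    ∃ φ, ColOn r t S φ ∧ (∀ v ∈ C, φ v = g v) ∧ (∀ v ∈ bag, φ v < q) ∧
      ∀ P : Finset ℕ, (P.image φ).card = (P.image g).card := by
  have h1 : (bag.image g).card ≤ (Finset.range q).card := by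
    rw [Finset.card_range]
    rcases hq with hq | hq
    · exact Finset.card_image_le.trans hq
    · refine le_trans ?_ hq
      rw [← Finset.card_range t]
      refine Finset.card_le_card fun c hc => ?_
      obtain ⟨v, hv, rfl⟩ := Finset.mem_image.1 hc
      exact Finset.mem_range.2 (h.1 v (hS hv))
  have h2 : C.image g ⊆ Finset.range q := fun c hc => by
    obtain ⟨v, hv, rfl⟩ := Finset.mem_image.1 hc
    exact Finset.mem_range.2 (hg v hv)
  obtain ⟨Q, hQ1, hQ2, hQ3⟩ := Finset.exists_subsuperset_card_eq h2
    (Finset.card_le_card (Finset.image_subset_image hC)) h1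
  obtain ⟨π, p1, p2, p3⟩ := exists_perm (t := t) (bag.image g) Q (C.image g)
    (Finset.image_subset_image hC) hQ1
    (fun x hx => by
      obtain ⟨v, hv, rfl⟩ := Finset.mem_image.1 hx
      exact h.1 v (hS hv))
    (fun x hx => (Finset.mem_range.1 (hQ2 hx)).trans_le hqt) hQ3.symm
  refine ⟨_, h.perm π p1, fun v hv => p2 _ (Finset.mem_image_of_mem _ hv), fun v hv => ?_,
    fun P => ?_⟩
  · apply Finset.mem_range.1
    apply hQ2
    rw [← p3]
    exact Finset.mem_image_of_mem _ (Finset.mem_image_of_mem _ hv)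
  · rw [show (fun v => π (g v)) = π ∘ g from rfl, ← Finset.image_image,
      Finset.card_image_of_injective _ π.injective]

end

end SplitMatching

/-! ### Correctness of the search for covers -/

namespace WhileLang

open SplitMatching

theorem foldl_prepend {α β : Type} (f : α → List β) (l : List α) (s : List β) :
    l.foldl (fun s a => f a ++ s) s = l.reverse.flatMap f ++ s := by
  induction l generalizing s with
  | nil => simp
  | cons a l ih => simp [ih]

theorem coverStep_eq (κ : ℕ) (L : Table) (uv : ℕ × ℕ) :
    coverStep κ L uv = L.reverse.flatMap fun C =>
      bif C.contains uv.1 || C.contains uv.2 then [C] else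
        bif Nat.ble κ C.length then [] else [uv.1 :: C, uv.2 :: C] := by
  have := foldl_prepend (fun C : List ℕ => bif C.contains uv.1 || C.contains uv.2 then [C] else
        bif Nat.ble κ C.length then [] else [uv.1 :: C, uv.2 :: C]) L []
  rw [List.append_nil] at this
  rw [← this, coverStep]
  congr 1
  funext out C
  cases (C.contains uv.1 || C.contains uv.2)
  · cases Nat.ble κ C.length <;> rfl
  · rfl

theorem mem_coverStep {κ : ℕ} {L : Table} {uv : ℕ × ℕ} {C : List ℕ} :
    C ∈ coverStep κ L uv ↔ ∃ D ∈ L, ((uv.1 ∈ D ∨ uv.2 ∈ D) ∧ C = D) ∨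
      (uv.1 ∉ D ∧ uv.2 ∉ D ∧ D.length < κ ∧ (C = uv.1 :: D ∨ C = uv.2 :: D)) := by
  rw [coverStep_eq]
  simp only [List.mem_flatMap, List.mem_reverse]
  refine exists_congr fun D => and_congr_right fun _ => ?_
  by_cases h1 : uv.1 ∈ D
  · simp [h1]
  · by_cases h2 : uv.2 ∈ D
    · simp [h1, h2]
    · by_cases h3 : κ ≤ D.length
      · have : Nat.ble κ D.length = true := by rw [Nat.ble_eq]; exact h3
        simp [h1, h2, this, h3]
      · have : Nat.ble κ D.length = false := by
          rw [← Bool.not_eq_true, Nat.ble_eq]; exact h3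
        simp [h1, h2, this, not_le.1 h3]

theorem covers_append (κ : ℕ) (E : List (ℕ × ℕ)) (e : ℕ × ℕ) :
    covers κ (E ++ [e]) = coverStep κ (covers κ E) e := by simp [covers]

theorem covers_spec {κ : ℕ} {E : List (ℕ × ℕ)} {C : List ℕ} (h : C ∈ covers κ E) :
    C.Nodup ∧ C.length ≤ κ ∧ (∀ e ∈ E, e.1 ∈ C ∨ e.2 ∈ C) ∧
      ∀ v ∈ C, ∃ e ∈ E, v = e.1 ∨ v = e.2 := by
  induction E using List.reverseRecOn generalizing C with
  | nil => simp [covers] at h; simp [h]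
  | append_singleton E e ih =>
    rw [covers_append, mem_coverStep] at h
    obtain ⟨D, hD, h⟩ := h
    obtain ⟨h1, h2, h3, h4⟩ := ih hD
    have h4' : ∀ v ∈ D, ∃ e' ∈ E ++ [e], v = e'.1 ∨ v = e'.2 := fun v hv => by
      obtain ⟨e', he', h⟩ := h4 v hv
      exact ⟨e', by simp [he'], h⟩
    rcases h with ⟨h, rfl⟩ | ⟨n1, n2, hl, h⟩
    · refine ⟨h1, h2, fun e' he' => ?_, h4'⟩
      rcases List.mem_append.1 he' with he' | he'
      · exact h3 e' he'
      · rw [List.mem_singleton.1 he']; exact h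
    · have key : ∀ x, (x = e.1 ∨ x = e.2) → x ∉ D → C = x :: D → C.Nodup ∧ C.length ≤ κ ∧
          (∀ e' ∈ E ++ [e], e'.1 ∈ C ∨ e'.2 ∈ C) ∧ ∀ v ∈ C, ∃ e' ∈ E ++ [e], v = e'.1 ∨ v = e'.2 := by
        rintro x hx hxD rfl
        refine ⟨List.nodup_cons.2 ⟨hxD, h1⟩, by simpa using hl, fun e' he' => ?_, fun v hv => ?_⟩
        · rcases List.mem_append.1 he' with he' | he'
          · rcases h3 e' he' with h | h <;> simp [h]
          · rw [List.mem_singleton.1 he']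
            rcases hx with rfl | rfl <;> simp
        · rcases List.mem_cons.1 hv with rfl | hv
          · exact ⟨e, by simp, hx⟩
          · exact h4' v hv
      rcases h with h | h
      · exact key _ (Or.inl rfl) n1 h
      · exact key _ (Or.inr rfl) n2 h

theorem exists_mem_covers {κ : ℕ} {E : List (ℕ × ℕ)} {S : Finset ℕ} (hS : S.card ≤ κ)
    (h : ∀ e ∈ E, e.1 ∈ S ∨ e.2 ∈ S) : ∃ C ∈ covers κ E, C.toFinset ⊆ S := by
  induction E using List.reverseRecOn with
  | nil => exact ⟨[], by simp [covers], by simp⟩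
  | append_singleton E e ih =>
    obtain ⟨D, hD, hDS⟩ := ih fun e' he' => h e' (by simp [he'])
    by_cases hc : e.1 ∈ D ∨ e.2 ∈ D
    · exact ⟨D, by rw [covers_append, mem_coverStep]; exact ⟨D, hD, Or.inl ⟨hc, rfl⟩⟩, hDS⟩
    · push Not at hc
      have key : ∀ x ∈ S, x ∉ D → D.length < κ := by
        intro x hx hxD
        have h1 : D.toFinset ⊂ S :=
          Finset.ssubset_iff_subset_ne.2 ⟨hDS, fun e => hxD (List.mem_toFinset.1 (e ▸ hx))⟩
        have := Finset.card_lt_card h1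
        rw [List.toFinset_card_of_nodup (covers_spec hD).1] at this
        omega
      have sub : ∀ x ∈ S, (x :: D).toFinset ⊆ S := by
        intro x hx
        rw [List.toFinset_cons]
        exact Finset.insert_subset hx hDS
      rcases h e (by simp) with hx | hx
      · exact ⟨e.1 :: D, by rw [covers_append, mem_coverStep]; exact
          ⟨D, hD, Or.inr ⟨hc.1, hc.2, key _ hx hc.1, Or.inl rfl⟩⟩, sub _ hx⟩
      · exact ⟨e.2 :: D, by rw [covers_append, mem_coverStep]; exact
          ⟨D, hD, Or.inr ⟨hc.1, hc.2, key _ hx hc.2, Or.inr rfl⟩⟩, sub _ hx⟩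

theorem prefers_iff (A C C' : List ℕ) : prefers A C C' = true ↔ C.length < C'.length ∨
    (C.length = C'.length ∧ (C.filter fun v => !A.contains v).length <
      (C'.filter fun v => !A.contains v).length) := by
  have ble : ∀ a b : ℕ, (!Nat.ble a b) = true ↔ b < a := fun a b => by
    rw [Bool.not_eq_true', ← Bool.not_eq_true, Nat.ble_eq, not_le]
  simp only [prefers, Bool.or_eq_true, Bool.and_eq_true, beq_iff_eq, ble]

theorem foldl_best (A : List ℕ) (L : Table) (b : List ℕ) :
    let b' := L.foldl (fun b C => bif prefers A C b then C else b) b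
    (b' = b ∨ b' ∈ L) ∧ prefers A b b' = false ∧ ∀ C ∈ L, prefers A C b' = false := by
  induction L generalizing b with
  | nil =>
    refine ⟨Or.inl rfl, ?_, by simp⟩
    rw [← Bool.not_eq_true, List.foldl_nil, prefers_iff]
    omega
  | cons C L ih =>
    simp only [List.foldl_cons]
    obtain ⟨h1, h2, h3⟩ := ih (bif prefers A C b then C else b)
    refine ⟨?_, ?_, ?_⟩
    · rcases h1 with h1 | h1
      · rw [h1]
        cases prefers A C b <;> simp
      · exact Or.inr (List.mem_cons_of_mem _ h1)
    · cases h : prefers A C b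
      · simpa [h] using h2
      · rw [h, cond_true] at h2
        rw [cond_true]
        rw [← Bool.not_eq_true] at h2 ⊢
        rw [prefers_iff] at *
        omega
    · intro D hD
      rcases List.mem_cons.1 hD with rfl | hD
      · cases h : prefers A D b
        · rw [h, cond_false] at h2
          rw [cond_false]
          rw [← Bool.not_eq_true] at h h2 ⊢
          rw [prefers_iff] at *
          omega
        · simpa [h] using h2
      · exact h3 D hD

theorem best_spec {A : List ℕ} {L : Table} (hL : L ≠ []) :
    best A L ∈ L ∧ ∀ C ∈ L, prefers A C (best A L) = false := by
  obtain ⟨h1, -, h3⟩ := foldl_best A L (L.headD [])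
  refine ⟨?_, h3⟩
  rcases h1 with h1 | h1
  · rw [best, h1]
    cases L with
    | nil => exact absurd rfl hL
    | cons C L => simp
  · exact h1

/-- The adjacency relation of a matrix. -/
def rel (g : Mat) (u v : ℕ) : Prop := adj g u v = true

/-- The matrix describes a simple graph. -/
structure IsGraph (g : Mat) : Prop where
  symm : ∀ u v, rel g u v → rel g v u
  irrefl : ∀ u, ¬ rel g u u
  lt : ∀ u v, rel g u v → v < g.length

section

variable {g : Mat} {A : List ℕ} {κ : ℕ}

theorem mem_outNbrs (hg : IsGraph g) {u w : ℕ} : w ∈ outNbrs g A u ↔ w ∉ A ∧ rel g u w := by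
  have := hg.lt u w
  simp only [outNbrs, List.mem_filter, List.mem_range, Bool.and_eq_true, Bool.not_eq_true',
    List.contains_eq_mem, decide_eq_false_iff_not, rel] at *
  tauto

theorem mem_cutEdges (hg : IsGraph g) {e : ℕ × ℕ} :
    e ∈ cutEdges g A ↔ e.1 ∈ A ∧ e.2 ∉ A ∧ rel g e.1 e.2 := by
  obtain ⟨u, w⟩ := e
  simp only [cutEdges, List.mem_flatMap, List.mem_map, mem_outNbrs hg, Prod.mk.injEq]
  constructor
  · rintro ⟨u', h, w', ⟨h1, h2⟩, rfl, rfl⟩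
    exact ⟨h, h1, h2⟩
  · rintro ⟨h, h1, h2⟩
    exact ⟨u, h, w, ⟨h1, h2⟩, rfl, rfl⟩

theorem isCov_iff (hg : IsGraph g) {D : Finset ℕ} :
    IsCov (rel g) A.toFinset D ↔ ∀ e ∈ cutEdges g A, e.1 ∈ D ∨ e.2 ∈ D := by
  simp only [IsCov, mem_cutEdges hg, List.mem_toFinset]
  exact ⟨fun h e he => h e.1 he.1 e.2 he.2.1 he.2.2,
    fun h u hu w hw e => h (u, w) ⟨hu, hw, e⟩⟩

theorem isBdry_bdry (hg : IsGraph g) : IsBdry (rel g) A.toFinset (bdry g A).toFinset := by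
  intro v
  have : ∀ l : List ℕ, (!l.isEmpty) = true ↔ ∃ w, w ∈ l := fun l => by
    cases l
    · simp
    · simp only [List.isEmpty_cons, Bool.not_false, true_iff]; exact ⟨_, List.mem_cons_self⟩
  simp only [bdry, List.mem_toFinset, List.mem_filter, this, mem_outNbrs hg]

theorem isJoin_iff (hg : IsGraph g) : isJoin g A = true ↔ IsJoin (rel g) A.toFinset := by
  have h := isBdry_bdry hg (A := A)
  simp only [IsBdry, List.mem_toFinset] at h
  simp only [isJoin, List.all_eq_true, mem_outNbrs hg, h, IsJoin, List.mem_toFinset]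
  constructor
  · intro h u hu v hv w x hw hx e e'
    exact h u ⟨hu, w, hw, e⟩ v ⟨hv, x, hx, e'⟩ w ⟨hw, e⟩
  · rintro h u ⟨hu, -⟩ v ⟨hv, x, hx, e'⟩ w ⟨hw, e⟩
    exact h u hu v hv w x hw hx e e'

theorem isBest_best (hg : IsGraph g) (h : covers κ (cutEdges g A) ≠ []) :
    IsBest (rel g) A.toFinset (best A (covers κ (cutEdges g A))).toFinset := by
  obtain ⟨h1, h2⟩ := best_spec (A := A) h
  set C := best A (covers κ (cutEdges g A))
  obtain ⟨c1, c2, c3, -⟩ := covers_spec h1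
  have out : ∀ D : List ℕ, D.Nodup → (D.filter fun v => !A.contains v).length =
      (D.toFinset \ A.toFinset).card := by
    intro D hD
    rw [← List.toFinset_card_of_nodup (hD.filter _)]
    congr 1
    ext v
    simp
  have cC := List.toFinset_card_of_nodup c1
  have low : ∀ D, IsCov (rel g) A.toFinset D → D.card ≤ κ → ∃ C' : List ℕ, C'.Nodup ∧
      C'.toFinset ⊆ D ∧ (C.length < C'.length ∨ (C.length = C'.length ∧
        (C.toFinset \ A.toFinset).card ≤ (C'.toFinset \ A.toFinset).card)) := by
    intro D hD hDκ
    obtain ⟨C', hC', hsub⟩ := exists_mem_covers hDκ ((isCov_iff hg).1 hD)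
    have hn := (covers_spec hC').1
    have := h2 C' hC'
    rw [← Bool.not_eq_true, prefers_iff, out _ c1, out _ hn] at this
    exact ⟨C', hn, hsub, by omega⟩
  refine ⟨(isCov_iff hg).2 fun e he => ?_, fun D hD => ?_, fun D hD hc => ?_⟩
  · simpa using c3 e he
  · by_cases hDκ : D.card ≤ κ
    · obtain ⟨C', hn, hsub, h⟩ := low D hD hDκ
      have h1 := Finset.card_le_card hsub
      rw [List.toFinset_card_of_nodup hn] at h1
      omega
    · omega
  · obtain ⟨C', hn, hsub, h⟩ := low D hD (by omega)
    have h1 := Finset.card_le_card hsub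
    have h2 := List.toFinset_card_of_nodup hn
    have h3 := Finset.eq_of_subset_of_card_le hsub (by omega)
    rw [← h3]
    omega

theorem kind_cutInfo (hg : IsGraph g) (h : (cutInfo g κ A).2.2 = true) :
    Kind (rel g) κ A.toFinset (cutInfo g κ A).1.toFinset (cutInfo g κ A).2.1.toFinset := by
  by_cases hc : covers κ (cutEdges g A) = []
  · have e : (covers κ (cutEdges g A)).isEmpty = true := by simp [hc]
    cases hj : isJoin g A
    · simp [cutInfo, e, hj] at h
    · right
      simp only [cutInfo, e, hj, cond_true, List.toFinset_nil, true_and]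
      refine ⟨isBdry_bdry hg, (isJoin_iff hg).1 hj, fun D hD => ?_⟩
      by_contra hD'
      obtain ⟨C, hC, -⟩ := exists_mem_covers (not_lt.1 hD') ((isCov_iff hg).1 hD)
      rw [hc] at hC
      simp at hC
  · have e : (covers κ (cutEdges g A)).isEmpty = false := by simp [hc]
    left
    simp only [cutInfo, e, cond_false, List.toFinset_nil, and_true]
    refine ⟨isBest_best hg hc, ?_⟩
    obtain ⟨h1, h2, -⟩ := covers_spec (best_spec (A := A) hc).1
    rw [List.toFinset_card_of_nodup h1]
    exact h2

theorem cutInfo_ok (hg : IsGraph g) (h : (∃ D, IsCov (rel g) A.toFinset D ∧ D.card ≤ κ) ∨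
    IsJoin (rel g) A.toFinset) : (cutInfo g κ A).2.2 = true := by
  by_cases hc : covers κ (cutEdges g A) = []
  · have e : (covers κ (cutEdges g A)).isEmpty = true := by simp [hc]
    rcases h with ⟨D, hD, hD'⟩ | h
    · obtain ⟨C, hC, -⟩ := exists_mem_covers hD' ((isCov_iff hg).1 hD)
      rw [hc] at hC
      simp at hC
    · simp [cutInfo, e, (isJoin_iff hg).2 h]
  · have e : (covers κ (cutEdges g A)).isEmpty = false := by simp [hc]
    simp [cutInfo, e]

end

theorem cutInfo_cov (g : Mat) (κ : ℕ) (A : List ℕ) :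
    (cutInfo g κ A).1.Nodup ∧ (cutInfo g κ A).1.length ≤ κ ∧
      ∀ v ∈ (cutInfo g κ A).1, v ∈ A ∨ v < g.length := by
  by_cases hc : covers κ (cutEdges g A) = []
  · have e : (covers κ (cutEdges g A)).isEmpty = true := by simp [hc]
    cases hj : isJoin g A <;> simp [cutInfo, e, hj]
  · have e : (covers κ (cutEdges g A)).isEmpty = false := by simp [hc]
    simp only [cutInfo, e, cond_false]
    obtain ⟨h1, h2, -, h4⟩ := covers_spec (best_spec (A := A) hc).1
    refine ⟨h1, h2, fun v hv => ?_⟩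
    obtain ⟨⟨u, w⟩, he, h⟩ := h4 v hv
    simp only [cutEdges, List.mem_flatMap, List.mem_map, Prod.mk.injEq, outNbrs, List.mem_filter,
      List.mem_range] at he
    obtain ⟨u', hu, w', ⟨hw, -⟩, rfl, rfl⟩ := he
    rcases h with rfl | rfl
    · exact Or.inl hu
    · exact Or.inr hw

end WhileLang

/-! ### Correctness of the dynamic programming -/

namespace WhileLang

open SplitMatching

theorem words_succ (q j : ℕ) : words q (j + 1) = (words q j).reverse.flatMap fun f =>
    ((List.range q).map fun c => c :: f).reverse := by
  have h : ∀ acc : Table, acc.foldl (fun out f =>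
      (List.range q).foldl (fun out c => (c :: f) :: out) out) [] =
      acc.reverse.flatMap fun f => ((List.range q).map fun c => c :: f).reverse := by
    intro acc
    have := foldl_prepend (fun f : List ℕ => ((List.range q).map fun c => c :: f).reverse) acc []
    rw [List.append_nil] at this
    rw [← this]
    congr 1
    funext out f
    rw [foldl_cons_map (fun c => c :: f)]
  rw [words, List.replicate_succ', List.foldl_append, List.foldl_cons, List.foldl_nil, h]
  rfl

theorem mem_words {q j : ℕ} {f : List ℕ} : f ∈ words q j ↔ f.length = j ∧ ∀ x ∈ f, x < q := by
  induction j generalizing f with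
  | zero =>
    simp only [words, List.replicate_zero, List.foldl_nil, List.mem_singleton]
    constructor
    · rintro rfl; simp
    · intro h; exact List.length_eq_zero_iff.1 h.1
  | succ j ih =>
    rw [words_succ]
    simp only [List.mem_flatMap, List.mem_reverse, List.mem_map, List.mem_range, ih]
    constructor
    · rintro ⟨f, ⟨rfl, h⟩, c, hc, rfl⟩
      simpa [hc] using h
    · rintro ⟨h1, h2⟩
      cases f with
      | nil => simp at h1
      | cons c f => exact ⟨f, ⟨by simpa using h1, fun x hx => h2 x (by simp [hx])⟩, c, h2 c (by simp), rfl⟩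

theorem length_words (q j : ℕ) : (words q j).length = q ^ j := by
  induction j with
  | zero => rfl
  | succ j ih =>
    rw [words_succ, List.length_flatMap]
    simp [ih, pow_succ]

theorem inTable_iff {e : Env} {f C : List ℕ} {T : Table} :
    e.inTable f C T = true ↔ C.map (e.look f) ∈ T := by
  rw [Env.inTable, foldl_or_any]
  simp

theorem ble_iff {a b : ℕ} : Nat.ble a b = true ↔ a ≤ b := by rw [Nat.ble_eq]

theorem look_map {e : Env} {φ : ℕ → ℕ} {v : ℕ} (hv : v ∈ e.bag) : e.look (e.bag.map φ) v = φ v := by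
  have h := List.idxOf_lt_length_of_mem hv
  rw [Env.look, List.getD_eq_getElem _ _ (by simpa using h), List.getElem_map, List.getElem_idxOf]

theorem look_lt {e : Env} {f : List ℕ} {v : ℕ} (hf : f.length = e.bag.length)
    (hq : ∀ x ∈ f, x < e.q) (hv : v ∈ e.bag) : e.look f v < e.q := by
  have h : e.bag.idxOf v < f.length := by rw [hf]; exact List.idxOf_lt_length_of_mem hv
  rw [Env.look, List.getD_eq_getElem _ _ h]
  exact hq _ (List.getElem_mem h)

theorem map_look {e : Env} {f f' : List ℕ} (hn : e.x.cov.Nodup) (hf : f.length = e.x.cov.length) :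
    e.x.cov.map (e.look (f ++ f')) = f := by
  refine List.ext_getElem (by simp [hf]) fun i h1 h2 => ?_
  have h3 : i < e.x.cov.length := by simpa using h1
  rw [List.getElem_map, Env.look, Env.bag,
    List.idxOf_append_of_mem (List.getElem_mem h3), hn.idxOf_getElem i h3,
    List.getD_append _ _ _ _ h2, List.getD_eq_getElem _ _ h2]

section

variable {e : Env} {f : List ℕ} {φ : ℕ → ℕ}

theorem mem_cols {S : List ℕ} {c : ℕ} (hS : ∀ v ∈ S, v ∈ e.bag)
    (h : ∀ v ∈ e.bag, e.look f v = φ v ∧ φ v < e.q) : c ∈ e.cols f S ↔ ∃ v ∈ S, φ v = c := by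
  simp only [Env.cols, List.mem_filter, List.mem_range, List.any_eq_true, beq_iff_eq]
  constructor
  · rintro ⟨-, v, hv, rfl⟩
    exact ⟨v, hv, (h v (hS v hv)).1.symm⟩
  · rintro ⟨v, hv, rfl⟩
    exact ⟨(h v (hS v hv)).2, v, hv, (h v (hS v hv)).1⟩

theorem nodup_cols (S : List ℕ) : (e.cols f S).Nodup := List.nodup_range.filter _

theorem mem_bag {v : ℕ} : v ∈ e.bag ↔
    v ∈ e.x.cov.toFinset ∪ (e.l.cov.toFinset ∪ e.r.cov.toFinset) := by
  simp [Env.bag]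

theorem mem_forb {s : Side} {c : ℕ} (h : ∀ v ∈ e.bag, e.look f v = φ v ∧ φ v < e.q) :
    c ∈ e.forb f s ↔ ∃ v ∈ e.x.cov.toFinset ∪ (e.l.cov.toFinset ∪ e.r.cov.toFinset),
      v ∉ s.set.toFinset ∧ (∃ u ∈ s.bd.toFinset, rel e.g u v) ∧ φ v = c := by
  rw [Env.forb, mem_cols (fun v hv => (List.mem_filter.1 hv).1) h]
  simp only [List.mem_filter, mem_bag, rel, Bool.and_eq_true, Bool.not_eq_true',
    List.contains_eq_mem, decide_eq_false_iff_not, List.any_eq_true, List.mem_toFinset, and_assoc]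

theorem bag_env (h : ∀ v ∈ e.bag, e.look f v = φ v ∧ φ v < e.q) :
    Bag (rel e.g) e.l.set.toFinset e.r.set.toFinset e.l.cov.toFinset e.r.cov.toFinset
      e.x.cov.toFinset e.l.bd.toFinset e.r.bd.toFinset e.x.bd.toFinset φ (e.forb f e.l).toFinset
      (e.forb f e.r).toFinset (e.outer f).toFinset (e.joined = true)
      ((e.l.bd.any fun u => e.x.bd.contains u) = true)
      ((e.r.bd.any fun u => e.x.bd.contains u) = true) where
  mem_FA c := by rw [List.mem_toFinset, mem_forb h]
  mem_FB c := by rw [List.mem_toFinset, mem_forb h]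
  mem_O c := by
    rw [List.mem_toFinset, Env.outer, mem_cols (fun v hv => (List.mem_filter.1 hv).1) h]
    simp [mem_bag, and_assoc]
  joined := by simp [Env.joined, rel]
  left := by simp
  right := by simp

theorem consistent_iff : e.consistent f = true ↔
    (∀ u ∈ e.bag, ∀ v ∈ e.bag, rel e.g u v → e.look f u ≠ e.look f v) ∧
    e.l.num + (e.forb f e.l).toFinset.card ≤ e.t ∧ e.r.num + (e.forb f e.r).toFinset.card ≤ e.t ∧
    (e.joined = true → e.l.num + e.r.num +
      ((e.forb f e.l).toFinset ∩ (e.forb f e.r).toFinset).card ≤ e.t) := by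
  have n : ∀ s, (e.forb f s).Nodup := fun s => nodup_cols _
  have i : ((e.forb f e.l).filter fun c => (e.forb f e.r).contains c).length =
      ((e.forb f e.l).toFinset ∩ (e.forb f e.r).toFinset).card := by
    rw [← List.toFinset_card_of_nodup ((n _).filter _)]
    congr 1
    ext v
    simp
  rw [List.toFinset_card_of_nodup (n _), List.toFinset_card_of_nodup (n _), ← i]
  simp only [Env.consistent, Bool.and_eq_true, ble_iff, List.all_eq_true, Bool.or_eq_true,
    Bool.not_eq_true', Bool.and_eq_false_iff, beq_eq_false_iff_ne, rel]
  have : ∀ (b : Bool) (P : Prop), (b = false ∨ P) ↔ (b = true → P) := by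
    intro b P; cases b <;> simp
  simp only [this]

theorem val_eq : e.val f = min e.t (outNum (e.forb f e.l).toFinset (e.forb f e.r).toFinset
    (e.outer f).toFinset e.l.num e.r.num (e.joined = true)
    ((e.l.bd.any fun u => e.x.bd.contains u) = true)
    ((e.r.bd.any fun u => e.x.bd.contains u) = true)) := by
  have n : (e.outer f).Nodup := nodup_cols _
  have i : ∀ s, ((e.outer f).filter fun c => !(e.forb f s).contains c).length =
      ((e.outer f).toFinset \ (e.forb f s).toFinset).card := by
    intro s
    rw [← List.toFinset_card_of_nodup (n.filter _)]
    congr 1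
    ext v
    simp
  have cif : ∀ (b : Bool) (x y : ℕ) (_ : Decidable (b = true)),
      (bif b then x else y) = if b = true then x else y := by
    intro b x y _; cases b <;> simp
  rw [outNum, List.toFinset_card_of_nodup n, Env.val, i, i, Env.part, Env.part]
  simp only [cif _ _ _ (Classical.propDecidable _)]

end

/-- The meaning of the data at a node. -/
structure Sem (g : Mat) (κ t q : ℕ) (N : Node) : Prop where
  kind : Kind (rel g) κ N.1.set.toFinset N.1.cov.toFinset N.1.bd.toFinset
  nodup : N.1.cov.Nodup
  mem : ∀ c, c ∈ N.2 ↔ (∀ x ∈ c, x < q) ∧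
    ∃ h, ColOn (rel g) t (N.1.set.toFinset ∪ N.1.cov.toFinset) h ∧ N.1.cov.map h = c
  le : ∀ h, ColOn (rel g) t (N.1.set.toFinset ∪ N.1.cov.toFinset) h →
    N.1.num ≤ (N.1.bd.toFinset.image h).card
  ex : ∀ h₀, ColOn (rel g) t (N.1.set.toFinset ∪ N.1.cov.toFinset) h₀ →
    ∃ h, ColOn (rel g) t (N.1.set.toFinset ∪ N.1.cov.toFinset) h ∧
      (N.1.bd.toFinset.image h).card ≤ N.1.num

theorem Sem.exists_col {g : Mat} {κ t q : ℕ} {N : Node} (h : Sem g κ t q N) {φ : ℕ → ℕ}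
    (hφ : N.1.cov.map φ ∈ N.2) : ∃ h, ColOn (rel g) t (N.1.set.toFinset ∪ N.1.cov.toFinset) h ∧
      (∀ v ∈ N.1.cov.toFinset, h v = φ v) ∧ (N.1.bd.toFinset.image h).card = N.1.num := by
  obtain ⟨-, h0, h1, h2⟩ := (h.mem _).1 hφ
  by_cases hB : N.1.bd.toFinset.Nonempty
  · obtain ⟨h3, h4, h5⟩ := h.ex h0 h1
    refine ⟨h3, h4, ?_, le_antisymm h5 (h.le _ h4)⟩
    rw [h.kind.cov_eq_empty hB]
    simp
  · rw [Finset.not_nonempty_iff_eq_empty] at hB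
    refine ⟨h0, h1, fun v hv => ?_, ?_⟩
    · exact List.map_inj_left.1 h2 v (List.mem_toFinset.1 hv)
    · have := h.le _ h1
      rw [hB] at this ⊢
      simp only [Finset.image_empty, Finset.card_empty] at this ⊢
      omega

theorem feas_iff {e : Env} {TL TR : Table} {f : List ℕ} : e.feas TL TR f = true ↔
    e.consistent f = true ∧ e.l.cov.map (e.look f) ∈ TL ∧ e.r.cov.map (e.look f) ∈ TR := by
  rw [← inTable_iff, ← inTable_iff, Env.feas]
  cases e.consistent f <;> cases e.inTable f e.l.cov TL <;> simp

theorem mem_nodeTable {e : Env} {TL TR W W' : Table} {c : List ℕ} : c ∈ nodeTable e TL TR W W' ↔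
    c ∈ W ∧ ∃ c' ∈ W', e.feas TL TR (c ++ c') = true := by
  rw [nodeTable]
  simp only [foldl_or_any, Bool.false_or]
  rw [foldl_cons_filter (fun f => W'.any fun f' => e.feas TL TR (f ++ f'))]
  simp

theorem foldl_min (p : List ℕ → Bool) (v : List ℕ → ℕ) (l : Table) (t : ℕ) :
    let j := l.foldl (fun j f => bif p f then min j (v f) else j) t
    j ≤ t ∧ (∀ f ∈ l, p f = true → j ≤ v f) ∧ (j = t ∨ ∃ f ∈ l, p f = true ∧ j = v f) := by
  induction l generalizing t with
  | nil => simp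
  | cons a l ih =>
    simp only [List.foldl_cons]
    obtain ⟨h1, h2, h3⟩ := ih (bif p a then min t (v a) else t)
    cases hp : p a
    · simp only [hp, cond_false] at h1 h2 h3 ⊢
      refine ⟨h1, fun f hf hpf => ?_, ?_⟩
      · rcases List.mem_cons.1 hf with rfl | hf
        · rw [hp] at hpf; simp at hpf
        · exact h2 f hf hpf
      · rcases h3 with h3 | ⟨f, hf, h⟩
        · exact Or.inl h3
        · exact Or.inr ⟨f, by simp [hf], h⟩
    · simp only [hp, cond_true] at h1 h2 h3 ⊢
      refine ⟨h1.trans (min_le_left _ _), fun f hf hpf => ?_, ?_⟩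
      · rcases List.mem_cons.1 hf with rfl | hf
        · exact h1.trans (min_le_right _ _)
        · exact h2 f hf hpf
      · rcases h3 with h3 | ⟨f, hf, h⟩
        · rcases min_choice t (v a) with h4 | h4
          · exact Or.inl (h3.trans h4)
          · exact Or.inr ⟨a, by simp, hp, h3.trans h4⟩
        · exact Or.inr ⟨f, by simp [hf], h⟩

section

variable {g : Mat} {κ t q : ℕ} {a b : Node} {e : Env}

/-- Soundness at a node. -/
theorem exists_col_of_feas (hg : IsGraph g) (ha : Sem g κ t q a) (hb : Sem g κ t q b)
    (hd : Disjoint a.1.set.toFinset b.1.set.toFinset) (h1 : e.g = g) (h2 : e.t = t) (h3 : e.q = q)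
    (h4 : e.l = a.1) (h5 : e.r = b.1) (hqt : q ≤ t)
    (hk : Kind (rel g) κ (a.1.set.toFinset ∪ b.1.set.toFinset) e.x.cov.toFinset e.x.bd.toFinset)
    {f : List ℕ} (hf : f.length = e.bag.length) (hfq : ∀ x ∈ f, x < q)
    (hfe : e.feas a.2 b.2 f = true) :
    ∃ h, ColOn (rel g) t (a.1.set.toFinset ∪ b.1.set.toFinset ∪ e.x.cov.toFinset) h ∧
      (∀ v ∈ e.x.cov.toFinset, h v = e.look f v) ∧ (e.x.bd.toFinset.image h).card ≤ e.val f := by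
  obtain ⟨f1, f2, f3⟩ := feas_iff.1 hfe
  obtain ⟨c1, c2, c3, c4⟩ := consistent_iff.1 f1
  have hlt : ∀ v ∈ e.bag, e.look f v < e.q := fun v hv => look_lt hf (h3 ▸ hfq) hv
  have hbag := bag_env (e := e) (f := f) (φ := e.look f) fun v hv => ⟨rfl, hlt v hv⟩
  rw [h4] at f2
  rw [h5] at f3
  have hA := ha.exists_col f2
  have hB := hb.exists_col f3
  rw [h1, h4, h5] at hbag
  rw [h2, h4] at c2
  rw [h2, h5] at c3
  rw [h2, h4, h5] at c4
  obtain ⟨h, k1, k2, k3⟩ := combine_sound hg.symm hd ha.kind hb.kind hk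
    ⟨fun u hu => by
        rw [← h4, ← h5, ← mem_bag] at hu
        exact (hlt u hu).trans_le (h3 ▸ hqt), fun u hu v hv => by
        rw [← h4, ← h5, ← mem_bag] at hu hv
        rw [← h1]
        exact c1 u hu v hv⟩ hA hB hbag c2 c3 c4
  refine ⟨h, k1, k2, ?_⟩
  rw [val_eq, h2, h4, h5]
  refine le_min ?_ k3
  rw [← Finset.card_range t]
  refine Finset.card_le_card fun c hc => ?_
  obtain ⟨v, hv, rfl⟩ := Finset.mem_image.1 hc
  exact Finset.mem_range.2 (k1.1 v (Finset.mem_union_left _ (hk.bd_subset hv)))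

/-- Completeness at a node. -/
theorem exists_feas (hg : IsGraph g) (ha : Sem g κ t q a) (hb : Sem g κ t q b)
    (hd : Disjoint a.1.set.toFinset b.1.set.toFinset) (h1 : e.g = g) (h2 : e.t = t) (h3 : e.q = q)
    (h4 : e.l = a.1) (h5 : e.r = b.1) (hq : q = min t (κ + κ + κ))
    (hk : Kind (rel g) κ (a.1.set.toFinset ∪ b.1.set.toFinset) e.x.cov.toFinset e.x.bd.toFinset)
    {h : ℕ → ℕ} (hc : ColOn (rel g) t (a.1.set.toFinset ∪ b.1.set.toFinset ∪ e.x.cov.toFinset) h)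
    (hlt : ∀ v ∈ e.x.cov, h v < q) :
    ∃ f' ∈ words q (e.l.cov ++ e.r.cov).length, e.feas a.2 b.2 (e.x.cov.map h ++ f') = true ∧
      e.val (e.x.cov.map h ++ f') ≤ (e.x.bd.toFinset.image h).card := by
  have hsub := bag_subset ha.kind hb.kind hk
  have hcard : (e.x.cov.toFinset ∪ (a.1.cov.toFinset ∪ b.1.cov.toFinset)).card ≤ κ + κ + κ := by
    have i1 := ha.kind.card_le
    have i2 := hb.kind.card_le
    have i3 := hk.card_le
    have i4 := Finset.card_union_le a.1.cov.toFinset b.1.cov.toFinset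
    have i5 := Finset.card_union_le e.x.cov.toFinset (a.1.cov.toFinset ∪ b.1.cov.toFinset)
    omega
  obtain ⟨φ, p1, p2, p3, p4⟩ := exists_small_col (q := q) hc hsub Finset.subset_union_left
    (by omega) (by omega) (fun v hv => hlt v (List.mem_toFinset.1 hv))
  have hbagq : ∀ v ∈ e.bag, φ v < q := fun v hv => p3 v (by rw [mem_bag, h4, h5] at hv; exact hv)
  have hmap : e.x.cov.map h ++ (e.l.cov ++ e.r.cov).map φ = e.bag.map φ := by
    rw [Env.bag, List.map_append (l₁ := e.x.cov)]
    congr 1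
    exact List.map_congr_left fun v hv => (p2 v (List.mem_toFinset.2 hv)).symm
  refine ⟨(e.l.cov ++ e.r.cov).map φ, mem_words.2 ⟨by simp, fun x hx => ?_⟩, ?_⟩
  · obtain ⟨v, hv, rfl⟩ := List.mem_map.1 hx
    exact hbagq v (by rw [Env.bag]; exact List.mem_append_right _ hv)
  rw [hmap]
  have hl : ∀ v ∈ e.bag, e.look (e.bag.map φ) v = φ v := fun v hv => look_map hv
  have hbag := bag_env (e := e) (f := e.bag.map φ) (φ := φ) fun v hv =>
    ⟨hl v hv, h3 ▸ hbagq v hv⟩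
  rw [h1, h4, h5] at hbag
  have subA : a.1.set.toFinset ∪ a.1.cov.toFinset ⊆
      a.1.set.toFinset ∪ b.1.set.toFinset ∪ e.x.cov.toFinset :=
    Finset.union_subset (Finset.subset_union_left.trans Finset.subset_union_left)
      ((Finset.subset_union_left.trans Finset.subset_union_right).trans hsub)
  have subB : b.1.set.toFinset ∪ b.1.cov.toFinset ⊆
      a.1.set.toFinset ∪ b.1.set.toFinset ∪ e.x.cov.toFinset :=
    Finset.union_subset (Finset.subset_union_right.trans Finset.subset_union_left)
      ((Finset.subset_union_right.trans Finset.subset_union_right).trans hsub)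
  obtain ⟨i1, i2, i3, i4⟩ := combine_complete hg.symm hd ha.kind hb.kind hk p1 hbag
    (ha.le φ (p1.mono subA)) (hb.le φ (p1.mono subB))
  have hL : ∀ v ∈ e.l.cov, v ∈ e.bag := fun v hv => by simp [Env.bag, hv]
  have hR : ∀ v ∈ e.r.cov, v ∈ e.bag := fun v hv => by simp [Env.bag, hv]
  refine ⟨feas_iff.2 ⟨consistent_iff.2 ⟨fun u hu v hv r => ?_, ?_⟩, ?_, ?_⟩, ?_⟩
  · rw [hl u hu, hl v hv]
    rw [mem_bag, h4, h5] at hu hv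
    exact p1.2 u (hsub hu) v (hsub hv) (h1 ▸ r)
  · rw [h2, h4, h5]
    exact ⟨i1, i2, i3⟩
  · rw [List.map_congr_left fun v hv => hl v (hL v hv), ha.mem]
    refine ⟨fun x hx => ?_, φ, p1.mono subA, by rw [h4]⟩
    obtain ⟨v, hv, rfl⟩ := List.mem_map.1 hx
    exact hbagq v (hL v hv)
  · rw [List.map_congr_left fun v hv => hl v (hR v hv), hb.mem]
    refine ⟨fun x hx => ?_, φ, p1.mono subB, by rw [h5]⟩
    obtain ⟨v, hv, rfl⟩ := List.mem_map.1 hx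
    exact hbagq v (hR v hv)
  · rw [val_eq, h4, h5, ← p4]
    exact (min_le_right _ _).trans i4

theorem sem_joinNode (hg : IsGraph g) (hq : q = min t (κ + κ + κ)) (ha : Sem g κ t q a)
    (hb : Sem g κ t q b) (hd : Disjoint a.1.set.toFinset b.1.set.toFinset)
    (hok : (cutInfo g κ (a.1.set ++ b.1.set)).2.2 = true) :
    Sem g κ t q (joinNode (g, κ, t, q) a b) := by
  have hk := kind_cutInfo hg hok
  obtain ⟨hn, -⟩ := cutInfo_cov g κ (a.1.set ++ b.1.set)
  rw [List.toFinset_append] at hk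
  rw [joinNode]
  simp only [hok]
  set e := mkEnv (g, κ, t, q) a.1 b.1 (a.1.set ++ b.1.set) (cutInfo g κ (a.1.set ++ b.1.set)) with he
  have e1 : e.g = g := rfl
  have e2 : e.t = t := rfl
  have e3 : e.q = q := rfl
  have e4 : e.l = a.1 := rfl
  have e5 : e.r = b.1 := rfl
  have e6 : e.x.set = a.1.set ++ b.1.set := rfl
  replace hk : Kind (rel g) κ (a.1.set.toFinset ∪ b.1.set.toFinset) e.x.cov.toFinset
    e.x.bd.toFinset := hk
  replace hn : e.x.cov.Nodup := hn
  clear_value e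
  have hset : e.x.set.toFinset = a.1.set.toFinset ∪ b.1.set.toFinset := by
    rw [e6, List.toFinset_append]
  have sound := fun {f : List ℕ} => exists_col_of_feas (f := f) hg ha hb hd e1 e2 e3 e4 e5
    (by omega) hk
  have complete := fun {h : ℕ → ℕ} => exists_feas (h := h) hg ha hb hd e1 e2 e3 e4 e5 hq hk
  have hlen : ∀ {f f' : List ℕ}, f ∈ words e.q e.x.cov.length →
      f' ∈ words e.q (e.l.cov ++ e.r.cov).length → (f ++ f').length = e.bag.length ∧
        ∀ x ∈ f ++ f', x < q := by
    intro f f' hf hf'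
    rw [mem_words] at hf hf'
    refine ⟨by simp only [Env.bag, List.length_append, hf.1, hf'.1], fun x hx => ?_⟩
    rcases List.mem_append.1 hx with hx | hx
    · exact e3 ▸ hf.2 x hx
    · exact e3 ▸ hf'.2 x hx
  refine ⟨?_, hn, fun c => ?_, fun h hc => ?_, fun h₀ hc => ?_⟩
  · change Kind (rel g) κ e.x.set.toFinset e.x.cov.toFinset e.x.bd.toFinset
    rw [hset]
    exact hk
  · change c ∈ nodeTable e a.2 b.2 (words e.q e.x.cov.length)
      (words e.q (e.l.cov ++ e.r.cov).length) ↔ (∀ x ∈ c, x < q) ∧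
      ∃ h, ColOn (rel g) t (e.x.set.toFinset ∪ e.x.cov.toFinset) h ∧ e.x.cov.map h = c
    rw [hset, mem_nodeTable]
    constructor
    · rintro ⟨hcw, c', hcw', hfe⟩
      obtain ⟨l1, l2⟩ := hlen hcw hcw'
      obtain ⟨h, k1, k2, -⟩ := sound l1 l2 hfe
      refine ⟨fun x hx => l2 x (by simp [hx]), h, k1, ?_⟩
      rw [← map_look (f' := c') hn (mem_words.1 hcw).1]
      exact List.map_congr_left fun v hv => k2 v (List.mem_toFinset.2 hv)
    · rintro ⟨hcq, h, k1, rfl⟩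
      obtain ⟨f', hf', k2, -⟩ := complete k1 fun v hv => hcq _ (List.mem_map_of_mem hv)
      exact ⟨mem_words.2 ⟨by simp, e3.symm ▸ hcq⟩, f', by rw [e3]; exact hf', k2⟩
  · change ColOn (rel g) t (e.x.set.toFinset ∪ e.x.cov.toFinset) h at hc
    change nodeNum e a.2 b.2 (words e.q (e.l.cov ++ e.r.cov).length) ≤
      (e.x.bd.toFinset.image h).card
    rw [hset] at hc
    rw [nodeNum]
    cases hemp : e.x.bd.isEmpty
    · have hne : e.x.bd.toFinset.Nonempty := by
        rw [List.toFinset_nonempty_iff]; simpa using hemp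
      have hC : e.x.cov = [] := List.toFinset_eq_empty_iff _ |>.1 (hk.cov_eq_empty hne)
      obtain ⟨f', hf', k2, k3⟩ := complete hc (by simp [hC])
      rw [hC, List.map_nil, List.nil_append] at k2 k3
      rw [cond_false]
      rw [← e3] at hf'
      exact ((foldl_min _ _ _ _).2.1 f' hf' k2).trans k3
    · simp
  · change ColOn (rel g) t (e.x.set.toFinset ∪ e.x.cov.toFinset) h₀ at hc
    change ∃ h, ColOn (rel g) t (e.x.set.toFinset ∪ e.x.cov.toFinset) h ∧
      (e.x.bd.toFinset.image h).card ≤ nodeNum e a.2 b.2 (words e.q (e.l.cov ++ e.r.cov).length)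
    rw [hset] at hc ⊢
    rw [nodeNum]
    cases hemp : e.x.bd.isEmpty
    · have hne : e.x.bd.toFinset.Nonempty := by
        rw [List.toFinset_nonempty_iff]; simpa using hemp
      have hC : e.x.cov = [] := List.toFinset_eq_empty_iff _ |>.1 (hk.cov_eq_empty hne)
      rw [cond_false]
      rcases (foldl_min (fun f' => e.feas a.2 b.2 f') (fun f' => e.val f')
        (words e.q (e.l.cov ++ e.r.cov).length) e.t).2.2 with h1 | ⟨f, hf, h1, h2⟩
      · refine ⟨h₀, hc, ?_⟩
        rw [h1, e2, ← Finset.card_range t]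
        refine Finset.card_le_card fun c hc' => ?_
        obtain ⟨v, hv, rfl⟩ := Finset.mem_image.1 hc'
        exact Finset.mem_range.2 (hc.1 v (Finset.mem_union_left _ (hk.bd_subset hv)))
      · have hmem : ([] : List ℕ) ∈ words e.q e.x.cov.length := by simp [hC, mem_words]
        obtain ⟨l1, l2⟩ := hlen hmem hf
        obtain ⟨h, k1, -, k2⟩ := sound l1 l2 h1
        exact ⟨h, k1, k2.trans h2.ge⟩
    · refine ⟨h₀, hc, ?_⟩
      rw [List.isEmpty_iff] at hemp
      simp [hemp]

theorem sem_leafNode (hg : IsGraph g) (hκ : 1 ≤ κ) (ht : 1 ≤ t) (hq : q = min t (κ + κ + κ)) (v : ℕ) :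
    Sem g κ t q (leafNode (g, κ, t, q) v) := by
  have cov : IsCov (rel g) [v].toFinset {v} := by
    intro u hu w _ _
    simp at hu
    simp [hu]
  have hok := cutInfo_ok hg (κ := κ) (Or.inl ⟨{v}, cov, by simpa using hκ⟩)
  have hk := kind_cutInfo hg hok
  obtain ⟨hn, -⟩ := cutInfo_cov g κ [v]
  have hk' : IsBest (rel g) [v].toFinset (cutInfo g κ [v]).1.toFinset ∧
      (cutInfo g κ [v]).1.toFinset.card ≤ κ := by
    rcases hk with hk | ⟨-, -, -, hk⟩
    · exact ⟨hk.1, hk.2.1⟩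
    · have := hk _ cov
      simp at this
      omega
  have hC : ∀ w ∈ (cutInfo g κ [v]).1, w = v := by
    intro w hw
    by_contra hne
    have hw' := List.mem_toFinset.2 hw
    have hwv : w ∉ [v].toFinset := by simpa using hne
    have h1 := hk'.1.le _ cov
    rw [Finset.card_singleton] at h1
    have h2 := Finset.card_pos.2 ⟨w, hw'⟩
    have h3 := hk'.1.out_le _ cov (by rw [Finset.card_singleton]; omega)
    have h4 := Finset.card_pos.2 ⟨w, Finset.mem_sdiff.2 ⟨hw', hwv⟩⟩
    simp only [List.toFinset_cons, List.toFinset_nil, insert_empty_eq, sdiff_self,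
      Finset.bot_eq_empty, Finset.card_empty] at h3 h4
    omega
  have hcol : ∀ h : ℕ → ℕ, ColOn (rel g) t ([v].toFinset ∪ (cutInfo g κ [v]).1.toFinset) h ↔
      h v < t := by
    intro h
    have e : [v].toFinset ∪ (cutInfo g κ [v]).1.toFinset = {v} := by
      ext w
      have := hC w
      simp only [Finset.mem_union, List.mem_toFinset, List.mem_singleton, Finset.mem_singleton]
      tauto
    rw [e]
    constructor
    · intro h; exact h.1 v (by simp)
    · intro hv
      refine ⟨by simpa using hv, fun u hu w hw r => ?_⟩
      rw [Finset.mem_singleton] at hu hw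
      subst hu hw
      exact absurd r (hg.irrefl _)
  refine ⟨Or.inl ⟨hk'.1, hk'.2, rfl⟩, hn, fun c => ?_, fun h hc => Nat.zero_le _, fun h hc => ⟨h, hc, by
    change (Finset.image h ([] : List ℕ).toFinset).card ≤ 0
    simp⟩⟩
  change c ∈ words q (cutInfo g κ [v]).1.length ↔ (∀ x ∈ c, x < q) ∧
    ∃ h, ColOn (rel g) t ([v].toFinset ∪ (cutInfo g κ [v]).1.toFinset) h ∧
      (cutInfo g κ [v]).1.map h = c
  simp only [hcol]
  rw [mem_words]
  constructor
  · rintro ⟨h1, h2⟩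
    refine ⟨h2, fun _ => c.headD 0, ?_, ?_⟩
    · cases c with
      | nil => simp only [List.headD_nil]; omega
      | cons x c =>
        have := h2 x (by simp)
        simp only [List.headD_cons]
        omega
    · have hl : c.length ≤ 1 := by
        rw [h1, ← List.toFinset_card_of_nodup hn]
        exact (hk'.1.le _ cov).trans (by simp)
      rw [List.map_const', ← h1]
      match c, hl with
      | [], _ => rfl
      | [x], _ => rfl
  · rintro ⟨h1, h, -, rfl⟩
    exact ⟨by simp, h1⟩

end

end WhileLang

namespace WhileLang

open SplitMatching

/-- Binary trees with leaves labelled by vertices. -/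
inductive BT : Type
  | leaf : ℕ → BT
  | node : BT → BT → BT

/-- The labels of the leaves. -/
def BT.leaves : BT → List ℕ
  | .leaf v => [v]
  | .node l r => l.leaves ++ r.leaves

/-- The postorder of a tree, right subtrees first. -/
def BT.post : BT → List (List ℕ)
  | .leaf v => [[v]]
  | .node l r => r.post ++ (l.post ++ [[]])

/-- The evaluation of a tree. -/
def BT.eval (p : Par) : BT → Node
  | .leaf v => leafNode p v
  | .node l r => joinNode p (l.eval p) (r.eval p)

/-- The set of leaves of every subtree has the property `P`. -/
def BT.AllSub (P : List ℕ → Prop) : BT → Prop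
  | .leaf v => P [v]
  | .node l r => l.AllSub P ∧ r.AllSub P ∧ P (l.leaves ++ r.leaves)

theorem foldl_post (p : Par) (t : BT) (st : List Node) :
    t.post.foldl (evalStep p) st = t.eval p :: st := by
  induction t generalizing st with
  | leaf v => simp [BT.post, evalStep, BT.eval]
  | node l r hl hr => simp [BT.post, List.foldl_append, hl, hr, evalStep, BT.eval]

theorem eval_set (p : Par) (t : BT) : (t.eval p).1.set = t.leaves := by
  induction t with
  | leaf v => rfl
  | node l r hl hr =>
    change (l.eval p).1.set ++ (r.eval p).1.set = _
    rw [hl, hr]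
    rfl

/-- The cut of `A` has a small cover or is complete bipartite. -/
def CutOk (g : Mat) (κ : ℕ) (A : List ℕ) : Prop := (cutInfo g κ A).2.2 = true

theorem sem_eval {g : Mat} {κ t q : ℕ} (hg : IsGraph g) (hκ : 1 ≤ κ) (ht : 1 ≤ t)
    (hq : q = min t (κ + κ + κ)) (T : BT) (hT : T.leaves.Nodup) (hok : T.AllSub (CutOk g κ)) :
    Sem g κ t q (T.eval (g, κ, t, q)) := by
  induction T with
  | leaf v => exact sem_leafNode hg hκ ht hq v
  | node l r hl hr =>
    obtain ⟨h1, h2, h3⟩ := List.nodup_append.1 hT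
    refine sem_joinNode hg hq (hl h1 hok.1) (hr h2 hok.2.1) ?_ ?_
    · rw [eval_set, eval_set, Finset.disjoint_left]
      intro v hv hv'
      exact h3 v (List.mem_toFinset.1 hv) v (List.mem_toFinset.1 hv') rfl
    · rw [eval_set, eval_set]
      exact hok.2.2

theorem allSub_of_eval {g : Mat} {κ t q : ℕ} (hg : IsGraph g) (hκ : 1 ≤ κ) (T : BT)
    (h : (T.eval (g, κ, t, q)).2 ≠ []) : T.AllSub (CutOk g κ) := by
  induction T with
  | leaf v =>
    refine cutInfo_ok hg (Or.inl ⟨{v}, fun u hu w _ _ => ?_, by simpa using hκ⟩)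
    simp at hu
    simp [hu]
  | node l r hl hr =>
    obtain ⟨c, hc⟩ := List.exists_mem_of_ne_nil _ h
    simp only [BT.eval, joinNode, finishNode] at hc
    rw [eval_set, eval_set] at hc
    cases hok : (cutInfo g κ (l.leaves ++ r.leaves)).2.2
    · simp [hok] at hc
    · rw [hok, cond_true, mem_nodeTable] at hc
      obtain ⟨-, c', -, hf⟩ := hc
      obtain ⟨-, h1, h2⟩ := feas_iff.1 hf
      exact ⟨hl (List.ne_nil_of_mem h1), hr (List.ne_nil_of_mem h2), hok⟩

theorem decideCol_iff {g : Mat} {κ t : ℕ} (hg : IsGraph g) (hκ : 1 ≤ κ) (ht : 1 ≤ t) (T : BT)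
    (hT : T.leaves.Nodup) (hc : ∀ u v, rel g u v → v ∈ T.leaves) :
    decideCol g T.post κ t = true ↔
      T.AllSub (CutOk g κ) ∧ ∃ h, ColOn (rel g) t T.leaves.toFinset h := by
  rw [decideCol, foldl_post, List.headD_cons, Bool.not_eq_true', List.isEmpty_eq_false_iff]
  have key : T.AllSub (CutOk g κ) →
      ((T.eval (g, κ, t, min t (κ + κ + κ))).2 ≠ [] ↔ ∃ h, ColOn (rel g) t T.leaves.toFinset h) := by
    intro hok
    have hs := sem_eval hg hκ ht rfl T hT hok
    have hset := eval_set (g, κ, t, min t (κ + κ + κ)) T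
    set N := T.eval (g, κ, t, min t (κ + κ + κ))
    have hcov0 : ∀ D, IsCov (rel g) N.1.set.toFinset D := fun D u hu w hw e => by
      rw [hset, List.mem_toFinset] at hw
      exact absurd (hc u w e) hw
    have hcov : N.1.cov = [] := by
      rw [← List.toFinset_eq_empty_iff]
      rcases hs.kind with h | h
      · have := h.1.le ∅ (hcov0 _)
        simpa using this
      · exact h.1
    have hm := hs.mem
    simp only [hcov, List.toFinset_nil, Finset.union_empty, List.map_nil, hset] at hm
    constructor
    · intro h
      obtain ⟨c, h⟩ := List.exists_mem_of_ne_nil _ h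
      obtain ⟨-, h', h1, -⟩ := (hm c).1 h
      exact ⟨h', h1⟩
    · rintro ⟨h, h1⟩
      exact List.ne_nil_of_mem ((hm []).2 ⟨by simp, h, h1, rfl⟩)
  constructor
  · intro h
    have hok := allSub_of_eval hg hκ T h
    exact ⟨hok, (key hok).1 h⟩
  · rintro ⟨hok, h⟩
    exact (key hok).2 h

/-- One step of the search for the chromatic number. -/
def chromStep (g : Mat) (items : List (List ℕ)) (r : ℕ) (c : ℕ × ℕ) : ℕ :=
  bif !Nat.ble r 0 then r else bif decideCol g items c.1 c.2 then c.2 else 0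

theorem chromatic_eq (g : Mat) (items : List (List ℕ)) (l : List (ℕ × ℕ)) :
    chromatic g items l = l.foldl (chromStep g items) 0 := rfl

theorem chromStep_pos {g : Mat} {items : List (List ℕ)} {r : ℕ} {c : ℕ × ℕ} (h : r ≠ 0) :
    chromStep g items r c = r := by
  have : Nat.ble r 0 = false := by rw [← Bool.not_eq_true, Nat.ble_eq]; omega
  simp [chromStep, this]

theorem foldl_chromStep_pos {g : Mat} {items : List (List ℕ)} {r : ℕ} {l : List (ℕ × ℕ)}
    (h : r ≠ 0) : l.foldl (chromStep g items) r = r := by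
  induction l with
  | nil => rfl
  | cons c l ih => rw [List.foldl_cons, chromStep_pos h, ih]

section

variable {g : Mat} {items : List (List ℕ)} {χ n : ℕ}

open Classical in
theorem foldl_colours {κ : ℕ} {ok : Prop} (hχ : 1 ≤ χ)
    (h : ∀ t, 1 ≤ t → (decideCol g items κ t = true ↔ ok ∧ χ ≤ t)) (j : ℕ) :
    ((List.range j).map fun t => (κ, t + 1)).foldl (chromStep g items) 0 =
      if ok ∧ χ ≤ j then χ else 0 := by
  induction j with
  | zero => simp; omega
  | succ j ih =>
    rw [List.range_succ, List.map_append, List.foldl_append, ih]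
    simp only [List.map_cons, List.map_nil, List.foldl_cons, List.foldl_nil]
    by_cases hj : ok ∧ χ ≤ j
    · rw [if_pos hj, if_pos ⟨hj.1, hj.2.trans (Nat.le_succ j)⟩, chromStep_pos (by omega)]
    · rw [if_neg hj]
      by_cases hj' : ok ∧ χ ≤ j + 1
      · have e : χ = j + 1 := by
          by_contra hne
          exact hj ⟨hj'.1, by have := hj'.2; omega⟩
        rw [if_pos hj']
        simp [chromStep, (h (j + 1) (by omega)).2 hj', Nat.ble, e]
      · rw [if_neg hj']
        have : decideCol g items κ (j + 1) = false := by
          rw [← Bool.not_eq_true, h (j + 1) (by omega)]; exact hj'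
        simp [chromStep, this]

/-- The candidates with covers of at most `i` elements. -/
def candidatesTo (n i : ℕ) : List (ℕ × ℕ) :=
  (List.range i).flatMap fun κ => (List.range n).map fun t => (κ + 1, t + 1)

theorem foldl_candidatesTo {ok : ℕ → Prop} (hχ : 1 ≤ χ)
    (h : ∀ κ t, 1 ≤ κ → 1 ≤ t → (decideCol g items κ t = true ↔ ok κ ∧ χ ≤ t)) (i : ℕ) :
    (candidatesTo n i).foldl (chromStep g items) 0 = 0 ∨
      (candidatesTo n i).foldl (chromStep g items) 0 = χ := by
  classical
  induction i with
  | zero => left; rfl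
  | succ i ih =>
    rw [candidatesTo, List.range_succ, List.flatMap_append, List.foldl_append]
    change List.foldl _ (List.foldl _ 0 (candidatesTo n i)) _ = 0 ∨
      List.foldl _ (List.foldl _ 0 (candidatesTo n i)) _ = χ
    rcases ih with ih | ih
    · rw [ih, List.flatMap_cons, List.flatMap_nil, List.append_nil,
        foldl_colours hχ (h (i + 1) · (by omega))]
      split_ifs <;> simp
    · rw [ih, foldl_chromStep_pos (by omega)]
      exact Or.inr rfl

theorem foldl_candidatesTo_eq {ok : ℕ → Prop} (hχ : 1 ≤ χ) (hn : χ ≤ n)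
    (h : ∀ κ t, 1 ≤ κ → 1 ≤ t → (decideCol g items κ t = true ↔ ok κ ∧ χ ≤ t)) {κ : ℕ}
    (hκ : 1 ≤ κ) (hok : ok κ) : (candidatesTo n κ).foldl (chromStep g items) 0 = χ := by
  classical
  obtain ⟨i, rfl⟩ : ∃ i, κ = i + 1 := ⟨κ - 1, by omega⟩
  have := foldl_candidatesTo (n := n) hχ h i
  rw [candidatesTo, List.range_succ, List.flatMap_append, List.foldl_append]
  change List.foldl _ (List.foldl _ 0 (candidatesTo n i)) _ = χ
  rcases this with ih | ih
  · rw [ih, List.flatMap_cons, List.flatMap_nil, List.append_nil,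
      foldl_colours hχ (h (i + 1) · (by omega)), if_pos ⟨hok, hn⟩]
  · rw [ih, foldl_chromStep_pos (by omega)]

theorem candidates_eq_append {κ : ℕ} (h : κ ≤ n) : ∃ l, candidates n = candidatesTo n κ ++ l := by
  obtain ⟨j, rfl⟩ := Nat.exists_eq_add_of_le h
  refine ⟨((List.range j).map (κ + ·)).flatMap fun i =>
    (List.range (κ + j)).map fun t => (i + 1, t + 1), ?_⟩
  rw [candidates, candidatesTo, ← List.flatMap_append, List.range_add]

end

end WhileLang

/-! ### Running times with an exponential factor -/

namespace WhileLang

open Code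

section

variable {α β γ δ σ : Type} [Code α] [Code β] [Code γ] [Code δ] [Code σ]

/-- Functions computable in constant time. -/
@[fun_prop]
def Cst (f : α → β) : Prop := ∃ k, Comp f (fun _ => k)

@[fun_prop]
theorem Cst.id : Cst (fun a : α => a) := ⟨_, .of_exp (.var 0) fun _ _ h => h⟩

@[fun_prop]
theorem Cst.const (b : β) : Cst (fun _ : α => b) :=
  ⟨_, .of_exp (enc b).toExp fun _ _ _ => Dat.eval_toExp _ _⟩

@[fun_prop]
theorem Cst.comp {g : β → γ} {f : α → β} (hg : Cst g) (hf : Cst f) : Cst (fun a => g (f a)) := by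
  obtain ⟨k, h⟩ := hg
  obtain ⟨k', h'⟩ := hf
  exact ⟨_, h.comp h'⟩

@[fun_prop]
theorem Cst.prodMk {f : α → β} {g : α → γ} (hf : Cst f) (hg : Cst g) :
    Cst (fun a => (f a, g a)) := by
  obtain ⟨k, h⟩ := hf
  obtain ⟨k', h'⟩ := hg
  exact ⟨_, h.pair h'⟩

@[fun_prop]
theorem Cst.fst {f : α → β × γ} (hf : Cst f) : Cst (fun a => (f a).1) :=
  .comp (g := fun q : β × γ => q.1) ⟨_, comp_fst⟩ hf

@[fun_prop]
theorem Cst.snd {f : α → β × γ} (hf : Cst f) : Cst (fun a => (f a).2) :=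
  .comp (g := fun q : β × γ => q.2) ⟨_, comp_snd⟩ hf

@[fun_prop]
theorem Cst.cons {f : γ → α} {l : γ → List α} (hf : Cst f) (hl : Cst l) :
    Cst (fun x => f x :: l x) :=
  .comp (g := fun q : α × List α => q.1 :: q.2) ⟨_, comp_cons⟩ (hf.prodMk hl)

@[fun_prop]
theorem Cst.tail {l : γ → List α} (hl : Cst l) : Cst (fun x => (l x).tail) :=
  .comp (g := fun l : List α => l.tail) ⟨_, comp_tail⟩ hl

@[fun_prop]
theorem Cst.headD {l : γ → List α} {d : γ → α} (hl : Cst l) (hd : Cst d) :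
    Cst (fun x => (l x).headD (d x)) :=
  .comp (g := fun q : α × List α => q.2.headD q.1) ⟨_, comp_headD⟩ (hd.prodMk hl)

@[fun_prop]
theorem Cst.isEmpty {l : γ → List α} (hl : Cst l) : Cst (fun x => (l x).isEmpty) :=
  .comp (g := fun l : List α => l.isEmpty) ⟨_, comp_isEmpty⟩ hl

@[fun_prop]
theorem Cst.units {f : γ → ℕ} (hf : Cst f) : Cst (fun x => List.replicate (f x) ()) :=
  .comp (g := fun j : ℕ => List.replicate j ()) ⟨_, .of_exp (.var 0) fun s a h => by
    rw [enc_replicate_unit]; exact h⟩ hf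

/-- The function `f` is computable such that whenever `R a N E` holds, the time on input `a` is
bounded by a fixed polynomial in `N` times `E`. -/
def Within (f : α → β) (R : α → ℕ → ℕ → Prop) : Prop :=
  ∃ T c, Comp f T ∧ ∀ a N E, 1 ≤ E → R a N E → T a ≤ (N + 2) ^ c * E

theorem Within.congr {f g : α → β} {R : α → ℕ → ℕ → Prop} (h : Within f R) (e : ∀ x, f x = g x) :
    Within g R := funext e ▸ h

theorem add_pow_le (N c d : ℕ) : (N + 2 + c) ^ d + 2 ≤ (N + 2) ^ ((c + 1) * d + 2) := by
  have h1 : N + 2 + c ≤ (N + 2) ^ (c + 1) := by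
    induction c with
    | zero => simp
    | succ c ih => rw [pow_succ]; nlinarith
  have h2 := Nat.pow_le_pow_left h1 d
  rw [← pow_mul] at h2
  have h3 : 1 ≤ (N + 2) ^ ((c + 1) * d) := Nat.one_le_pow _ _ (by omega)
  have h4 : 4 ≤ (N + 2) ^ 2 := by nlinarith
  rw [pow_add]
  nlinarith

theorem Within.mono {f : α → β} {R R' : α → ℕ → ℕ → Prop} (c d : ℕ) (h : Within f R)
    (hR : ∀ a N E, 1 ≤ E → R' a N E → R a ((N + 2 + c) ^ d) E) : Within f R' := by
  obtain ⟨T, k, h1, h2⟩ := h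
  refine ⟨T, ((c + 1) * d + 2) * k, h1, fun a N E hE h => (h2 a _ E hE (hR a N E hE h)).trans ?_⟩
  refine Nat.mul_le_mul_right _ ?_
  rw [pow_mul]
  exact Nat.pow_le_pow_left (add_pow_le _ _ _) _

theorem Within.weaken {f : α → β} {R R' : α → ℕ → ℕ → Prop} (h : Within f R)
    (hR : ∀ a N E, 1 ≤ E → R' a N E → R a N E) : Within f R' := by
  obtain ⟨T, k, h1, h2⟩ := h
  exact ⟨T, k, h1, fun a N E hE h => h2 a _ E hE (hR a N E hE h)⟩

theorem const_le_pow {N E : ℕ} (k : ℕ) (hE : 1 ≤ E) : k ≤ (N + 2) ^ k * E :=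
  (Nat.lt_two_pow_self (n := k)).le.trans ((Nat.pow_le_pow_left (by omega) _).trans
    (Nat.le_mul_of_pos_right _ hE))

theorem add_le_pow {N E a b c d : ℕ} (ha : a ≤ (N + 2) ^ c * E) (hb : b ≤ (N + 2) ^ d * E) :
    a + b ≤ (N + 2) ^ (c + d + 1) * E := by
  have h1 : (N + 2) ^ c ≤ (N + 2) ^ (c + d) := Nat.pow_le_pow_right (by omega) (by omega)
  have h2 : (N + 2) ^ d ≤ (N + 2) ^ (c + d) := Nat.pow_le_pow_right (by omega) (by omega)
  calc a + b ≤ (N + 2) ^ (c + d) * E + (N + 2) ^ (c + d) * E :=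
        add_le_add (ha.trans (Nat.mul_le_mul_right _ h1)) (hb.trans (Nat.mul_le_mul_right _ h2))
    _ = (N + 2) ^ (c + d) * 2 * E := by ring
    _ ≤ (N + 2) ^ (c + d + 1) * E := by rw [pow_succ]; gcongr; omega

theorem Cst.within {f : α → β} (h : Cst f) : Within f (fun _ _ _ => True) := by
  obtain ⟨k, h⟩ := h
  exact ⟨_, k, h, fun a N E hE _ => const_le_pow k hE⟩

theorem Poly.within {f : α → β} (h : Poly f) : Within f (fun a N _ => sz a ≤ N) := by
  obtain ⟨⟨T, h1, c, h2⟩, -⟩ := h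
  refine ⟨T, c, h1, fun a N E hE h => (h2 a).trans ?_⟩
  exact (Nat.pow_le_pow_left (by omega) c).trans (Nat.le_mul_of_pos_right _ hE)

theorem Within.comp {g : β → γ} {f : α → β} {R : β → ℕ → ℕ → Prop} {S : α → ℕ → ℕ → Prop}
    (hg : Within g R) (hf : Within f S) :
    Within (fun a => g (f a)) (fun a N E => S a N E ∧ R (f a) N E) := by
  obtain ⟨T, c, h1, h2⟩ := hg
  obtain ⟨T', c', h1', h2'⟩ := hf
  exact ⟨_, _, h1.comp h1', fun a N E hE h => add_le_pow (h2' a N E hE h.1) (h2 _ N E hE h.2)⟩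

theorem Within.comp_cst {g : β → γ} {f : α → β} {R : β → ℕ → ℕ → Prop}
    (hg : Within g R) (hf : Cst f) : Within (fun a => g (f a)) (fun a N E => R (f a) N E) :=
  (hg.comp hf.within).weaken fun _ _ _ _ h => ⟨trivial, h⟩

theorem Within.pair {f : α → β} {g : α → γ} {R S : α → ℕ → ℕ → Prop}
    (hf : Within f R) (hg : Within g S) :
    Within (fun a => (f a, g a)) (fun a N E => R a N E ∧ S a N E) := by
  obtain ⟨T, c, h1, h2⟩ := hf
  obtain ⟨T', c', h1', h2'⟩ := hg
  exact ⟨_, _, h1.pair h1', fun a N E hE h =>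
    add_le_pow (add_le_pow (h2 a N E hE h.1) (h2' _ N E hE h.2)) (const_le_pow 10 hE)⟩

theorem Within.cond {c : α → Bool} {f g : α → β} {P R S : α → ℕ → ℕ → Prop}
    (hc : Within c P) (hf : Within f R) (hg : Within g S) :
    Within (fun a => bif c a then f a else g a)
      (fun a N E => P a N E ∧ (c a = true → R a N E) ∧ (c a = false → S a N E)) := by
  obtain ⟨T, k, h1, h2⟩ := hf
  obtain ⟨T', k', h1', h2'⟩ := hg
  obtain ⟨T'', k'', h1'', h2''⟩ := hc
  refine ⟨_, _, h1''.cond h1 h1', fun a N E hE h =>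
    add_le_pow (add_le_pow (d := k + k') (h2'' a N E hE h.1) ?_) (const_le_pow 10 hE)⟩
  cases hca : c a
  · exact (h2' a N E hE (h.2.2 hca)).trans (Nat.mul_le_mul_right _
      (Nat.pow_le_pow_right (by omega) (by omega)))
  · exact (h2 a N E hE (h.2.1 hca)).trans (Nat.mul_le_mul_right _
      (Nat.pow_le_pow_right (by omega) (by omega)))

theorem Within.foldl {step : γ × σ × α → σ} {S : γ × σ × α → ℕ → ℕ → Prop} (h : Within step S) :
    Within (fun q : γ × σ × List α => q.2.2.foldl (fun s a => step (q.1, s, a)) q.2.1)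
      (fun q N E => ∃ (I : List α → σ → Prop) (K F : ℕ), 1 ≤ F ∧ K * F ≤ E ∧
        q.2.2.length ≤ N * K ∧ I q.2.2 q.2.1 ∧
        ∀ a l s, I (a :: l) s → I l (step (q.1, s, a)) ∧ S (q.1, s, a) N F) := by
  obtain ⟨T, c, h1, h2⟩ := h
  refine ⟨_, (c + 5 + 1) + 30 + 1, h1.foldl, ?_⟩
  rintro ⟨x, s, l⟩ N E hE ⟨I, K, F, hF, hKF, hl, h0, hI⟩
  refine (foldCost_le step T x ((N + 2) ^ c * F) I l s h0 fun a l s h =>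
    ⟨(hI a l s h).1, h2 _ _ _ hF (hI a l s h).2⟩).trans ?_
  refine add_le_pow (c := c + 5 + 1) (d := 30) ?_ (const_le_pow 30 hE)
  have h3 : (N + 2) ^ c * F + 30 ≤ (N + 2) ^ (c + 5) * F := by
    have h4 : 1 ≤ (N + 2) ^ c * F := Nat.mul_pos (Nat.pow_pos (by omega)) hF
    have h5 : 2 ^ 5 ≤ (N + 2) ^ 5 := Nat.pow_le_pow_left (by omega) 5
    calc (N + 2) ^ c * F + 30 ≤ (N + 2) ^ c * F * 2 ^ 5 := by omega
      _ ≤ (N + 2) ^ c * F * (N + 2) ^ 5 := by gcongr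
      _ = _ := by ring
  calc l.length * ((N + 2) ^ c * F + 30) ≤ (N * K) * ((N + 2) ^ (c + 5) * F) := by
        gcongr
    _ = N * (N + 2) ^ (c + 5) * (K * F) := by ring
    _ ≤ (N + 2) * (N + 2) ^ (c + 5) * E := by gcongr; omega
    _ = (N + 2) ^ (c + 5 + 1) * E := by ring

end

end WhileLang

/-! ### The running times of the parts of the algorithm -/

namespace WhileLang

open Code

/-- A table of at most `E` lists of size at most `N`. -/
def TabBd (T : Table) (N E : ℕ) : Prop := T.length ≤ E ∧ ∀ f ∈ T, sz f ≤ N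

theorem TabBd.mono {T : Table} {N E N' E' : ℕ} (h : TabBd T N E) (hN : N ≤ N') (hE : E ≤ E') :
    TabBd T N' E' :=
  ⟨h.1.trans hE, fun f hf => (h.2 f hf).trans hN⟩

theorem linear_le (N : ℕ) {k : ℕ} (hk : k ≤ 18) : k * N + k ≤ (N + 2 + 7) ^ 2 := by
  nlinarith

theorem within_prepend : Within (fun q : List ℕ × Table × List ℕ =>
    q.2.2.foldl (fun out c => (c :: q.1) :: out) q.2.1) (fun q N _ => q.2.2.length ≤ N) := by
  have h : Cst (fun q : List ℕ × Table × ℕ => (q.2.2 :: q.1) :: q.2.1) := by fun_prop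
  refine h.within.foldl.weaken fun q N E hE h => ⟨fun _ _ => True, 1, 1, le_rfl, by simpa, by simpa,
    trivial, fun _ _ _ _ => ⟨trivial, trivial⟩⟩

theorem within_words : Within (fun q : ℕ × ℕ => words q.1 q.2)
    (fun q N E => q.1 ≤ N ∧ q.2 ≤ N ∧ ∃ b, 1 ≤ b ∧ q.1 ≤ b ∧ b ^ q.2 ≤ E) := by
  have h1 : Within (fun q : ℕ × Table × List ℕ =>
      (List.range q.1).foldl (fun out c => (c :: q.2.2) :: out) q.2.1) (fun q N _ => q.1 ≤ N) := by
    have hr : Poly (fun j : ℕ => List.range j) := by fun_prop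
    have := within_prepend.comp (Within.pair
      (f := fun q : ℕ × Table × List ℕ => q.2.2) (Cst.within (by fun_prop)) (Within.pair
      (f := fun q : ℕ × Table × List ℕ => q.2.1) (Cst.within (by fun_prop))
        (hr.within.comp_cst (f := fun q : ℕ × Table × List ℕ => q.1) (by fun_prop))))
    refine this.mono 7 2 fun q N E hE h => ?_
    have := linear_le N (k := 2) (by omega)
    simp only [List.length_range, sz_nat, true_and]
    omega
  have h2 : Within (fun q : ℕ × Table × Unit => q.2.1.foldl (fun out f =>
      (List.range q.1).foldl (fun out c => (c :: f) :: out) out) [])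
      (fun q N E => q.1 ≤ N ∧ q.2.1.length ≤ E) := by
    have := h1.foldl.comp_cst (f := fun q : ℕ × Table × Unit => (q.1, [], q.2.1)) (by fun_prop)
    refine this.mono 0 1 fun q N E hE h => ⟨fun _ _ => True, E, 1, le_rfl, by simp, ?_, trivial,
      fun _ _ _ _ => ⟨trivial, ?_⟩⟩
    · have h' := h.2
      dsimp only
      nlinarith
    · have h' := h.1
      simp only [Nat.add_zero, pow_one]
      omega
  have := h2.foldl.comp_cst (f := fun q : ℕ × ℕ => (q.1, [[]], List.replicate q.2 ())) (by fun_prop)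
  refine this.weaken fun q N E hE ⟨hq, hj, b, hb, hqb, hbE⟩ =>
    ⟨fun l s => ∃ i, i + l.length = q.2 ∧ s = words q.1 i, 1, E, hE, by simp, by simpa,
      ⟨0, by simp, rfl⟩, ?_⟩
  rintro a l s ⟨i, hi, rfl⟩
  refine ⟨⟨i + 1, by simp at hi; omega, ?_⟩, hq, ?_⟩
  · rw [words, words, List.replicate_succ', List.foldl_append]
    rfl
  · dsimp only
    rw [length_words]
    refine (Nat.pow_le_pow_left hqb i).trans ((Nat.pow_le_pow_right hb ?_).trans hbE)
    simp at hi; omega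

theorem within_coverStep : Within (fun q : ℕ × Table × (ℕ × ℕ) => coverStep q.1 q.2.1 q.2.2)
    (fun q N E => sz q.1 ≤ N ∧ sz q.2.2 ≤ N ∧ TabBd q.2.1 N E) := by
  have p1 : Poly (fun q : (ℕ × ℕ × ℕ) × List ℕ => q.2.contains q.1.2.1 || q.2.contains q.1.2.2) := by
    fun_prop
  have p2 : Poly (fun q : (ℕ × ℕ × ℕ) × List ℕ => Nat.ble q.1.1 q.2.length) := by
    fun_prop
  have h1 : Within (fun q : (ℕ × ℕ × ℕ) × Table × List ℕ =>
      bif q.2.2.contains q.1.2.1 || q.2.2.contains q.1.2.2 then q.2.2 :: q.2.1 else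
        bif Nat.ble q.1.1 q.2.2.length then q.2.1 else
          (q.1.2.1 :: q.2.2) :: (q.1.2.2 :: q.2.2) :: q.2.1)
      (fun q N _ => sz (q.1, q.2.2) ≤ N) :=
    ((p1.within.comp_cst (f := fun q : (ℕ × ℕ × ℕ) × Table × List ℕ => (q.1, q.2.2))
      (by fun_prop)).cond (Cst.within (by fun_prop))
      ((p2.within.comp_cst (f := fun q : (ℕ × ℕ × ℕ) × Table × List ℕ => (q.1, q.2.2))
      (by fun_prop)).cond (Cst.within (by fun_prop)) (Cst.within (by fun_prop)))).weaken
        fun q N E hE h => ⟨h, fun _ => trivial, fun _ => ⟨h, fun _ => trivial, fun _ => trivial⟩⟩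
  have := h1.foldl.comp_cst (f := fun q : ℕ × Table × (ℕ × ℕ) => ((q.1, q.2.2), [], q.2.1))
    (by fun_prop)
  refine this.mono 7 2 fun q N E hE ⟨hκ, huv, hL, hC⟩ =>
    ⟨fun l _ => ∀ C ∈ l, sz C ≤ N, E, 1, le_rfl, by simp, ?_, hC, ?_⟩
  · have := linear_le N (k := 1) (by omega)
    dsimp only
    nlinarith
  · intro C l s h
    refine ⟨fun D hD => h D (List.mem_cons_of_mem _ hD), ?_⟩
    have := linear_le N (k := 3) (by omega)
    have := h C (by simp)
    rw [sz_pair, sz_pair]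
    dsimp only
    omega

/-- The weight of a list of partial covers decreases in the search for covers. -/
theorem weight_coverStep (κ : ℕ) (L : Table) (uv : ℕ × ℕ) :
    ((coverStep κ L uv).map fun C => 2 ^ (κ - C.length)).sum ≤
      (L.map fun C => 2 ^ (κ - C.length)).sum := by
  rw [coverStep_eq, ← List.sum_reverse (L.map _), ← List.map_reverse]
  induction L.reverse with
  | nil => simp
  | cons C l ih =>
    rw [List.flatMap_cons, List.map_append, List.sum_append, List.map_cons, List.sum_cons]
    refine add_le_add ?_ ih
    cases (C.contains uv.1 || C.contains uv.2)
    · cases h : Nat.ble κ C.length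
      · have h' : ¬ κ ≤ C.length := by rw [← Nat.ble_eq, h]; simp
        obtain ⟨j, hj⟩ : ∃ j, κ - C.length = j + 1 := ⟨κ - C.length - 1, by omega⟩
        have hj' : κ - (C.length + 1) = j := by omega
        simp [hj, hj', pow_succ]; omega
      · simp
    · simp

theorem length_covers_le (κ : ℕ) (E : List (ℕ × ℕ)) : (covers κ E).length ≤ 2 ^ κ := by
  have h : ((covers κ E).map fun C => 2 ^ (κ - C.length)).sum ≤ 2 ^ κ := by
    induction E using List.reverseRecOn with
    | nil => simp [covers]
    | append_singleton E e ih =>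
      rw [covers_append]
      exact (weight_coverStep _ _ _).trans ih
  refine le_trans ?_ h
  have := List.card_nsmul_le_sum ((covers κ E).map fun C => 2 ^ (κ - C.length)) 1 (by
    intro x hx
    obtain ⟨C, -, rfl⟩ := List.mem_map.1 hx
    exact Nat.one_le_two_pow)
  simpa using this

theorem tabBd_covers (κ : ℕ) (E : List (ℕ × ℕ)) :
    TabBd (covers κ E) (κ * (sz E + 1) + 1) (2 ^ κ) := by
  refine ⟨length_covers_le κ E, fun C hC => ?_⟩
  obtain ⟨-, h2, -, h4⟩ := covers_spec hC
  refine (sz_le_of_forall (B := sz E) fun v hv => ?_).trans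
    (Nat.add_le_add_right (Nat.mul_le_mul_right _ h2) 1)
  obtain ⟨e, he, h⟩ := h4 v hv
  have := sz_le_of_mem he
  obtain ⟨a, b⟩ := e
  rw [sz_pair] at this
  rcases h with rfl | rfl <;> omega

theorem within_covers : Within (fun q : ℕ × List (ℕ × ℕ) => covers q.1 q.2)
    (fun q N E => sz q ≤ N ∧ 2 ^ q.1 ≤ E) := by
  have := within_coverStep.foldl.comp_cst (f := fun q : ℕ × List (ℕ × ℕ) => (q.1, [[]], q.2))
    (by fun_prop)
  refine this.mono 7 2 fun ⟨κ, Es⟩ N E hE ⟨hN, hE'⟩ =>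
    ⟨fun l s => ∃ pre, pre ++ l = Es ∧ s = covers κ pre, 1, E, hE, by simp, ?_,
      ⟨[], by simp, rfl⟩, ?_⟩
  · have := linear_le N (k := 1) (by omega)
    have := length_lt_sz Es
    rw [sz_pair] at hN
    dsimp only
    omega
  · rintro e l s ⟨pre, rfl, rfl⟩
    rw [sz_pair] at hN
    have h1 := sz_append pre (e :: l)
    rw [sz_cons] at h1
    have h2 := linear_le N (k := 1) (by omega)
    have h3 := sz_nat κ
    have h4 := sz_pos l
    have h5 := sz_pos pre
    refine ⟨⟨pre ++ [e], by simp, (covers_append _ _ _).symm⟩, ?_, ?_, ?_⟩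
    · dsimp only; omega
    · dsimp only; omega
    · refine (tabBd_covers κ pre).mono ?_ hE'
      have : κ * (sz pre + 1) ≤ N * (N + 1) := Nat.mul_le_mul (by omega) (by omega)
      nlinarith

theorem within_best : Within (fun q : List ℕ × Table => best q.1 q.2)
    (fun q N E => sz q.1 ≤ N ∧ TabBd q.2 N E) := by
  have h1 : Poly (fun q : List ℕ × List ℕ × List ℕ => bif prefers q.1 q.2.2 q.2.1 then q.2.2 else
    q.2.1) := by fun_prop
  have := h1.within.foldl.comp_cst (f := fun q : List ℕ × Table => (q.1, q.2.headD [], q.2))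
    (by fun_prop)
  refine this.mono 7 2 fun ⟨A, L⟩ N E hE ⟨hN, hL, hC⟩ =>
    ⟨fun l s => sz s ≤ N + 1 ∧ ∀ C ∈ l, sz C ≤ N, E, 1, le_rfl, by simp, ?_, ⟨?_, hC⟩, ?_⟩
  · have := linear_le N (k := 1) (by omega)
    dsimp only at *
    nlinarith
  · cases L with
    | nil => simp
    | cons C L => exact (hC C (by simp)).trans (Nat.le_succ _)
  · rintro C l s ⟨hs, h⟩
    have h2 := h C (by simp)
    refine ⟨⟨?_, fun D hD => h D (List.mem_cons_of_mem _ hD)⟩, ?_⟩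
    · dsimp only
      cases prefers A C s <;> simp <;> omega
    · have := linear_le N (k := 3) (by omega)
      dsimp only at *
      rw [sz_pair, sz_pair]
      omega

theorem within_cutInfo : Within (fun q : Mat × ℕ × List ℕ => cutInfo q.1 q.2.1 q.2.2)
    (fun q N E => sz q ≤ N ∧ 2 ^ q.2.1 ≤ E) := by
  have p1 : Poly (fun q : Mat × ℕ × List ℕ => cutEdges q.1 q.2.2) := by fun_prop
  have p2 : Poly (fun q : Mat × ℕ × List ℕ => isJoin q.1 q.2.2) := by fun_prop
  have p3 : Poly (fun q : Mat × ℕ × List ℕ => (([], bdry q.1 q.2.2, true) :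
    List ℕ × List ℕ × Bool)) := by fun_prop
  have h1 : Within (fun q : Mat × ℕ × List ℕ => covers q.2.1 (cutEdges q.1 q.2.2))
      (fun q N E => sz q ≤ N ∧ 2 ^ q.2.1 ≤ E) := by
    obtain ⟨c, hc⟩ := p1.2
    have := within_covers.comp ((Cst.within (f := fun q : Mat × ℕ × List ℕ => q.2.1)
      (by fun_prop)).pair p1.within)
    refine this.mono 0 (c + 1) fun ⟨g, κ, A⟩ N E hE ⟨hN, hE'⟩ => ?_
    have h1 := hc (g, κ, A)
    have h2 : N ≤ (N + 2) ^ (c + 1) := (by omega : N ≤ N + 2).trans (Nat.le_self_pow (by omega) _)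
    have h3 : (sz (g, κ, A) + 2) ^ c ≤ (N + 2) ^ c := Nat.pow_le_pow_left (by omega) c
    have h4 : N + 1 ≤ (N + 2) ^ c * (N + 1) := Nat.le_mul_of_pos_left _ (Nat.pow_pos (by omega))
    have h5 : (N + 2) ^ (c + 1) = (N + 2) ^ c * (N + 1) + (N + 2) ^ c := by ring
    refine ⟨⟨trivial, hN.trans h2⟩, ?_, hE'⟩
    have h6 : sz κ ≤ N := by
      rw [sz_pair, sz_pair] at hN
      omega
    rw [sz_pair]
    dsimp only [Nat.add_zero] at h1 ⊢
    omega
  have h2 : Within (fun q : Mat × ℕ × List ℕ => best q.2.2 (covers q.2.1 (cutEdges q.1 q.2.2)))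
      (fun q N E => sz q ≤ N ∧ 2 ^ q.2.1 ≤ E) := by
    obtain ⟨c, hc⟩ := p1.2
    have := within_best.comp ((Cst.within (f := fun q : Mat × ℕ × List ℕ => q.2.2)
      (by fun_prop)).pair h1)
    refine this.mono 0 (c + 2) fun ⟨g, κ, A⟩ N E hE ⟨hN, hE'⟩ => ?_
    have h2 : N ≤ (N + 2) ^ (c + 2) := (by omega : N ≤ N + 2).trans (Nat.le_self_pow (by omega) _)
    rw [sz_pair, sz_pair] at hN
    refine ⟨⟨trivial, ?_, hE'⟩, ?_, (tabBd_covers _ _).mono ?_ hE'⟩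
    · rw [sz_pair, sz_pair]; exact hN.trans h2
    · dsimp only [Nat.add_zero]; omega
    · have h1 := hc (g, κ, A)
      have h3 : (sz (g, κ, A) + 2) ^ c ≤ (N + 2) ^ c :=
        Nat.pow_le_pow_left (by rw [sz_pair, sz_pair]; omega) c
      have h4 := sz_nat κ
      have h5 : 1 ≤ (N + 2) ^ c := Nat.one_le_pow _ _ (by omega)
      dsimp only at h1 ⊢
      have h6 := h1.trans h3
      calc κ * (sz (cutEdges g A) + 1) + 1 ≤ N * ((N + 2) ^ c + 1) + 1 := by
            gcongr
            omega
        _ ≤ (N + 2) ^ c * (N + 2) ^ 2 := by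
            nlinarith [Nat.mul_le_mul_left N h5, Nat.zero_le ((N + 2) ^ c * N ^ 2)]
        _ = _ := by ring
  have h3 := ((Cst.within (f := fun l : Table => l.isEmpty) (by fun_prop)).comp h1).cond
    (p2.within.cond p3.within (Cst.within (f := fun _ => ([], [], false)) (by fun_prop)))
    (h2.pair (Cst.within (f := fun _ => (([], true) : List ℕ × Bool)) (by fun_prop)))
  exact h3.weaken fun q N E hE h => ⟨⟨h, trivial⟩, fun _ => ⟨h.1, fun _ => h.1, fun _ => trivial⟩,
    fun _ => ⟨h, trivial⟩⟩

theorem within_inTable : Within (fun q : (Env × List ℕ × List ℕ) × Table =>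
    q.1.1.inTable q.1.2.1 q.1.2.2 q.2) (fun q N E => sz q.1 ≤ N ∧ TabBd q.2 N E) := by
  have h1 : Poly (fun q : (Env × List ℕ × List ℕ) × Bool × List ℕ =>
    q.2.1 || q.1.2.2.map (q.1.1.look q.1.2.1) == q.2.2) := by fun_prop
  have := h1.within.foldl.comp_cst (f := fun q : (Env × List ℕ × List ℕ) × Table =>
    (q.1, false, q.2)) (by fun_prop)
  refine this.mono 7 2 fun q N E hE ⟨hN, hL, hC⟩ =>
    ⟨fun l _ => ∀ C ∈ l, sz C ≤ N, E, 1, le_rfl, by simp, ?_, hC, ?_⟩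
  · have := linear_le N (k := 1) (by omega)
    dsimp only at *
    nlinarith
  · rintro C l s h
    have h2 := h C (by simp)
    refine ⟨fun D hD => h D (List.mem_cons_of_mem _ hD), ?_⟩
    have := linear_le N (k := 5) (by omega)
    have := sz_bool_le s
    change sz q.1 + (sz s + sz C + 1) + 1 ≤ _
    dsimp only at *
    omega

/-- The environment and the two tables of the children. -/
abbrev Ctx : Type := Env × Table × Table

/-- The environment is of size at most `N`, the tables are bounded by `N` and `E`. -/
def CtxBd (e : Ctx) (N E : ℕ) : Prop := sz e.1 ≤ N ∧ TabBd e.2.1 N E ∧ TabBd e.2.2 N E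

theorem CtxBd.mono {e : Ctx} {N N' E : ℕ} (h : CtxBd e N E) (hN : N ≤ N') : CtxBd e N' E :=
  ⟨h.1.trans hN, h.2.1.mono hN le_rfl, h.2.2.mono hN le_rfl⟩

theorem within_feas : Within (fun q : Ctx × List ℕ => q.1.1.feas q.1.2.1 q.1.2.2 q.2)
    (fun q N E => CtxBd q.1 N E ∧ sz q.2 ≤ N) := by
  have p1 : Poly (fun q : Env × List ℕ => q.1.consistent q.2) := by fun_prop
  have h1 := p1.within.comp_cst (f := fun q : Ctx × List ℕ => (q.1.1, q.2)) (by fun_prop)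
  have h2 := within_inTable.comp_cst (f := fun q : Ctx × List ℕ =>
    ((q.1.1, q.2, q.1.1.2.2.2.1.2.1), q.1.2.1)) (by fun_prop)
  have h3 := within_inTable.comp_cst (f := fun q : Ctx × List ℕ =>
    ((q.1.1, q.2, q.1.1.2.2.2.2.1.2.1), q.1.2.2)) (by fun_prop)
  have := h1.cond (h2.cond h3 (Cst.const false).within) (Cst.const false).within
  refine this.mono 7 2 fun ⟨⟨e, TL, TR⟩, f⟩ N E hE ⟨⟨he, hL, hR⟩, hf⟩ => ?_
  have h4 := linear_le N (k := 3) (by omega)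
  obtain ⟨e1, e2, e3, ⟨l1, l2, l3, l4⟩, ⟨r1, r2, r3, r4⟩, x⟩ := e
  simp only [sz_pair] at he hf ⊢
  exact ⟨by omega, fun _ => ⟨⟨by omega, hL.mono (by omega) le_rfl⟩,
    fun _ => ⟨by omega, hR.mono (by omega) le_rfl⟩, fun _ => trivial⟩, fun _ => trivial⟩

theorem within_nodeTable : Within (fun q : Ctx × Table × Table =>
    nodeTable q.1.1 q.1.2.1 q.1.2.2 q.2.1 q.2.2)
    (fun q N E => ∃ a b c, 1 ≤ c ∧ a * b * c ≤ E ∧ CtxBd q.1 N c ∧ TabBd q.2.1 N a ∧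
      1 ≤ b ∧ TabBd q.2.2 N b) := by
  have p1 : Poly (fun q : List ℕ × List ℕ => q.1 ++ q.2) := by fun_prop
  have h1 : Within (fun q : (Ctx × List ℕ) × Bool × List ℕ =>
      q.2.1 || q.1.1.1.feas q.1.1.2.1 q.1.1.2.2 (q.1.2 ++ q.2.2))
      (fun q N E => CtxBd q.1.1 N E ∧ sz q.1.2 ≤ N ∧ sz q.2.2 ≤ N) := by
    have h2 := within_feas.comp ((Cst.within (f := fun q : (Ctx × List ℕ) × Bool × List ℕ => q.1.1)
      (by fun_prop)).pair (p1.within.comp_cst (f := fun q : (Ctx × List ℕ) × Bool × List ℕ =>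
        (q.1.2, q.2.2)) (by fun_prop)))
    have h3 := (Cst.within (f := fun q : (Ctx × List ℕ) × Bool × List ℕ => q.2.1)
      (by fun_prop)).cond (Cst.const true).within h2
    refine (h3.mono 7 2 fun ⟨⟨e, f⟩, s, f'⟩ N E hE ⟨he, hf, hf'⟩ => ?_).congr
      fun q => by cases q.2.1 <;> rfl
    have h4 := linear_le N (k := 3) (by omega)
    have h5 := sz_append f f'
    simp only [sz_pair] at hf hf' ⊢
    exact ⟨trivial, fun _ => trivial, fun _ => ⟨⟨trivial, by omega⟩, he.mono (by omega), by omega⟩⟩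
  have h2 : Within (fun q : (Ctx × Table) × Table × List ℕ =>
      bif q.1.2.foldl (fun b f' => b || q.1.1.1.feas q.1.1.2.1 q.1.1.2.2 (q.2.2 ++ f')) false then
        q.2.2 :: q.2.1 else q.2.1)
      (fun q N E => ∃ b c, 1 ≤ c ∧ b * c ≤ E ∧ CtxBd q.1.1 N c ∧ TabBd q.1.2 N b ∧ sz q.2.2 ≤ N) := by
    have h3 := (h1.foldl.comp_cst (f := fun q : (Ctx × Table) × Table × List ℕ =>
      ((q.1.1, q.2.2), false, q.1.2)) (by fun_prop)).cond
        (Cst.within (f := fun q => q.2.2 :: q.2.1) (by fun_prop))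
        (Cst.within (f := fun q => q.2.1) (by fun_prop))
    refine h3.mono 7 2 fun ⟨⟨e, W'⟩, s, f⟩ N E hE ⟨b, c, hc, hE', he, hW, hf⟩ =>
      ⟨⟨fun l _ => ∀ C ∈ l, sz C ≤ N, b, c, hc, hE', ?_, hW.2, ?_⟩, fun _ => trivial,
        fun _ => trivial⟩
    · have := linear_le N (k := 1) (by omega)
      have := hW.1
      dsimp only at *
      nlinarith
    · rintro C l s h
      have h2 := h C (by simp)
      have := linear_le N (k := 1) (by omega)
      exact ⟨fun D hD => h D (List.mem_cons_of_mem _ hD), he.mono (by omega), hf.trans (by omega),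
        h2.trans (by omega)⟩
  have := h2.foldl.comp_cst (f := fun q : Ctx × Table × Table => ((q.1, q.2.2), [], q.2.1))
    (by fun_prop)
  refine this.mono 7 2 fun ⟨e, W, W'⟩ N E hE ⟨a, b, c, hc, hE', he, hW, hb, hW'⟩ =>
    ⟨fun l _ => ∀ C ∈ l, sz C ≤ N, a, b * c, Nat.mul_pos hb hc, by rwa [← mul_assoc], ?_, hW.2, ?_⟩
  · have := linear_le N (k := 1) (by omega)
    have := hW.1
    dsimp only at *
    nlinarith
  · rintro C l s h
    have h2 := h C (by simp)
    have := linear_le N (k := 1) (by omega)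
    exact ⟨fun D hD => h D (List.mem_cons_of_mem _ hD), b, c, hc, le_rfl, he.mono (by omega),
      hW'.mono (by omega) le_rfl, h2.trans (by omega)⟩

theorem within_nodeNum : Within (fun q : Ctx × Table => nodeNum q.1.1 q.1.2.1 q.1.2.2 q.2)
    (fun q N E => ∃ b c, 1 ≤ c ∧ b * c ≤ E ∧ CtxBd q.1 N c ∧ TabBd q.2 N b) := by
  have p1 : Poly (fun q : (Env × List ℕ) × ℕ => min q.2 (q.1.1.val q.1.2)) := by fun_prop
  have h1 : Within (fun q : Ctx × ℕ × List ℕ => bif q.1.1.feas q.1.2.1 q.1.2.2 q.2.2 then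
      min q.2.1 (q.1.1.val q.2.2) else q.2.1)
      (fun q N E => CtxBd q.1 N E ∧ sz q.2.1 ≤ N ∧ sz q.2.2 ≤ N) := by
    have h2 := (within_feas.comp_cst (f := fun q : Ctx × ℕ × List ℕ => (q.1, q.2.2))
      (by fun_prop)).cond (p1.within.comp_cst (f := fun q : Ctx × ℕ × List ℕ =>
        ((q.1.1, q.2.2), q.2.1)) (by fun_prop)) (Cst.within (f := fun q => q.2.1) (by fun_prop))
    refine h2.mono 7 2 fun ⟨e, j, f⟩ N E hE ⟨he, hj, hf⟩ => ?_
    have h4 := linear_le N (k := 3) (by omega)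
    have h5 := he.1
    simp only [sz_pair] at hf hj h5 ⊢
    exact ⟨⟨he.mono (by omega), by omega⟩, fun _ => by omega, fun _ => trivial⟩
  have h2 := (Cst.within (f := fun q : Ctx × Table => q.1.1.2.2.2.2.2.2.2.1.isEmpty)
    (by fun_prop)).cond (Cst.const 0).within (h1.foldl.comp_cst (f := fun q : Ctx × Table =>
      (q.1, q.1.1.2.1, q.2)) (by fun_prop))
  refine h2.mono 7 2 fun ⟨e, W'⟩ N E hE ⟨b, c, hc, hE', he, hW⟩ => ⟨trivial, fun _ => trivial, fun _ =>
    ⟨fun l j => sz j ≤ N ∧ ∀ C ∈ l, sz C ≤ N, b, c, hc, hE', ?_, ⟨?_, hW.2⟩, ?_⟩⟩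
  · have := linear_le N (k := 1) (by omega)
    have := hW.1
    dsimp only at *
    nlinarith
  · obtain ⟨⟨e1, e2, e3⟩, TL⟩ := e
    have h4 := he.1
    simp only [sz_pair] at h4 ⊢
    omega
  · rintro C l s ⟨hs, h⟩
    have h2 := h C (by simp)
    have := linear_le N (k := 1) (by omega)
    refine ⟨⟨?_, fun D hD => h D (List.mem_cons_of_mem _ hD)⟩, he.mono (by omega), hs.trans (by omega),
      h2.trans (by omega)⟩
    dsimp only
    cases e.1.feas e.2.1 e.2.2 C
    · exact hs
    · rw [sz_nat] at hs ⊢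
      simp only [cond_true]
      omega

theorem sz_word_le {f : List ℕ} {b : ℕ} (h : ∀ x ∈ f, x ≤ b) : sz f ≤ f.length * (2 * b + 2) + 1 :=
  sz_le_of_forall fun x hx => by rw [sz_nat]; have := h x hx; omega

theorem tabBd_words {q j : ℕ} : TabBd (words q j) (j * (2 * q + 2) + 1) (q ^ j) := by
  refine ⟨(length_words q j).le, fun f hf => ?_⟩
  obtain ⟨rfl, h⟩ := mem_words.1 hf
  exact sz_word_le fun x hx => (h x hx).le

/-- The bounds under which the running time at a node is estimated. -/
def EnvBd (e : Ctx) (κ b N E : ℕ) : Prop :=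
  1 ≤ b ∧ e.1.q ≤ b ∧ e.1.x.cov.length ≤ κ ∧ e.1.l.cov.length ≤ κ ∧ e.1.r.cov.length ≤ κ ∧
    CtxBd e N (b ^ κ) ∧ b ^ (4 * κ) ≤ E

theorem le_cube (N : ℕ) : N ≤ (N + 2 + 7) ^ 3 :=
  (by omega : N ≤ N + 2 + 7).trans (Nat.le_self_pow (by omega) _)

theorem word_le_cube {q j N : ℕ} (hq : q ≤ 2 * N) (hj : j ≤ N) :
    j * (2 * q + 2) + 1 ≤ (N + 2 + 7) ^ 3 := by
  have : j * (2 * q + 2) ≤ N * (4 * N + 2) := Nat.mul_le_mul hj (by omega)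
  nlinarith [Nat.zero_le (N ^ 3)]

theorem EnvBd.mono {e : Ctx} {κ b N N' E : ℕ} (h : EnvBd e κ b N E) (hN : N ≤ N') :
    EnvBd e κ b N' E :=
  ⟨h.1, h.2.1, h.2.2.1, h.2.2.2.1, h.2.2.2.2.1, h.2.2.2.2.2.1.mono hN, h.2.2.2.2.2.2⟩

theorem within_finishNode : Within (fun q : Ctx × Bool => finishNode q.1.1 q.2 q.1.2.1 q.1.2.2)
    (fun q N E => ∃ κ b, EnvBd q.1 κ b N E) := by
  have hsz : ∀ e : Env, e.q ≤ sz e ∧ e.x.cov.length ≤ sz e ∧ (e.l.cov ++ e.r.cov).length ≤ sz e := by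
    rintro ⟨e1, e2, e3, ⟨l1, l2, l3⟩, ⟨r1, r2, r3⟩, ⟨x1, x2, x3⟩⟩
    have h1 := length_lt_sz l2
    have h2 := length_lt_sz r2
    have h3 := length_lt_sz x2
    have h4 := sz_nat e3
    simp only [Env.q, Env.x, Env.l, Env.r, Side.cov, sz_pair, List.length_append]
    omega
  have hpow : ∀ {b i j k : ℕ}, 1 ≤ b → i ≤ b → j ≤ k → i ^ j ≤ b ^ k :=
    fun hb hi hj => (Nat.pow_le_pow_left hi _).trans (Nat.pow_le_pow_right hb hj)
  have p1 : Poly (fun e : Env => (e.q, e.x.cov.length)) := by fun_prop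
  have p2 : Poly (fun e : Env => (e.q, (e.l.cov ++ e.r.cov).length)) := by fun_prop
  have w1 : Within (fun q : Ctx => words q.1.q q.1.x.cov.length)
      (fun q N E => ∃ κ b, EnvBd q κ b N E) := by
    refine (within_words.comp (p1.within.comp_cst (f := fun q : Ctx => q.1) (by fun_prop))).weaken
      fun q N E hE ⟨κ, b, hb, hq, hx, hl, hr, hc, hE'⟩ => ⟨hc.1, ?_⟩
    have h1 := hsz q.1
    have h2 := hc.1
    exact ⟨by dsimp only; omega, by dsimp only; omega, b, hb, hq, (hpow hb le_rfl (by omega)).trans hE'⟩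
  have w2 : Within (fun q : Ctx => words q.1.q (q.1.l.cov ++ q.1.r.cov).length)
      (fun q N E => ∃ κ b, EnvBd q κ b N E) := by
    refine (within_words.comp (p2.within.comp_cst (f := fun q : Ctx => q.1) (by fun_prop))).weaken
      fun q N E hE ⟨κ, b, hb, hq, hx, hl, hr, hc, hE'⟩ => ⟨hc.1, ?_⟩
    have h1 := hsz q.1
    have h2 := hc.1
    exact ⟨by dsimp only; omega, by dsimp only; omega, b, hb, hq,
      (hpow hb le_rfl (by rw [List.length_append]; omega)).trans hE'⟩
  have wn : Within (fun q : Ctx => nodeNum q.1 q.2.1 q.2.2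
      (words q.1.q (q.1.l.cov ++ q.1.r.cov).length)) (fun q N E => ∃ κ b, EnvBd q κ b N E) := by
    refine (within_nodeNum.comp ((Cst.within (f := fun q : Ctx => q) (by fun_prop)).pair w2)).mono 7 3
      fun q N E hE ⟨κ, b, h⟩ => ⟨⟨trivial, κ, b, h.mono (le_cube N)⟩, ?_⟩
    obtain ⟨hb, hq, hx, hl, hr, hc, hE'⟩ := h
    have h1 := hsz q.1
    have h2 := hc.1
    refine ⟨b ^ (2 * κ), b ^ κ, Nat.one_le_pow _ _ hb, ?_, hc.mono (le_cube N), tabBd_words.mono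
      (word_le_cube (by omega) (by omega)) (hpow hb hq ?_)⟩
    · rw [← pow_add]
      exact (Nat.pow_le_pow_right hb (by omega)).trans hE'
    · rw [List.length_append]; omega
  have wt : Within (fun q : Ctx => nodeTable q.1 q.2.1 q.2.2 (words q.1.q q.1.x.cov.length)
      (words q.1.q (q.1.l.cov ++ q.1.r.cov).length)) (fun q N E => ∃ κ b, EnvBd q κ b N E) := by
    refine (within_nodeTable.comp ((Cst.within (f := fun q : Ctx => q) (by fun_prop)).pair
      (w1.pair w2))).mono 7 3 fun q N E hE ⟨κ, b, h⟩ =>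
      ⟨⟨trivial, ⟨κ, b, h.mono (le_cube N)⟩, κ, b, h.mono (le_cube N)⟩, ?_⟩
    obtain ⟨hb, hq, hx, hl, hr, hc, hE'⟩ := h
    have h1 := hsz q.1
    have h2 := hc.1
    refine ⟨b ^ κ, b ^ (2 * κ), b ^ κ, Nat.one_le_pow _ _ hb, ?_, hc.mono (le_cube N), tabBd_words.mono
      (word_le_cube (by omega) (by omega)) (hpow hb hq hx), Nat.one_le_pow _ _ hb,
      tabBd_words.mono (word_le_cube (by omega) (by omega)) (hpow hb hq ?_)⟩
    · rw [← pow_add, ← pow_add]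
      exact (Nat.pow_le_pow_right hb (by omega)).trans hE'
    · rw [List.length_append]; omega
  have hset : Cst (fun q : Ctx × Bool => q.1.1.x.set) := by unfold Env.x Side.set; fun_prop
  have hcov : Cst (fun q : Ctx × Bool => q.1.1.x.cov) := by unfold Env.x Side.cov; fun_prop
  have hbd : Cst (fun q : Ctx × Bool => q.1.1.x.bd) := by unfold Env.x Side.bd; fun_prop
  have := (hset.within.pair (hcov.within.pair (hbd.within.pair
    (wn.comp_cst (f := fun q : Ctx × Bool => q.1) (by fun_prop))))).pair
    ((Cst.within (f := fun q : Ctx × Bool => q.2) (by fun_prop)).cond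
      (wt.comp_cst (f := fun q : Ctx × Bool => q.1) (by fun_prop)) (Cst.const []).within)
  exact this.weaken fun q N E hE h => ⟨⟨trivial, trivial, trivial, h⟩, trivial, fun _ => h,
    fun _ => trivial⟩

theorem sz_cutInfo (g : Mat) (κ : ℕ) (A : List ℕ) :
    sz (cutInfo g κ A).1 ≤ κ * (sz A + 2 * g.length + 2) + 1 ∧ (cutInfo g κ A).2.1.Sublist A := by
  constructor
  · obtain ⟨-, h1, h2⟩ := cutInfo_cov g κ A
    refine (sz_le_of_forall (B := sz A + 2 * g.length + 1) fun v hv => ?_).trans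
      (Nat.add_le_add_right (Nat.mul_le_mul_right _ h1) 1)
    rcases h2 v hv with h | h
    · have := sz_le_of_mem h; omega
    · rw [sz_nat]; omega
  · unfold cutInfo
    cases (covers κ (cutEdges g A)).isEmpty
    · simp
    · cases isJoin g A
      · simp
      · simp [bdry, List.filter_sublist]

/-- A node is small. -/
def NodeBd (nd : Node) (κ b N : ℕ) : Prop :=
  sz nd.1 ≤ N ∧ nd.1.cov.length ≤ κ ∧ TabBd nd.2 N (b ^ κ)

/-- The parameters are small. -/
def ParBd (p : Par) (b N E : ℕ) : Prop :=
  sz p ≤ N ∧ 2 ≤ b ∧ p.2.2.2 ≤ b ∧ b ^ (4 * p.2.1) ≤ E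

theorem ParBd.two_pow_le {p : Par} {b N E : ℕ} (h : ParBd p b N E) : 2 ^ p.2.1 ≤ E :=
  (Nat.pow_le_pow_left h.2.1 _).trans
    ((Nat.pow_le_pow_right (by have := h.2.1; omega) (by omega)).trans h.2.2.2)

theorem within_joinNode : Within (fun q : Par × Node × Node => joinNode q.1 q.2.1 q.2.2)
    (fun q N E => ∃ b, ParBd q.1 b N E ∧ NodeBd q.2.1 q.1.2.1 b N ∧ NodeBd q.2.2 q.1.2.1 b N) := by
  have p1 : Poly (fun q : Side × Side => q.1.set ++ q.2.set) := by fun_prop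
  have wA := p1.within.comp_cst (f := fun q : Par × Node × Node => (q.2.1.1, q.2.2.1)) (by fun_prop)
  have wi : Within (fun q : Par × Node × Node =>
      cutInfo q.1.1 q.1.2.1 (q.2.1.1.set ++ q.2.2.1.set))
      (fun q N E => ∃ b, ParBd q.1 b N E ∧ NodeBd q.2.1 q.1.2.1 b N ∧ NodeBd q.2.2 q.1.2.1 b N) := by
    refine (within_cutInfo.comp ((Cst.within (f := fun q : Par × Node × Node => q.1.1)
      (by fun_prop)).pair ((Cst.within (f := fun q : Par × Node × Node => q.1.2.1)
      (by fun_prop)).pair wA))).mono 7 2 fun ⟨⟨g, κ, t, j⟩, ⟨⟨a1, a2⟩, a3⟩, ⟨⟨b1, b2⟩, b3⟩⟩ N E hE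
        ⟨b, h, ha, hb⟩ => ⟨⟨trivial, trivial, ?_⟩, ?_, h.two_pow_le⟩
    · have h1 := ha.1
      have h2 := hb.1
      have := linear_le N (k := 3) (by omega)
      simp only [sz_pair] at h1 h2 ⊢
      omega
    · have h1 := ha.1
      have h2 := hb.1
      have h3 := h.1
      have h4 := sz_append a1 b1
      have := linear_le N (k := 3) (by omega)
      simp only [sz_pair, Side.set] at h1 h2 h3 ⊢
      omega
  have we : Within (fun q : Par × Node × Node =>
      mkEnv q.1 q.2.1.1 q.2.2.1 (q.2.1.1.set ++ q.2.2.1.set)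
        (cutInfo q.1.1 q.1.2.1 (q.2.1.1.set ++ q.2.2.1.set)))
      (fun q N E => ∃ b, ParBd q.1 b N E ∧ NodeBd q.2.1 q.1.2.1 b N ∧ NodeBd q.2.2 q.1.2.1 b N) := by
    have h1 : Cst (fun q : (Par × Node × Node) × List ℕ × List ℕ × List ℕ × Bool =>
      mkEnv q.1.1 q.1.2.1.1 q.1.2.2.1 q.2.1 q.2.2) := by unfold mkEnv; fun_prop
    refine (h1.within.comp ((Cst.within (f := fun q : Par × Node × Node => q) (by fun_prop)).pair
      (wA.pair wi))).mono 7 2 fun q N E hE ⟨b, h, ha, hb⟩ =>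
        ⟨⟨trivial, ?_, b, ?_, ?_⟩, trivial⟩
    · have h1 := ha.1
      have h2 := hb.1
      have := linear_le N (k := 3) (by omega)
      rw [sz_pair]
      omega
    all_goals have := linear_le N (k := 1) (by omega)
    · exact ⟨h.1.trans (by omega), h.2⟩
    · exact ⟨⟨ha.1.trans (by omega), ha.2.1, ha.2.2.mono (by omega) le_rfl⟩,
        ⟨hb.1.trans (by omega), hb.2.1, hb.2.2.mono (by omega) le_rfl⟩⟩
  have := within_finishNode.comp ((we.pair (Cst.within (f := fun q : Par × Node × Node =>
    (q.2.1.2, q.2.2.2)) (by fun_prop))).pair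
    ((Cst.within (f := fun i : List ℕ × List ℕ × Bool => i.2.2) (by fun_prop)).comp wi))
  refine this.mono 7 3 fun q N E hE ⟨b, h, ha, hb⟩ => ?_
  have hN := le_cube N
  have h' : ParBd q.1 b ((N + 2 + 7) ^ 3) E := ⟨h.1.trans hN, h.2⟩
  have ha' : NodeBd q.2.1 q.1.2.1 b ((N + 2 + 7) ^ 3) :=
    ⟨ha.1.trans hN, ha.2.1, ha.2.2.mono hN le_rfl⟩
  have hb' : NodeBd q.2.2 q.1.2.1 b ((N + 2 + 7) ^ 3) :=
    ⟨hb.1.trans hN, hb.2.1, hb.2.2.mono hN le_rfl⟩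
  refine ⟨⟨⟨⟨b, h', ha', hb'⟩, trivial⟩, ⟨b, h', ha', hb'⟩, trivial⟩, q.1.2.1, b, ?_⟩
  obtain ⟨⟨g, κ, t, j⟩, ⟨⟨a1, a2⟩, a3⟩, ⟨⟨b1, b2⟩, b3⟩⟩ := q
  refine ⟨by have := h.2.1; omega, h.2.2.1, (cutInfo_cov _ _ _).2.1, ha.2.1, hb.2.1,
    ⟨?_, ha'.2.2, hb'.2.2⟩, h.2.2.2⟩
  obtain ⟨h1, h2⟩ := sz_cutInfo g κ (a1 ++ b1)
  have h3 := sz_le_of_sublist h2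
  have h4 := sz_append a1 b1
  have h5 := h.1
  have h6 := ha.1
  have h7 := hb.1
  have h8 := length_lt_sz g
  have h9 := sz_nat κ
  simp only [sz_pair, Side.set, mkEnv, sz_zero] at h3 h4 h5 h6 h7 ⊢
  have h10 : κ * (sz (a1 ++ b1) + 2 * g.length + 2) ≤ N * (4 * N + 2) :=
    Nat.mul_le_mul (by omega) (by omega)
  have h11 : N * (4 * N + 2) + 10 * N + 10 ≤ (N + 2 + 7) ^ 3 := by nlinarith [Nat.zero_le (N ^ 3)]
  omega

theorem within_leafNode : Within (fun q : Par × ℕ => leafNode q.1 q.2)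
    (fun q N E => sz q.2 ≤ N ∧ ∃ b, ParBd q.1 b N E) := by
  have wi : Within (fun q : Par × ℕ => (cutInfo q.1.1 q.1.2.1 [q.2]).1)
      (fun q N E => sz q.2 ≤ N ∧ ∃ b, ParBd q.1 b N E) := by
    have h1 := within_cutInfo.comp_cst (f := fun q : Par × ℕ => (q.1.1, q.1.2.1, [q.2]))
      (by fun_prop)
    have h2 := (Cst.within (f := fun i : List ℕ × List ℕ × Bool => i.1) (by fun_prop)).comp h1
    refine h2.mono 7 2 fun ⟨⟨g, κ, t, j⟩, v⟩ N E hE ⟨hv, b, h⟩ => ⟨⟨?_, h.two_pow_le⟩, trivial⟩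
    have := linear_le N (k := 6) (by omega)
    have h3 := h.1
    simp only [sz_pair, sz_cons, sz_nil] at h3 hv ⊢
    omega
  have p1 : Poly (fun l : List ℕ => l.length) := by fun_prop
  have ww := within_words.comp ((Cst.within (f := fun q : Par × ℕ => q.1.2.2.2) (by fun_prop)).pair
    (p1.within.comp wi))
  have hv : Cst (fun q : Par × ℕ => [q.2]) := by fun_prop
  refine ((hv.within.pair (wi.pair (Cst.const (([], 0) : List ℕ × ℕ)).within)).pair ww).mono 7 3
    fun ⟨⟨g, κ, t, j⟩, v⟩ N E hE ⟨hv, b, h⟩ => ?_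
  have hN := le_cube N
  have h' : sz v ≤ (N + 2 + 7) ^ 3 ∧ ∃ b, ParBd (g, κ, t, j) b ((N + 2 + 7) ^ 3) E :=
    ⟨hv.trans hN, b, h.1.trans hN, h.2⟩
  have h1 := h.1
  have h2 := sz_nat j
  have h3 := sz_nat κ
  have h4 := (cutInfo_cov g κ [v]).2.1
  have h5 := (sz_cutInfo g κ [v]).1
  have h6 := length_lt_sz g
  simp only [sz_pair, sz_cons, sz_nil] at h1 hv h5
  have hb := h.2.1
  refine ⟨⟨trivial, h', trivial⟩, ⟨trivial, h', ?_⟩, ?_, ?_, b, by omega, h.2.2.1, ?_⟩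
  · have h10 : κ * (sz v + 1 + 1 + 2 * g.length + 2) ≤ N * (3 * N + 4) :=
      Nat.mul_le_mul (by omega) (by omega)
    have h11 : N * (3 * N + 4) + 1 ≤ (N + 2 + 7) ^ 3 := by nlinarith [Nat.zero_le (N ^ 3)]
    dsimp only
    omega
  · dsimp only; omega
  · dsimp only; omega
  · exact (Nat.pow_le_pow_right (by omega) (by dsimp only; omega)).trans h.2.2.2

theorem within_evalStep : Within (fun q : Par × List Node × List ℕ => evalStep q.1 q.2.1 q.2.2)
    (fun q N E => sz q.2.2 ≤ N ∧ ∃ b, ParBd q.1 b N E ∧ ∀ nd ∈ q.2.1, NodeBd nd q.1.2.1 b N) := by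
  have h1 := (within_joinNode.comp_cst (f := fun q : Par × List Node × List ℕ =>
    (q.1, q.2.1.headD noNode, q.2.1.tail.headD noNode)) (by fun_prop)).pair
      (Cst.within (f := fun q => q.2.1.tail.tail) (by fun_prop))
  have h2 := (within_leafNode.comp_cst (f := fun q : Par × List Node × List ℕ =>
    (q.1, q.2.2.headD 0)) (by fun_prop)).pair (Cst.within (f := fun q => q.2.1) (by fun_prop))
  have hc : Cst (fun x : Node × List Node => x.1 :: x.2) := by fun_prop
  have h3 := (Cst.within (f := fun q : Par × List Node × List ℕ => q.2.2.isEmpty) (by fun_prop)).cond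
    (hc.within.comp h1) (hc.within.comp h2)
  refine h3.mono 7 2 fun ⟨p, st, i⟩ N E hE ⟨hi, b, hp, hst⟩ => ?_
  have hN := linear_le N (k := 9) (by omega)
  have hp' : ParBd p b ((N + 2 + 7) ^ 2) E := ⟨hp.1.trans (by omega), hp.2⟩
  have h0 : NodeBd noNode p.2.1 b ((N + 2 + 7) ^ 2) :=
    ⟨le_trans (by decide) ((by omega : 9 ≤ _).trans hN), Nat.zero_le _, Nat.zero_le _, by simp [noNode]⟩
  have hst' : ∀ nd ∈ st, NodeBd nd p.2.1 b ((N + 2 + 7) ^ 2) := fun nd h =>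
    ⟨(hst nd h).1.trans (by omega), (hst nd h).2.1, (hst nd h).2.2.mono (by omega) le_rfl⟩
  have hd : ∀ l : List Node, (∀ nd ∈ l, nd ∈ st) →
      NodeBd (l.headD noNode) p.2.1 b ((N + 2 + 7) ^ 2) := by
    rintro (_ | ⟨a, l⟩) h
    · exact h0
    · exact hst' a (h a (by simp))
  refine ⟨trivial, fun _ => ⟨⟨⟨b, hp', hd _ fun _ h => h, hd _ fun _ h => List.mem_of_mem_tail h⟩,
    trivial⟩, trivial⟩, fun _ => ⟨⟨⟨?_, b, hp'⟩, trivial⟩, trivial⟩⟩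
  cases i with
  | nil => simp only [List.headD_nil, sz_zero]; omega
  | cons v i =>
    have := sz_le_of_mem (a := v) (l := v :: i) (by simp)
    dsimp only [List.headD_cons] at *
    omega

/-- The invariant of the nodes that occur in the computation. -/
structure NodeInv (nd : Node) (κ t b V : ℕ) : Prop where
  set : ∀ v ∈ nd.1.set, v ≤ V
  cov_length : nd.1.cov.length ≤ κ
  cov : ∀ v ∈ nd.1.cov, v ≤ V
  bd : nd.1.bd.Sublist nd.1.set
  num : nd.1.num ≤ t
  length : nd.2.length ≤ b ^ κ
  word : ∀ f ∈ nd.2, f.length ≤ κ ∧ ∀ x ∈ f, x ≤ b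

theorem nodeInv_noNode (κ t b V : ℕ) : NodeInv noNode κ t b V where
  set := by simp [noNode, Side.set]
  cov_length := Nat.zero_le _
  cov := by simp [noNode, Side.cov]
  bd := by simp [noNode, Side.set, Side.bd]
  num := Nat.zero_le _
  length := Nat.zero_le _
  word := by simp [noNode]

theorem cutInfo_cov_le {g : Mat} {κ V : ℕ} {A : List ℕ} (hg : g.length ≤ V) (hA : ∀ v ∈ A, v ≤ V) :
    ∀ v ∈ (cutInfo g κ A).1, v ≤ V := fun v hv =>
  ((cutInfo_cov g κ A).2.2 v hv).elim (hA v) fun h => h.le.trans hg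

theorem nodeInv_leafNode {g : Mat} {κ t q b V v : ℕ} (hg : g.length ≤ V) (hv : v ≤ V) (hb : 1 ≤ b)
    (hq : q ≤ b) : NodeInv (leafNode (g, κ, t, q) v) κ t b V := by
  have hc := cutInfo_cov g κ [v]
  refine ⟨by simpa [leafNode, Side.set] using hv, hc.2.1, cutInfo_cov_le hg (by simpa using hv),
    by simp [leafNode, Side.bd], Nat.zero_le _, ?_, fun f hf => ?_⟩
  · simp only [leafNode, length_words]
    exact (Nat.pow_le_pow_left hq _).trans (Nat.pow_le_pow_right hb hc.2.1)
  · obtain ⟨h1, h2⟩ := mem_words.1 hf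
    exact ⟨h1.le.trans hc.2.1, fun x hx => (h2 x hx).le.trans hq⟩

theorem length_nodeTable_le (e : Env) (TL TR W W' : Table) :
    (nodeTable e TL TR W W').length ≤ W.length := by
  rw [nodeTable, foldl_cons_filter (fun f => W'.foldl (fun b f' => b || e.feas TL TR (f ++ f')) false)]
  simpa using List.length_filter_le _ W

theorem nodeNum_le (e : Env) (TL TR W' : Table) : nodeNum e TL TR W' ≤ e.t := by
  rw [nodeNum]
  cases e.x.bd.isEmpty
  · exact (foldl_min (e.feas TL TR) e.val W' e.t).1
  · exact Nat.zero_le _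

theorem nodeInv_joinNode {g : Mat} {κ t q b V : ℕ} {a c : Node} (hg : g.length ≤ V) (hb : 1 ≤ b)
    (hq : q ≤ b) (ha : NodeInv a κ t b V) (hc : NodeInv c κ t b V) :
    NodeInv (joinNode (g, κ, t, q) a c) κ t b V := by
  have hi := cutInfo_cov g κ (a.1.set ++ c.1.set)
  have hA : ∀ v ∈ a.1.set ++ c.1.set, v ≤ V := fun v hv =>
    (List.mem_append.1 hv).elim (ha.set v) (hc.set v)
  refine ⟨hA, hi.2.1, cutInfo_cov_le hg hA, (sz_cutInfo g κ _).2, nodeNum_le _ _ _ _, ?_, ?_⟩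
  · simp only [joinNode, finishNode]
    cases (cutInfo g κ (a.1.set ++ c.1.set)).2.2
    · exact Nat.zero_le _
    · refine (length_nodeTable_le _ _ _ _ _).trans ?_
      rw [length_words]
      exact (Nat.pow_le_pow_left hq _).trans (Nat.pow_le_pow_right hb hi.2.1)
  · simp only [joinNode, finishNode]
    cases (cutInfo g κ (a.1.set ++ c.1.set)).2.2
    · simp
    · intro f hf
      obtain ⟨h1, h2⟩ := mem_words.1 (mem_nodeTable.1 hf).1
      exact ⟨h1.le.trans hi.2.1, fun x hx => (h2 x hx).le.trans hq⟩

theorem NodeInv.nodeBd {nd : Node} {κ t b V N : ℕ} (h : NodeInv nd κ t b V) (hκ : κ ≤ N)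
    (ht : t ≤ N) (hb : b ≤ 2 * N) (hV : V ≤ N) (hs : nd.1.set.length ≤ N) :
    NodeBd nd κ b ((N + 2 + 7) ^ 3) := by
  obtain ⟨⟨s, c, B, j⟩, T⟩ := nd
  have h1 := sz_word_le fun x hx => (h.set x hx).trans hV
  have h2 := sz_word_le fun x hx => (h.cov x hx).trans hV
  have h3 := sz_le_of_sublist h.bd
  have h4 := sz_nat j
  have h5 := h.num
  have h6 := h.cov_length
  simp only [Side.set, Side.cov, Side.bd, Side.num] at h1 h2 h3 h4 h5 h6 hs
  refine ⟨?_, h6, h.length, fun f hf => ?_⟩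
  · have h7 : s.length * (2 * N + 2) ≤ N * (2 * N + 2) := Nat.mul_le_mul_right _ hs
    have h8 : c.length * (2 * N + 2) ≤ N * (2 * N + 2) := Nat.mul_le_mul_right _ (by omega)
    have h9 : 3 * (N * (2 * N + 2)) + 2 * N + 10 ≤ (N + 2 + 7) ^ 3 := by nlinarith [Nat.zero_le (N ^ 3)]
    simp only [sz_pair]
    omega
  · obtain ⟨h1, h2⟩ := h.word f hf
    exact (sz_word_le h2).trans (word_le_cube hb (h1.trans hκ))

/-- The invariant of the evaluation of a list of items. -/
def StackInv (items : List (List ℕ)) (κ t b V : ℕ) (rest : List (List ℕ)) (st : List Node) : Prop :=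
  (∀ nd ∈ st, NodeInv nd κ t b V) ∧
    (st.map fun nd => nd.1.set.length).sum + rest.length ≤ items.length ∧ ∀ i ∈ rest, i ∈ items

theorem StackInv.evalStep {items rest : List (List ℕ)} {g : Mat} {κ t q b V : ℕ} {i : List ℕ}
    {st : List Node} (h : StackInv items κ t b V (i :: rest) st) (hg : g.length ≤ V) (hb : 1 ≤ b)
    (hq : q ≤ b) (hi : ∀ i ∈ items, ∀ v ∈ i, v ≤ V) :
    StackInv items κ t b V rest (evalStep (g, κ, t, q) st i) := by
  obtain ⟨h1, h2, h3⟩ := h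
  rw [List.length_cons] at h2
  have h4 : ∀ i ∈ rest, i ∈ items := fun i hi => h3 i (List.mem_cons_of_mem _ hi)
  have hset : ∀ a c : Node, (joinNode (g, κ, t, q) a c).1.set = a.1.set ++ c.1.set := fun _ _ => rfl
  have h0 : noNode.1.set = [] := rfl
  have hn := nodeInv_noNode κ t b V
  cases i with
  | nil =>
    have e : WhileLang.evalStep (g, κ, t, q) st [] = joinNode (g, κ, t, q) (st.headD noNode)
      (st.tail.headD noNode) :: st.tail.tail := rfl
    rw [e]
    rcases st with _ | ⟨a, _ | ⟨c, st⟩⟩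
    · refine ⟨?_, ?_, h4⟩
      · simpa using nodeInv_joinNode hg hb hq hn hn
      · simp [hset, h0]; omega
    · refine ⟨?_, ?_, h4⟩
      · simpa using nodeInv_joinNode hg hb hq (h1 a (by simp)) hn
      · simp [hset, h0] at h2 ⊢; omega
    · refine ⟨?_, ?_, h4⟩
      · simp only [List.headD_cons, List.tail_cons, List.mem_cons]
        rintro nd (rfl | hnd)
        · exact nodeInv_joinNode hg hb hq (h1 a (by simp)) (h1 c (by simp))
        · exact h1 nd (by simp [hnd])
      · simp [hset] at h2 ⊢; omega
  | cons v i =>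
    have e : WhileLang.evalStep (g, κ, t, q) st (v :: i) = leafNode (g, κ, t, q) v :: st := rfl
    rw [e]
    refine ⟨?_, ?_, h4⟩
    · simp only [List.mem_cons]
      rintro nd (rfl | hnd)
      · exact nodeInv_leafNode hg (hi (v :: i) (h3 _ (by simp)) v (by simp)) hb hq
      · exact h1 nd hnd
    · have : (leafNode (g, κ, t, q) v).1.set.length = 1 := rfl
      rw [List.map_cons, List.sum_cons, this]
      omega

theorem Within.not {α : Type} [Code α] {f : α → Bool} {R : α → ℕ → ℕ → Prop} (h : Within f R) :
    Within (fun x => !(f x)) R :=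
  ((h.cond (Cst.const false).within (Cst.const true).within).congr fun x => by
    cases f x <;> rfl).weaken fun _ _ _ _ h => ⟨h, fun _ => trivial, fun _ => trivial⟩

theorem within_decideCol : Within (fun q : (Mat × List (List ℕ)) × ℕ × ℕ =>
      decideCol q.1.1 q.1.2 q.2.1 q.2.2)
    (fun q N E => sz q ≤ N ∧ 1 ≤ q.2.1 ∧ (3 * q.2.1) ^ (4 * q.2.1) ≤ E) := by
  have p1 : Poly (fun q : (Mat × List (List ℕ)) × ℕ × ℕ =>
    ((q.1.1, q.2.1, q.2.2, min q.2.2 (q.2.1 + q.2.1 + q.2.1)) : Par)) := by fun_prop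
  have h1 := within_evalStep.foldl.comp (p1.within.pair (Cst.within
    (f := fun q : (Mat × List (List ℕ)) × ℕ × ℕ => (([], q.1.2) : List Node × List (List ℕ)))
    (by fun_prop)))
  have h2 := ((Cst.within (f := fun st : List Node => (st.headD noNode).2.isEmpty)
    (by fun_prop)).comp h1).not
  refine h2.mono 7 3 fun ⟨⟨g, items⟩, κ, t⟩ N E hE ⟨hN, hκ, hE'⟩ => ⟨⟨⟨hN.trans (le_cube N), trivial⟩, ?_⟩,
    trivial⟩
  have hg := length_lt_sz g
  have hi := length_lt_sz items
  have h3 := sz_nat κ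
  have h4 := sz_nat t
  simp only [sz_pair] at hN hκ
  have hV : ∀ i ∈ items, ∀ v ∈ i, v ≤ N := fun i hi v hv => by
    have h5 := sz_le_of_mem hi
    have h6 := sz_le_of_mem hv
    rw [sz_nat] at h6
    omega
  refine ⟨StackInv items κ t (3 * κ) N, 1, E, hE, by simp, ?_, ⟨by simp, by simp, fun _ h => h⟩, ?_⟩
  · have := le_cube N
    dsimp only
    omega
  · intro i rest st h
    have hq : min t (κ + κ + κ) ≤ 3 * κ := by omega
    refine ⟨h.evalStep (g := g) (q := min t (κ + κ + κ)) (by omega) (by omega) hq hV, ?_⟩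
    have h5 := sz_le_of_mem (h.2.2 i (by simp))
    have h7 := le_cube N
    refine ⟨by dsimp only; omega, 3 * κ, ⟨?_, by omega, hq, hE'⟩, fun nd hnd => ?_⟩
    · have h6 := sz_nat (min t (κ + κ + κ))
      have h8 : 10 * N + 10 ≤ (N + 2 + 7) ^ 3 := by nlinarith [Nat.zero_le (N ^ 3)]
      simp only [sz_pair]
      omega
    · have h8 : nd.1.set.length ≤ N := by
        have h9 := List.single_le_sum (l := st.map fun nd => nd.1.set.length) (by simp) _
          (List.mem_map.2 ⟨nd, hnd, rfl⟩)
        have h10 := h.2.1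
        omega
      refine NodeInv.nodeBd (h.1 nd hnd) (by dsimp only; omega) (by omega) (by omega)
        le_rfl h8

theorem foldl_chromatic_cases {g : Mat} {items : List (List ℕ)} {l₁ l₂ l : List (ℕ × ℕ)}
    {pre : List (ℕ × ℕ)} {c : ℕ × ℕ} (h : l₁.foldl (chromStep g items) 0 ≠ 0)
    (e : pre ++ c :: l = l₁ ++ l₂) (h0 : pre.foldl (chromStep g items) 0 = 0) : c ∈ l₁ := by
  rcases List.append_eq_append_iff.1 e with ⟨a, rfl, ha⟩ | ⟨a, rfl, ha⟩
  · cases a with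
    | nil => simp [h0] at h
    | cons d a => simp at ha; simp [ha.1]
  · rw [List.foldl_append, foldl_chromStep_pos h] at h0
    exact absurd h0 h

theorem chromStep_le {g : Mat} {items : List (List ℕ)} {r N : ℕ} {c : ℕ × ℕ} (hr : r ≤ N)
    (hc : c.2 ≤ N) : chromStep g items r c ≤ N := by
  unfold chromStep
  cases Nat.ble r 0
  · simpa
  · cases decideCol g items c.1 c.2
    · simp
    · simpa

theorem within_chromatic : Within (fun q : (Mat × List (List ℕ)) × List (ℕ × ℕ) =>
      chromatic q.1.1 q.1.2 q.2)
    (fun q N E => sz q ≤ N ∧ ∃ (l₁ l₂ : List (ℕ × ℕ)) (K : ℕ), q.2 = l₁ ++ l₂ ∧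
      l₁.foldl (chromStep q.1.1 q.1.2) 0 ≠ 0 ∧ (∀ c ∈ l₁, 1 ≤ c.1 ∧ c.1 ≤ K) ∧
        (3 * K) ^ (4 * K) ≤ E) := by
  have p1 : Poly (fun r : ℕ => !Nat.ble r 0) := by fun_prop
  have h1 := (p1.within.comp_cst (f := fun q : (Mat × List (List ℕ)) × ℕ × ℕ × ℕ => q.2.1)
    (by fun_prop)).cond (Cst.within (f := fun q => q.2.1) (by fun_prop))
    ((within_decideCol.comp_cst (f := fun q : (Mat × List (List ℕ)) × ℕ × ℕ × ℕ =>
      (q.1, q.2.2)) (by fun_prop)).cond (Cst.within (f := fun q => q.2.2.2) (by fun_prop))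
        (Cst.const 0).within)
  have h2 := h1.foldl.comp_cst (f := fun q : (Mat × List (List ℕ)) × List (ℕ × ℕ) => (q.1, 0, q.2))
    (by fun_prop)
  refine h2.mono 7 2 fun ⟨⟨g, items⟩, l⟩ N E hE ⟨hN, l₁, l₂, K, hl, h3, h4, hE'⟩ =>
    ⟨fun rest r => r ≤ N ∧ ∃ pre, pre ++ rest = l ∧ r = pre.foldl (chromStep g items) 0, 1, E, hE,
      by simp, ?_, ⟨Nat.zero_le _, [], by simp, rfl⟩, ?_⟩
  · have := linear_le N (k := 1) (by omega)
    have := length_lt_sz l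
    simp only [sz_pair] at hN ⊢
    omega
  · rintro ⟨κ, t⟩ rest r ⟨hr, pre, hp, hr'⟩
    have h5 := sz_le_of_mem (a := (κ, t)) (l := l) (by simp [← hp])
    have h6 := linear_le N (k := 2) (by omega)
    have h7 := sz_nat t
    simp only [sz_pair] at hN h5
    refine ⟨⟨chromStep_le hr (by dsimp only; omega), pre ++ [(κ, t)], by simp [hp], ?_⟩, ?_, ?_⟩
    · rw [List.foldl_append, ← hr']
      rfl
    · rw [sz_nat]; dsimp only; omega
    · refine ⟨fun _ => trivial, fun h0 => ⟨⟨?_, ?_⟩, fun _ => trivial, fun _ => trivial⟩⟩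
      · simp only [sz_pair]; omega
      · have h8 : r = 0 := by
          dsimp only at h0
          rw [Bool.not_eq_false', Nat.ble_eq] at h0
          omega
        obtain ⟨h9, h10⟩ := h4 _ (foldl_chromatic_cases h3 (hp.trans hl) (hr'.symm.trans h8))
        refine ⟨h9, le_trans ?_ hE'⟩
        dsimp only at *
        exact (Nat.pow_le_pow_left (by omega) _).trans (Nat.pow_le_pow_right (by omega) (by omega))

theorem visit_inv {T : Mat} {d : List (List ℕ)} {s : List (ℕ × ℕ) × List (List ℕ)} {j : ℕ}
    (h : (∀ a ∈ s.1, a.1 ≤ T.length ∧ a.2 ≤ T.length) ∧ s.1.length ≤ 1 + j * T.length ∧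
      s.2.length ≤ 2 * j ∧ ∀ i ∈ s.2, i ∈ d ∨ i = []) :
    (∀ a ∈ (visit T d s).1, a.1 ≤ T.length ∧ a.2 ≤ T.length) ∧
      (visit T d s).1.length ≤ 1 + (j + 1) * T.length ∧
      (visit T d s).2.length ≤ 2 * (j + 1) ∧ ∀ i ∈ (visit T d s).2, i ∈ d ∨ i = [] := by
  obtain ⟨st, out⟩ := s
  obtain ⟨h1, h2, h3, h4⟩ := h
  cases st with
  | nil => exact ⟨h1, Nat.zero_le _, h3.trans (by omega), h4⟩
  | cons a st =>
    obtain ⟨x, p⟩ := a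
    have hx := h1 (x, p) (by simp)
    simp only [visit, List.isEmpty_cons, cond_false, List.headD_cons, List.tail_cons]
    refine ⟨fun a ha => ?_, ?_, ?_, ?_⟩
    · rcases List.mem_append.1 ha with ha | ha
      · obtain ⟨y, hy, rfl⟩ := List.mem_map.1 ha
        have := List.mem_range.1 (List.mem_filter.1 hy).1
        exact ⟨this.le, hx.1⟩
      · exact h1 a (List.mem_cons_of_mem _ ha)
    · have := List.length_filter_le (fun y => adj T x y && !(y == p)) (List.range T.length)
      rw [List.length_range] at this
      simp only [List.length_cons, List.length_append, List.length_map, Nat.succ_mul] at h2 ⊢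
      omega
    · simp only [List.length_append] at h3 ⊢
      cases (d.getD x []).isEmpty <;>
      cases (((List.range T.length).filter fun y => adj T x y && !(y == p)).length +
        (d.getD x []).length == 2) <;> simp <;> omega
    · intro i hi
      rcases List.mem_append.1 hi with hi | hi
      · cases hd : (d.getD x []).isEmpty
        · rw [hd] at hi
          simp only [cond_false, List.mem_singleton] at hi
          subst hi
          by_cases hxd : x < d.length
          · left; rw [List.getD_eq_getElem _ _ hxd]; exact List.getElem_mem _
          · right; exact List.getD_eq_default _ _ (by omega)
        · rw [hd] at hi
          simp at hi
      · rcases List.mem_append.1 hi with hi | hi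
        · right
          revert hi
          cases (((List.range T.length).filter fun y => adj T x y && !(y == p)).length +
            (d.getD x []).length == 2) <;> simp
        · exact h4 i hi

theorem poly_postorder : Poly (fun q : Mat × List (List ℕ) => postorder q.1 q.2) := by
  have h : Poly (fun q : Mat × List (List ℕ) => (List.replicate q.1.length ()).foldl
      (fun s _ => visit q.1 q.2 s) ([(((List.range q.1.length).filter fun x =>
        !(q.2.getD x []).isEmpty).headD 0, ((List.range q.1.length).filter fun x =>
        !(q.2.getD x []).isEmpty).headD 0)], [])) := by
    refine Poly.foldl (B := fun q => (1 + sz q * sz q) * (4 * sz q + 4) + 1 +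
      (2 * sz q * (sz q + 1) + 1) + 1) (by fun_prop) (by fun_prop) (by fun_prop) ?_ ?_
    · exact (((((PolyBd.const 1).add (PolyBd.size.mul .size)).mul
        (((PolyBd.const 4).mul .size).add (.const 4))).add (.const 1)).add
        ((((PolyBd.const 2).mul .size).mul (PolyBd.size.add (.const 1))).add (.const 1))).add (.const 1)
    · rintro ⟨T, d⟩ l' hl
      obtain ⟨j, hj, rfl⟩ := initial_units hl
      dsimp only at hj ⊢
      have hr : ((List.range T.length).filter fun x => !(d.getD x []).isEmpty).headD 0 ≤ T.length := by
        rcases hf : (List.range T.length).filter fun x => !(d.getD x []).isEmpty with _ | ⟨a, l⟩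
        · simp
        · have : a ∈ (List.range T.length).filter fun x => !(d.getD x []).isEmpty := by
            rw [hf]; simp
          exact (List.mem_range.1 (List.mem_filter.1 this).1).le
      generalize ((List.range T.length).filter fun x => !(d.getD x []).isEmpty).headD 0 = r at hr
      have key : ∀ i, let s := (List.replicate i ()).foldl (fun s _ => visit T d s) ([(r, r)], [])
          (∀ a ∈ s.1, a.1 ≤ T.length ∧ a.2 ≤ T.length) ∧ s.1.length ≤ 1 + i * T.length ∧
          s.2.length ≤ 2 * i ∧ ∀ k ∈ s.2, k ∈ d ∨ k = [] := by
        intro i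
        induction i with
        | zero => simpa using hr
        | succ i ih =>
          rw [List.replicate_succ', List.foldl_append]
          exact visit_inv ih
      obtain ⟨h1, h2, h3, h4⟩ := key j
      generalize (List.replicate j ()).foldl (fun s _ => visit T d s) ([(r, r)], []) = s at *
      have h5 := length_lt_sz T
      obtain ⟨st, out⟩ := s
      have h6 := sz_le_of_forall (l := st) (B := 4 * sz (T, d) + 3) fun a ha => by
        have := h1 a ha
        obtain ⟨a, b⟩ := a
        simp only [sz_pair, sz_nat] at this ⊢
        omega
      have h7 := sz_le_of_forall (l := out) (B := sz (T, d)) fun a ha => by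
        rcases h4 a ha with h | rfl
        · have := sz_le_of_mem h
          rw [sz_pair]; omega
        · exact sz_pos _
      have h8 : T.length ≤ sz (T, d) := by rw [sz_pair]; omega
      have h9 : j * T.length ≤ sz (T, d) * sz (T, d) := Nat.mul_le_mul (hj.trans h8) h8
      have h10 : st.length * (4 * sz (T, d) + 3 + 1) ≤ (1 + sz (T, d) * sz (T, d)) * (4 * sz (T, d) + 4) :=
        Nat.mul_le_mul_right _ (h2.trans (by omega))
      have h11 : out.length * (sz (T, d) + 1) ≤ 2 * sz (T, d) * (sz (T, d) + 1) :=
        Nat.mul_le_mul_right _ (by dsimp only at h3; omega)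
      rw [sz_pair st out]
      omega
  have := h.snd
  exact this

theorem within_solve : Within solve (fun q N E => sz q ≤ N ∧ ∃ (l₁ l₂ : List (ℕ × ℕ)) (K : ℕ),
    candidates q.1.length = l₁ ++ l₂ ∧
      l₁.foldl (chromStep q.1 (postorder q.2.1 q.2.2)) 0 ≠ 0 ∧ (∀ c ∈ l₁, 1 ≤ c.1 ∧ c.1 ≤ K) ∧
        (3 * K) ^ (4 * K) ≤ E) := by
  have p1 : Poly (fun q : Mat × Mat × List (List ℕ) =>
      ((q.1, postorder q.2.1 q.2.2), candidates q.1.length)) := by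
    have := poly_postorder
    fun_prop
  obtain ⟨c, hc⟩ := p1.2
  refine (within_chromatic.comp p1.within).mono 0 (c + 1) fun q N E hE ⟨hN, h⟩ => ⟨?_, ?_, h⟩
  · rw [add_zero]
    exact hN.trans ((by omega : N ≤ N + 2).trans (Nat.le_self_pow (by omega) _))
  · rw [add_zero]
    exact (hc q).trans ((Nat.pow_le_pow_left (by omega) _).trans
      (Nat.pow_le_pow_right (by omega) (Nat.le_succ c)))

end WhileLang

/-! ### Traversing the tree of a branch decomposition -/

namespace SplitMatching

section

variable {W : Type*} {T : SimpleGraph W} {x y y' p z : W}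

/-- The nodes on the side of `x` of the edge `xp`. -/
def side (T : SimpleGraph W) (x p : W) : Set W := {z | (T.deleteEdges {s(x, p)}).Reachable x z}

theorem self_mem_side : x ∈ side T x p := SimpleGraph.Reachable.refl _

theorem adj_mem_side (hz : z ∈ side T x p) (h : T.Adj z y) (hx : s(z, y) ≠ s(x, p)) :
    y ∈ side T x p :=
  SimpleGraph.Reachable.trans hz
    (SimpleGraph.Adj.reachable (SimpleGraph.deleteEdges_adj.2 ⟨h, by simpa using hx⟩))

theorem side_induction {P : W → Prop} (h0 : P x)
    (h : ∀ y z, y ∈ side T x p → T.Adj y z → s(y, z) ≠ s(x, p) → P y → P z) (hz : z ∈ side T x p) :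
    P z := by
  have hz' := (SimpleGraph.reachable_iff_reflTransGen _ _).1 hz
  induction hz' with
  | refl => exact h0
  | tail h1 h2 ih =>
    have h3 := (SimpleGraph.reachable_iff_reflTransGen _ _).2 h1
    rw [SimpleGraph.deleteEdges_adj] at h2
    exact h _ _ h3 h2.1 (by simpa using h2.2) (ih h3)

theorem notMem_side (hT : T.IsTree) (h : T.Adj x p) : p ∉ side T x p :=
  SimpleGraph.isBridge_iff.1 (SimpleGraph.isAcyclic_iff_forall_adj_isBridge.1 hT.isAcyclic h)

theorem side_subset (hT : T.IsTree) (h : T.Adj y x) (hy : y ≠ p) : side T y x ⊆ side T x p := by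
  intro z hz
  have hx := notMem_side hT h
  refine side_induction ?_ (fun u v hu huv he hu' => adj_mem_side hu' huv ?_) hz
  · refine adj_mem_side self_mem_side h.symm fun e => ?_
    rcases Sym2.eq_iff.1 e with ⟨-, e⟩ | ⟨e, e'⟩
    · exact hy e
    · exact hy (e'.trans e)
  · have hv := adj_mem_side hu huv he
    intro e
    rcases Sym2.eq_iff.1 e with ⟨rfl, -⟩ | ⟨-, rfl⟩
    · exact hx hu
    · exact hx hv

theorem side_disjoint (hT : T.IsTree) (h : T.Adj y x) (h' : T.Adj y' x) (hy : y ≠ y') :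
    Disjoint (side T y x) (side T y' x) := by
  rw [Set.disjoint_left]
  intro z hz hz'
  have hx := notMem_side hT h
  have hx' := notMem_side hT h'
  have key : y' ∈ side T y x := by
    revert hz
    refine side_induction (P := fun z => z ∈ side T y x → y' ∈ side T y x) id
      (fun u v hu huv he ih hv => ih (adj_mem_side hv huv.symm fun e => ?_)) hz'
    have hv' := adj_mem_side hu huv he
    rcases Sym2.eq_iff.1 e with ⟨-, rfl⟩ | ⟨rfl, -⟩
    · exact hx' hu
    · exact hx' hv'
  refine hx (adj_mem_side key h' fun e => ?_)
  rcases Sym2.eq_iff.1 e with ⟨e, -⟩ | ⟨e, -⟩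
  · exact hy e.symm
  · exact h'.ne e

theorem mem_side_cases (hT : T.IsTree) (hz : z ∈ side T x p) :
    z = x ∨ ∃ y, T.Adj y x ∧ y ≠ p ∧ z ∈ side T y x := by
  refine side_induction (P := fun z => z = x ∨ ∃ y, T.Adj y x ∧ y ≠ p ∧ z ∈ side T y x) (Or.inl rfl)
    (fun u v hu huv he ih => ?_) hz
  by_cases hv : v = x
  · exact Or.inl hv
  · right
    rcases ih with rfl | ⟨y, hy, hyp, huy⟩
    · exact ⟨v, huv.symm, fun e => he (by rw [e]), self_mem_side⟩
    · refine ⟨y, hy, hyp, adj_mem_side huy huv fun e => ?_⟩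
      rcases Sym2.eq_iff.1 e with ⟨-, e⟩ | ⟨rfl, -⟩
      · exact hv e
      · exact notMem_side hT hy huy

theorem exists_mem_side (hT : T.IsTree) (z r : W) : z = r ∨ ∃ y, T.Adj y r ∧ z ∈ side T y r := by
  have h := (SimpleGraph.reachable_iff_reflTransGen _ _).1 (hT.connected.preconnected r z)
  induction h with
  | refl => exact Or.inl rfl
  | tail h1 h2 ih =>
    rename_i u v
    by_cases hv : v = r
    · exact Or.inl hv
    · right
      rcases ih with rfl | ⟨y, hy, huy⟩
      · exact ⟨v, h2.symm, self_mem_side⟩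
      · refine ⟨y, hy, adj_mem_side huy h2 fun e => ?_⟩
        rcases Sym2.eq_iff.1 e with ⟨-, e⟩ | ⟨rfl, -⟩
        · exact hv e
        · exact notMem_side hT hy huy

end

end SplitMatching

namespace WhileLang

open SplitMatching

/-- The matrix `M` and the table `d` represent the branch decomposition `D`. -/
structure Represents {n m : ℕ} (D : BranchDecomposition (Fin n) (Fin m)) (M : Mat)
    (d : List (List ℕ)) : Prop where
  length : M.length = m
  adj : ∀ x y : Fin m, adj M x y = true ↔ D.tree.Adj x y
  leaf : ∀ x (h : IsLeaf D.tree x), d.getD x [] = [(D.leafEquiv ⟨x, h⟩ : ℕ)]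
  inner : ∀ x : Fin m, ¬ IsLeaf D.tree x → d.getD x [] = []

section

variable {n m : ℕ} {D : BranchDecomposition (Fin n) (Fin m)} {M : Mat} {d : List (List ℕ)}

/-- The nodes visited after `x` when coming from `p`. -/
def kids (M : Mat) (x p : ℕ) : List ℕ :=
  (List.range M.length).filter fun y => adj M x y && !(y == p)

theorem Represents.mem_kids (h : Represents D M d) {x : Fin m} {p y : ℕ} :
    y ∈ kids M x p ↔ ∃ y' : Fin m, (y' : ℕ) = y ∧ D.tree.Adj x y' ∧ (y' : ℕ) ≠ p := by
  simp only [kids, List.mem_filter, List.mem_range, h.length, Bool.and_eq_true,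
    Bool.not_eq_true', beq_eq_false_iff_ne]
  constructor
  · rintro ⟨hy, h1, h2⟩
    exact ⟨⟨y, hy⟩, rfl, (h.adj x ⟨y, hy⟩).1 h1, h2⟩
  · rintro ⟨y', rfl, h1, h2⟩
    exact ⟨y'.2, (h.adj x y').2 h1, h2⟩

theorem nodup_kids (M : Mat) (x p : ℕ) : (kids M x p).Nodup := List.nodup_range.filter _

theorem Represents.ncard_eq (h : Represents D M d) {x p : Fin m} (hp : D.tree.Adj x p) :
    (D.tree.neighborSet x).ncard = (kids M x p).length + 1 := by
  classical
  rw [← Set.ncard_image_of_injective _ Fin.val_injective]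
  have : Fin.val '' D.tree.neighborSet x = ((insert (p : ℕ) (kids M x p).toFinset : Finset ℕ) : Set ℕ) := by
    ext y
    simp only [Set.mem_image, SimpleGraph.mem_neighborSet, Finset.coe_insert, List.coe_toFinset,
      Set.mem_insert_iff, Set.mem_ofPred_eq, h.mem_kids]
    constructor
    · rintro ⟨y', h1, rfl⟩
      by_cases e : (y' : ℕ) = p
      · exact Or.inl e
      · exact Or.inr ⟨y', rfl, h1, e⟩
    · rintro (rfl | ⟨y', rfl, h1, -⟩)
      · exact ⟨p, hp, rfl⟩
      · exact ⟨y', h1, rfl⟩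
  rw [this, Set.ncard_coe_finset, Finset.card_insert_of_notMem,
    List.toFinset_card_of_nodup (nodup_kids _ _ _)]
  rw [List.mem_toFinset, h.mem_kids]
  rintro ⟨y', h1, -, h2⟩
  exact h2 h1

theorem Represents.ncard_eq_root (h : Represents D M d) (x : Fin m) :
    (D.tree.neighborSet x).ncard = (kids M x x).length := by
  classical
  rw [← Set.ncard_image_of_injective _ Fin.val_injective]
  have : Fin.val '' D.tree.neighborSet x = ((kids M x x).toFinset : Set ℕ) := by
    ext y
    simp only [Set.mem_image, SimpleGraph.mem_neighborSet, List.coe_toFinset,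
      Set.mem_ofPred_eq, h.mem_kids]
    constructor
    · rintro ⟨y', h1, rfl⟩
      exact ⟨y', rfl, h1, fun e => h1.ne (Fin.ext e.symm)⟩
    · rintro ⟨y', rfl, h1, -⟩
      exact ⟨y', h1, rfl⟩
  rw [this, Set.ncard_coe_finset, List.toFinset_card_of_nodup (nodup_kids _ _ _)]

theorem visit_cons (M : Mat) (d : List (List ℕ)) (x p : ℕ) (st : List (ℕ × ℕ))
    (out : List (List ℕ)) : visit M d ((x, p) :: st, out) =
      ((kids M x p).map (fun y => (y, x)) ++ st, (bif (d.getD x []).isEmpty then [] else [d.getD x []]) ++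
        ((bif (kids M x p).length + (d.getD x []).length == 2 then [[]] else []) ++ out)) := rfl

theorem mem_cut {a b : Fin m} {v : Fin n} :
    v ∈ D.cut a b ↔ (D.leafEquiv.symm v : Fin m) ∈ side D.tree a b := Iff.rfl

/-- The list of numbers of the elements of a set. -/
def Lists {n : ℕ} (A : List ℕ) (S : Set (Fin n)) : Prop :=
  ∀ v : ℕ, v ∈ A ↔ ∃ v' : Fin n, (v' : ℕ) = v ∧ v' ∈ S

theorem Represents.visit_side (h : Represents D M d) {P : List ℕ → Prop}
    (hP : ∀ v : Fin n, P [(v : ℕ)])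
    (hP' : ∀ A a b, D.tree.Adj a b → Lists A (D.cut a b) → P A) (k : ℕ) :
    ∀ x p : Fin m, D.tree.Adj x p → (side D.tree x p).ncard ≤ k →
    ∃ (t : BT) (j : ℕ), j ≤ (side D.tree x p).ncard ∧ (∀ st out, (visit M d)^[j]
      (((x : ℕ), (p : ℕ)) :: st, out) = (st, t.post ++ out)) ∧ t.leaves.Nodup ∧
      Lists t.leaves (D.cut x p) ∧ t.AllSub P := by
  induction k with
  | zero =>
    intro x p _ hk
    have : (side D.tree x p).ncard ≠ 0 := Set.ncard_ne_zero_of_mem self_mem_side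
    omega
  | succ k ih =>
    intro x p hp hk
    have hT := D.isTree
    have hdeg := D.degree_le x
    have hcard := h.ncard_eq hp
    have sub : ∀ y ∈ kids M x p, ∃ y' : Fin m, (y' : ℕ) = y ∧ D.tree.Adj y' x ∧ y' ≠ p ∧
        (side D.tree y' x).ncard + 1 ≤ (side D.tree x p).ncard ∧
        insert x (side D.tree y' x) ⊆ side D.tree x p := by
      intro y hy
      obtain ⟨y', rfl, h1, h2⟩ := h.mem_kids.1 hy
      have h3 : insert x (side D.tree y' x) ⊆ side D.tree x p :=
        Set.insert_subset self_mem_side (side_subset hT h1.symm fun e => h2 (by rw [e]))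
      refine ⟨y', rfl, h1.symm, fun e => h2 (by rw [e]), ?_, h3⟩
      rw [← Set.ncard_insert_of_notMem (notMem_side hT h1.symm)]
      exact Set.ncard_le_ncard h3
    rcases hkids : kids M x p with _ | ⟨y₁, _ | ⟨y₂, _ | ⟨y₃, l⟩⟩⟩
    · rw [hkids] at hcard
      have hl : IsLeaf D.tree x := by simp [IsLeaf, hcard]
      have hcut : ∀ v : Fin n, v ∈ D.cut x p ↔ v = D.leafEquiv ⟨x, hl⟩ := by
        intro v
        rw [mem_cut]
        constructor
        · intro hv
          rcases mem_side_cases hT hv with e | ⟨y, h1, h2, -⟩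
          · rw [← Equiv.symm_apply_eq]; exact Subtype.ext e
          · have : (y : ℕ) ∈ kids M x p :=
              h.mem_kids.2 ⟨y, rfl, h1.symm, fun e => h2 (Fin.ext e)⟩
            simp [hkids] at this
        · rintro rfl
          simpa using self_mem_side
      refine ⟨.leaf (D.leafEquiv ⟨x, hl⟩), 1, ?_, ?_, by simp [BT.leaves], ?_, hP _⟩
      · exact Nat.one_le_iff_ne_zero.2 (Set.ncard_ne_zero_of_mem self_mem_side)
      · intro st out
        rw [Function.iterate_one, visit_cons, hkids, h.leaf x hl]
        simp [BT.post]
      · intro v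
        simp only [BT.leaves, List.mem_singleton, hcut]
        constructor
        · rintro rfl; exact ⟨_, rfl, rfl⟩
        · rintro ⟨v', rfl, rfl⟩; rfl
    · rw [hkids] at hcard
      have hl : ¬ IsLeaf D.tree x := by simp [IsLeaf, hcard]
      obtain ⟨z, rfl, h1, h2, h3, h4⟩ := sub y₁ (by simp [hkids])
      obtain ⟨t, j, h5, h6, h7, h8, h9⟩ := ih z x h1 (by omega)
      refine ⟨t, j + 1, by omega, fun st out => ?_, h7, fun v => ?_, h9⟩
      · rw [Function.iterate_succ_apply, visit_cons, hkids, h.inner x hl]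
        simpa using h6 st out
      · rw [h8 v]
        refine exists_congr fun v' => and_congr_right fun _ => ?_
        rw [mem_cut, mem_cut]
        constructor
        · exact fun hv => h4 (Set.mem_insert_of_mem _ hv)
        · intro hv
          rcases mem_side_cases hT hv with e | ⟨y, h1', h2', hv⟩
          · exact absurd (e ▸ (D.leafEquiv.symm v').2) hl
          · have : (y : ℕ) ∈ kids M x p :=
              h.mem_kids.2 ⟨y, rfl, h1'.symm, fun e => h2' (Fin.ext e)⟩
            rw [hkids, List.mem_singleton] at this
            rwa [← Fin.ext this]
    · rw [hkids] at hcard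
      have hl : ¬ IsLeaf D.tree x := by simp [IsLeaf, hcard]
      have hne : y₁ ≠ y₂ := by
        have := nodup_kids M x p
        rw [hkids] at this
        simpa using this
      obtain ⟨z, rfl, h1, h2, h3, h4⟩ := sub y₁ (by simp [hkids])
      obtain ⟨z', rfl, h1', h2', h3', h4'⟩ := sub y₂ (by simp [hkids])
      obtain ⟨t, j, h5, h6, h7, h8, h9⟩ := ih z x h1 (by omega)
      obtain ⟨t', j', h5', h6', h7', h8', h9'⟩ := ih z' x h1' (by omega)
      have hdis := side_disjoint hT h1 h1' fun e => hne (by rw [e])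
      have hlist : Lists (t.leaves ++ t'.leaves) (D.cut x p) := by
        intro v
        rw [List.mem_append, h8 v, h8' v]
        constructor
        · rintro (⟨v', rfl, hv⟩ | ⟨v', rfl, hv⟩)
          · exact ⟨v', rfl, h4 (Set.mem_insert_of_mem _ hv)⟩
          · exact ⟨v', rfl, h4' (Set.mem_insert_of_mem _ hv)⟩
        · rintro ⟨v', rfl, hv⟩
          rcases mem_side_cases hT hv with e | ⟨y, g1, g2, hv⟩
          · exact absurd (e ▸ (D.leafEquiv.symm v').2) hl
          · have : (y : ℕ) ∈ kids M x p :=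
              h.mem_kids.2 ⟨y, rfl, g1.symm, fun e => g2 (Fin.ext e)⟩
            simp only [hkids, List.mem_cons, List.not_mem_nil, or_false] at this
            rcases this with e | e
            · rw [Fin.ext e] at hv; exact Or.inl ⟨v', rfl, hv⟩
            · rw [Fin.ext e] at hv; exact Or.inr ⟨v', rfl, hv⟩
      refine ⟨.node t t', j' + j + 1, ?_, fun st out => ?_, ?_, hlist, h9, h9', hP' _ x p hp hlist⟩
      · have h10 : (insert x (side D.tree z x ∪ side D.tree z' x)).ncard ≤ (side D.tree x p).ncard := by
          refine Set.ncard_le_ncard ?_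
          rw [Set.insert_union_distrib]
          exact Set.union_subset h4 h4'
        rw [Set.ncard_insert_of_notMem, Set.ncard_union_eq hdis] at h10
        · omega
        · rintro (hx | hx)
          · exact notMem_side hT h1 hx
          · exact notMem_side hT h1' hx
      · rw [Function.iterate_succ_apply, visit_cons, hkids, h.inner x hl, Function.iterate_add_apply]
        simp only [List.map_cons, List.map_nil, List.cons_append, List.nil_append, h6, h6']
        simp [BT.post]
      · refine List.nodup_append.2 ⟨h7, h7', fun a ha b hb e => ?_⟩
        obtain ⟨v, rfl, hv⟩ := (h8 a).1 ha
        obtain ⟨v', rfl, hv'⟩ := (h8' b).1 hb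
        rw [Fin.ext e] at hv
        exact Set.disjoint_left.1 hdis hv hv'
    · rw [hkids] at hcard
      simp only [List.length_cons] at hcard
      omega

theorem iterate_visit_nil (M : Mat) (d : List (List ℕ)) (j : ℕ) (out : List (List ℕ)) :
    (visit M d)^[j] ([], out) = ([], out) :=
  Function.iterate_fixed rfl j

theorem exists_isLeaf {m : ℕ} {T : SimpleGraph (Fin m)} (hT : T.IsTree) : ∃ x, IsLeaf T x := by
  classical
  have hne := hT.connected.nonempty
  by_cases h : Nontrivial (Fin m)
  · obtain ⟨x, hx⟩ := hT.exists_vert_degree_one_of_nontrivial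
    refine ⟨x, ?_⟩
    rw [IsLeaf, Set.ncard_eq_toFinset_card', ← hx]
    rfl
  · rw [not_nontrivial_iff_subsingleton] at h
    exact ⟨hne.some, Set.ncard_le_one_of_subsingleton _⟩

theorem Represents.postorder_eq (h : Represents D M d) {P : List ℕ → Prop}
    (hP : ∀ v : Fin n, P [(v : ℕ)])
    (hP' : ∀ A a b, D.tree.Adj a b → Lists A (D.cut a b) → P A)
    (hP'' : ∀ A, Lists A (Set.univ : Set (Fin n)) → P A) :
    ∃ t : BT, postorder M d = t.post ∧ t.leaves.Nodup ∧ Lists t.leaves (Set.univ : Set (Fin n)) ∧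
      t.AllSub P := by
  have hT := D.isTree
  obtain ⟨r, hr, hrd⟩ : ∃ r : Fin m, IsLeaf D.tree r ∧
      ((List.range M.length).filter fun x => !(d.getD x []).isEmpty).headD 0 = (r : ℕ) := by
    obtain ⟨z, hz⟩ := exists_isLeaf hT
    have hz' : (z : ℕ) ∈ (List.range M.length).filter fun x => !(d.getD x []).isEmpty := by
      rw [List.mem_filter, List.mem_range, h.length, h.leaf z hz]
      exact ⟨z.2, rfl⟩
    rcases hf : (List.range M.length).filter fun x => !(d.getD x []).isEmpty with _ | ⟨a, l⟩
    · rw [hf] at hz'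
      simp at hz'
    · have ha : a ∈ (List.range M.length).filter fun x => !(d.getD x []).isEmpty := by
        rw [hf]
        simp
      rw [List.mem_filter, List.mem_range, h.length] at ha
      refine ⟨⟨a, ha.1⟩, ?_, rfl⟩
      by_contra hl
      have := ha.2
      rw [show a = ((⟨a, ha.1⟩ : Fin m) : ℕ) from rfl, h.inner _ hl] at this
      simp at this
  have hpost : postorder M d = ((visit M d)^[m] ([((r : ℕ), (r : ℕ))], [])).2 := by
    rw [← foldl_units, ← hrd]
    have := h.length
    generalize m = m₀ at this
    subst this
    rfl
  have hcard := h.ncard_eq_root r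
  obtain ⟨m', hm'⟩ : ∃ m', m = m' + 1 := ⟨m - 1, by have := r.2; omega⟩
  have hstep : (visit M d)^[m] ([((r : ℕ), (r : ℕ))], []) =
      (visit M d)^[m'] (visit M d ([((r : ℕ), (r : ℕ))], [])) :=
    congrArg (fun j => (visit M d)^[j] ([((r : ℕ), (r : ℕ))], [])) hm'
  rw [hpost, hstep, visit_cons, h.leaf r hr]
  have hside : ∀ v : Fin n, v = D.leafEquiv ⟨r, hr⟩ ∨
      ∃ y : Fin m, (y : ℕ) ∈ kids M r r ∧ v ∈ D.cut y r := by
    intro v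
    rcases exists_mem_side hT (D.leafEquiv.symm v : Fin m) r with e | ⟨y, h1, h2⟩
    · left; rw [← Equiv.symm_apply_eq]; exact Subtype.ext e
    · exact Or.inr ⟨y, h.mem_kids.2 ⟨y, rfl, h1.symm, fun e => h1.ne (Fin.ext e)⟩, h2⟩
  rcases hkids : kids M r r with _ | ⟨y, _ | ⟨y', l⟩⟩
  · refine ⟨.leaf (D.leafEquiv ⟨r, hr⟩), ?_, by simp [BT.leaves], fun v => ?_, hP _⟩
    · simp [iterate_visit_nil, BT.post]
    · simp only [BT.leaves, List.mem_singleton, Set.mem_univ, and_true]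
      constructor
      · rintro rfl; exact ⟨_, rfl⟩
      · rintro ⟨v', rfl⟩
        rcases hside v' with rfl | ⟨y, h1, -⟩
        · rfl
        · simp [hkids] at h1
  · obtain ⟨z, rfl, h1, -⟩ := h.mem_kids.1 (by rw [hkids]; simp : y ∈ kids M r r)
    obtain ⟨t, j, h5, h6, h7, h8, h9⟩ := h.visit_side hP hP' _ z r h1.symm le_rfl
    have hr' := notMem_side hT h1.symm
    have hlist : Lists ((D.leafEquiv ⟨r, hr⟩ : ℕ) :: t.leaves) (Set.univ : Set (Fin n)) := by
      intro v
      rw [List.mem_cons, h8 v]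
      constructor
      · rintro (rfl | ⟨v', rfl, -⟩)
        · exact ⟨_, rfl, trivial⟩
        · exact ⟨_, rfl, trivial⟩
      · rintro ⟨v', rfl, -⟩
        rcases hside v' with rfl | ⟨y, h2, h3⟩
        · exact Or.inl rfl
        · rw [hkids, List.mem_singleton] at h2
          rw [Fin.ext h2] at h3
          exact Or.inr ⟨v', rfl, h3⟩
    refine ⟨.node (.leaf (D.leafEquiv ⟨r, hr⟩)) t, ?_, ?_, hlist, hP _, h9, hP'' _ hlist⟩
    · have h10 : (side D.tree z r).ncard < m := by
        have := Set.ncard_lt_card (s := side D.tree z r) fun e => hr' (e ▸ Set.mem_univ r)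
        simpa using this
      obtain ⟨i, rfl⟩ := Nat.exists_eq_add_of_le' (show j ≤ m' by omega)
      rw [Function.iterate_add_apply]
      simp only [List.map_cons, List.map_nil, List.cons_append, List.nil_append, h6, iterate_visit_nil]
      simp [BT.post]
    · refine List.nodup_append.2 ⟨by simp [BT.leaves], h7, fun a ha b hb e => ?_⟩
      subst e
      rw [BT.leaves, List.mem_singleton] at ha
      subst ha
      obtain ⟨v', e, hv'⟩ := (h8 _).1 hb
      rw [Fin.ext e, mem_cut, Equiv.symm_apply_apply] at hv'
      exact hr' hv'
  · rw [hkids] at hcard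
    simp only [IsLeaf, List.length_cons] at hcard hr
    omega

end

end WhileLang

/-! ### Covers and matchings of cuts -/

namespace SplitMatching

section

variable {V : Type*} [Fintype V] [DecidableEq V] {H : SimpleGraph V} {A : Set V} {C : Finset V}

/-- A set that meets every edge. -/
def Covers (H : SimpleGraph V) (C : Finset V) : Prop := ∀ u w, H.Adj u w → u ∈ C ∨ w ∈ C

/-- One side of a smallest cover of a bipartite graph can be matched into the complement of the
cover. -/
theorem exists_injective_of_cover (hA : ∀ u w, H.Adj u w → (u ∈ A ↔ w ∉ A)) (hC : Covers H C)
    (hmin : ∀ D, Covers H D → C.card ≤ D.card) :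
    ∃ f : {c // c ∈ C ∧ c ∈ A} → V, Function.Injective f ∧
      ∀ c : {c // c ∈ C ∧ c ∈ A}, H.Adj c (f c) ∧ f c ∉ C := by
  classical
  let N : {c // c ∈ C ∧ c ∈ A} → Finset V := fun c => {w | H.Adj c w ∧ w ∉ C}
  obtain ⟨f, hf, hf'⟩ := (Finset.all_card_le_biUnion_card_iff_exists_injective N).1 fun S => by
    have hS : S.map (Function.Embedding.subtype _) ⊆ C := by
      intro u hu
      obtain ⟨c, -, rfl⟩ := Finset.mem_map.1 hu
      exact c.2.1
    have h := hmin (C \ S.map (Function.Embedding.subtype _) ∪ S.biUnion N) ?_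
    · have h1 := Finset.card_union_le (C \ S.map (Function.Embedding.subtype _)) (S.biUnion N)
      rw [Finset.card_sdiff_of_subset hS, Finset.card_map] at h1
      have h2 := Finset.card_le_card hS
      rw [Finset.card_map] at h2
      omega
    · have key : ∀ u w, H.Adj u w → u ∈ C →
          u ∈ C \ S.map (Function.Embedding.subtype _) ∪ S.biUnion N ∨
          w ∈ C \ S.map (Function.Embedding.subtype _) ∪ S.biUnion N := by
        intro u w huw hu
        by_cases hu' : u ∈ S.map (Function.Embedding.subtype _)
        · right
          obtain ⟨c, hc, rfl⟩ := Finset.mem_map.1 hu'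
          by_cases hw : w ∈ C
          · refine Finset.mem_union_left _ (Finset.mem_sdiff.2 ⟨hw, fun h => ?_⟩)
            obtain ⟨c', -, rfl⟩ := Finset.mem_map.1 h
            exact (hA _ _ huw).1 c.2.2 c'.2.2
          · exact Finset.mem_union_right _ (Finset.mem_biUnion.2 ⟨c, hc, by simpa [N] using ⟨huw, hw⟩⟩)
        · exact Or.inl (Finset.mem_union_left _ (Finset.mem_sdiff.2 ⟨hu, hu'⟩))
      intro u w huw
      rcases hC u w huw with h | h
      · exact key u w huw h
      · exact (key w u huw.symm h).symm
  exact ⟨f, hf, fun c => by simpa [N] using hf' c⟩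

theorem exists_matching_of_cover (hA : ∀ u w, H.Adj u w → (u ∈ A ↔ w ∉ A)) (hC : Covers H C)
    (hmin : ∀ D, Covers H D → C.card ≤ D.card) :
    ∃ M : H.Subgraph, M.IsMatching ∧ C.card ≤ M.edgeSet.ncard := by
  classical
  obtain ⟨f, hf, hf'⟩ := exists_injective_of_cover hA hC hmin
  obtain ⟨f', hg, hg'⟩ := exists_injective_of_cover (A := Aᶜ) (fun u w h => by
    have := hA u w h
    simp only [Set.mem_compl_iff]
    tauto) hC hmin
  obtain ⟨φ, h1, h2⟩ : ∃ φ : V → V, Set.InjOn φ C ∧ ∀ c ∈ C, H.Adj c (φ c) ∧ φ c ∉ C := by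
    refine ⟨fun c => if h : c ∈ C ∧ c ∈ A then f ⟨c, h⟩ else
      if h : c ∈ C ∧ c ∈ Aᶜ then f' ⟨c, h⟩ else c, ?_, ?_⟩
    · intro c hc c' hc' e
      have hc1 : c ∈ C := hc
      have hc1' : c' ∈ C := hc'
      by_cases hcA : c ∈ A <;> by_cases hcA' : c' ∈ A <;>
        simp only [hc1, hc1', hcA, hcA', Set.mem_compl_iff, not_true, not_false_iff, and_true,
          and_false, dite_true, dite_false] at e
      · simpa using hf e
      · have h3 := (hA _ _ (hf' ⟨c, hc1, hcA⟩).1).1 hcA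
        have h4 := (hA _ _ (hg' ⟨c', hc1', hcA'⟩).1).not.1 hcA'
        rw [e] at h3
        exact absurd h3 h4
      · have h3 := (hA _ _ (hf' ⟨c', hc1', hcA'⟩).1).1 hcA'
        have h4 := (hA _ _ (hg' ⟨c, hc1, hcA⟩).1).not.1 hcA
        rw [← e] at h3
        exact absurd h3 h4
      · simpa using hg e
    · intro c hc
      by_cases hcA : c ∈ A
      · simpa [hc, hcA] using hf' ⟨c, hc, hcA⟩
      · simpa [hc, hcA] using hg' ⟨c, hc, hcA⟩
  let M : H.Subgraph :=
    { verts := C ∪ φ '' C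
      Adj := fun u w => (u ∈ C ∧ w = φ u) ∨ (w ∈ C ∧ u = φ w)
      adj_sub := by
        rintro u w (⟨hu, rfl⟩ | ⟨hw, rfl⟩)
        · exact (h2 u hu).1
        · exact (h2 w hw).1.symm
      edge_vert := by
        rintro u w (⟨hu, rfl⟩ | ⟨hw, rfl⟩)
        · exact Or.inl hu
        · exact Or.inr ⟨w, hw, rfl⟩
      symm := ⟨fun u w h => h.symm⟩ }
  refine ⟨M, ?_, ?_⟩
  · rintro u (hu | ⟨c, hc, rfl⟩)
    · refine ⟨φ u, Or.inl ⟨hu, rfl⟩, ?_⟩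
      rintro w (⟨-, h⟩ | ⟨hw, rfl⟩)
      · exact h
      · exact absurd hu (h2 w hw).2
    · refine ⟨c, Or.inr ⟨hc, rfl⟩, ?_⟩
      rintro w (⟨h, -⟩ | ⟨hw, e⟩)
      · exact absurd h (h2 c hc).2
      · exact (h1 hc hw e).symm
  · rw [← Set.ncard_coe_finset]
    refine Set.ncard_le_ncard_of_injOn (fun c => s(c, φ c)) (fun c hc => Or.inl ⟨hc, rfl⟩) ?_
    intro c hc c' hc' e
    rcases Sym2.eq_iff.1 e with ⟨e, -⟩ | ⟨rfl, -⟩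
    · exact e
    · exact absurd hc (h2 c' hc').2

theorem exists_cover_le_mm (G : SimpleGraph V) (A : Set V) :
    ∃ C : Finset V, Covers (G.between A Aᶜ) C ∧ C.card ≤ mm G A := by
  classical
  obtain ⟨C, hC, hmin⟩ : ∃ C : Finset V, Covers (G.between A Aᶜ) C ∧
      ∀ D, Covers (G.between A Aᶜ) D → C.card ≤ D.card := by
    obtain ⟨C, hC, hmin⟩ := Set.exists_min_image {C : Finset V | Covers (G.between A Aᶜ) C}
      Finset.card (Set.toFinite _) ⟨Finset.univ, fun u w _ => Or.inl (Finset.mem_univ u)⟩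
    exact ⟨C, hC, hmin⟩
  refine ⟨C, hC, ?_⟩
  obtain ⟨M, hM, hle⟩ := exists_matching_of_cover (A := A) (fun u w h => by
    rw [SimpleGraph.between_adj] at h
    have := h.2
    simp only [Set.mem_compl_iff] at this
    tauto) hC hmin
  refine hle.trans (le_csSup ⟨Nat.card (Sym2 V), ?_⟩ ⟨M, hM, rfl⟩)
  rintro j ⟨M', -, rfl⟩
  rw [← Set.ncard_univ]
  exact Set.ncard_le_ncard (Set.subset_univ _)

end

theorem sm_le_smWidth {V W : Type*} [Finite W] (D : BranchDecomposition V W) (G : SimpleGraph V)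
    {a b : W} (h : D.tree.Adj a b) : sm G (D.cut a b) ≤ D.smWidth G := by
  refine le_csSup (Set.Finite.bddAbove ?_) ⟨a, b, h, rfl⟩
  refine (Set.finite_range fun p : W × W => sm G (D.cut p.1 p.2)).subset ?_
  rintro j ⟨a, b, -, rfl⟩
  exact ⟨(a, b), rfl⟩

end SplitMatching

/-! ### The encoding of the input, and the main theorem -/

namespace WhileLang

open Code SplitMatching

open Classical in
/-- The adjacency matrix of a graph. -/
noncomputable def matOf {n : ℕ} (G : SimpleGraph (Fin n)) : Mat :=
  List.ofFn fun i => List.ofFn fun j => decide (G.Adj i j)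

open Classical in
/-- The table of the leaves of a branch decomposition. -/
noncomputable def tabOf {n m : ℕ} (D : BranchDecomposition (Fin n) (Fin m)) : List (List ℕ) :=
  List.ofFn fun x => if h : IsLeaf D.tree x then [(D.leafEquiv ⟨x, h⟩ : ℕ)] else []

theorem enc_ofFn {α : Type} [Code α] {n : ℕ} (f : Fin n → α) :
    enc (List.ofFn f) = Dat.ofList (List.ofFn fun i => enc (f i)) := by
  change Dat.ofList ((List.ofFn f).map enc) = _
  rw [List.map_ofFn]
  rfl

theorem enc_matOf {n : ℕ} (G : SimpleGraph (Fin n)) : enc (matOf G) = Dat.ofGraph G := by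
  simp only [matOf, Dat.ofGraph, enc_ofFn]
  congr
  funext i
  congr
  funext j
  by_cases h : G.Adj i j <;> simp [Dat.ofProp, h]

theorem enc_tabOf {n m : ℕ} (D : BranchDecomposition (Fin n) (Fin m)) :
    enc (matOf D.tree, tabOf D) = Dat.ofBranchDecomposition D := by
  rw [enc_pair, enc_matOf, Dat.ofBranchDecomposition, tabOf, enc_ofFn]
  congr
  funext x
  split_ifs <;> rfl

theorem length_matOf {n : ℕ} (G : SimpleGraph (Fin n)) : (matOf G).length = n := by simp [matOf]

theorem rel_matOf {n : ℕ} {G : SimpleGraph (Fin n)} {u v : ℕ} :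
    rel (matOf G) u v ↔ ∃ (hu : u < n) (hv : v < n), G.Adj ⟨u, hu⟩ ⟨v, hv⟩ := by
  classical
  simp only [rel, adj, matOf, List.getD_eq_getElem?_getD, List.getElem?_ofFn]
  by_cases hu : u < n
  · by_cases hv : v < n
    · simp [hu, hv]
    · simp [hu, hv]
  · simp [hu]

theorem isGraph_matOf {n : ℕ} (G : SimpleGraph (Fin n)) : IsGraph (matOf G) where
  symm u v h := by
    obtain ⟨hu, hv, h⟩ := rel_matOf.1 h
    exact rel_matOf.2 ⟨hv, hu, h.symm⟩
  irrefl u h := by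
    obtain ⟨hu, hv, h⟩ := rel_matOf.1 h
    exact G.irrefl h
  lt u v h := by
    obtain ⟨hu, hv, h⟩ := rel_matOf.1 h
    rwa [length_matOf]

theorem represents_matOf {n m : ℕ} (D : BranchDecomposition (Fin n) (Fin m)) :
    Represents D (matOf D.tree) (tabOf D) where
  length := length_matOf _
  adj x y := by
    refine rel_matOf.trans ?_
    simp
  leaf x h := by
    simp [tabOf, List.getD_eq_getElem?_getD, h]
  inner x h := by
    simp [tabOf, List.getD_eq_getElem?_getD, h]

theorem cutOk_of_cut {n m : ℕ} {G : SimpleGraph (Fin n)} {D : BranchDecomposition (Fin n) (Fin m)}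
    {k : ℕ} (hk : D.smWidth G ≤ k) {A : List ℕ} {a b : Fin m} (hab : D.tree.Adj a b)
    (hA : Lists A (D.cut a b)) : CutOk (matOf G) (max 1 (min k n)) A := by
  classical
  have hmem : ∀ v : Fin n, (v : ℕ) ∈ A ↔ v ∈ D.cut a b := fun v =>
    (hA v).trans ⟨fun ⟨v', e, h⟩ => Fin.ext e ▸ h, fun h => ⟨v, rfl, h⟩⟩
  have hw := (sm_le_smWidth D G hab).trans hk
  refine cutInfo_ok (isGraph_matOf G) ?_
  by_cases hs : IsSplit G (D.cut a b)
  · right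
    intro u hu v hv w x hw hx huw hvx
    rw [List.mem_toFinset] at hu hv hw hx
    obtain ⟨hu', hw', huw⟩ := rel_matOf.1 huw
    obtain ⟨hv', hx', hvx⟩ := rel_matOf.1 hvx
    have hwA : (⟨w, hw'⟩ : Fin n) ∈ (D.cut a b)ᶜ := fun h => hw ((hmem ⟨w, hw'⟩).2 h)
    have hxA : (⟨x, hx'⟩ : Fin n) ∈ (D.cut a b)ᶜ := fun h => hx ((hmem ⟨x, hx'⟩).2 h)
    have h := hs.2.2 ⟨u, hu'⟩ ((hmem ⟨u, hu'⟩).1 hu) ⟨v, hv'⟩ ((hmem ⟨v, hv'⟩).1 hv)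
      ⟨_, huw, hwA⟩ ⟨_, hvx, hxA⟩
    have hvw : (⟨w, hw'⟩ : Fin n) ∈ G.neighborSet ⟨v, hv'⟩ ∩ (D.cut a b)ᶜ := h ▸ ⟨huw, hwA⟩
    exact rel_matOf.2 ⟨hv', hw', hvw.1⟩
  · left
    rw [sm, if_neg hs] at hw
    obtain ⟨C, hC, hle⟩ := exists_cover_le_mm G (D.cut a b)
    refine ⟨C.image Fin.val, fun u hu w hw' huw => ?_, ?_⟩
    · rw [List.mem_toFinset] at hu hw'
      obtain ⟨hu', hw'', huw⟩ := rel_matOf.1 huw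
      refine (hC ⟨u, hu'⟩ ⟨w, hw''⟩ ⟨huw, Or.inl ⟨(hmem ⟨u, hu'⟩).1 hu,
        fun h => hw' ((hmem ⟨w, hw''⟩).2 h)⟩⟩).imp ?_ ?_
      · exact fun h => Finset.mem_image.2 ⟨_, h, rfl⟩
      · exact fun h => Finset.mem_image.2 ⟨_, h, rfl⟩
    · have h1 : (C.image Fin.val).card ≤ C.card := Finset.card_image_le
      have h2 := card_finset_fin_le C
      omega

theorem exists_colOn_iff {n : ℕ} {G : SimpleGraph (Fin n)} {A : List ℕ}
    (hA : Lists A (Set.univ : Set (Fin n))) (t : ℕ) :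
    (∃ h, ColOn (rel (matOf G)) t A.toFinset h) ↔ G.Colorable t := by
  have hmem : ∀ v : Fin n, (v : ℕ) ∈ A.toFinset := fun v =>
    List.mem_toFinset.2 ((hA v).2 ⟨v, rfl, trivial⟩)
  constructor
  · rintro ⟨h, h1, h2⟩
    exact ⟨SimpleGraph.Coloring.mk (fun v => ⟨h v, h1 v (hmem v)⟩) fun {u v} huv e =>
      h2 u (hmem u) v (hmem v) (rel_matOf.2 ⟨u.2, v.2, huv⟩) (Fin.ext_iff.1 e)⟩
  · rintro ⟨c⟩
    refine ⟨fun v => if hv : v < n then c ⟨v, hv⟩ else 0, fun u hu => ?_, fun u _ v _ huv => ?_⟩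
    · obtain ⟨u', rfl, -⟩ := (hA u).1 (List.mem_toFinset.1 hu)
      simp
    · obtain ⟨hu, hv, h⟩ := rel_matOf.1 huv
      simp only [hu, hv, dif_pos]
      exact fun e => c.valid h (Fin.ext e)

theorem sz_matOf_le {n : ℕ} (G : SimpleGraph (Fin n)) : sz (matOf G) ≤ n * (4 * n + 2) + 1 := by
  classical
  have h := sz_le_of_forall (l := matOf G) (B := n * (3 + 1) + 1) fun r hr => by
    simp only [matOf, List.mem_ofFn'] at hr
    obtain ⟨i, rfl⟩ := hr
    have := sz_le_of_forall (l := List.ofFn fun j => decide (G.Adj i j)) (B := 3) fun b _ => sz_bool_le b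
    simpa using this
  rw [length_matOf] at h
  nlinarith

theorem sz_tabOf_le {n m : ℕ} (D : BranchDecomposition (Fin n) (Fin m)) :
    sz (tabOf D) ≤ m * (2 * n + 4) + 1 := by
  have h := sz_le_of_forall (l := tabOf D) (B := 2 * n + 3) fun r hr => by
    simp only [tabOf, List.mem_ofFn'] at hr
    obtain ⟨x, rfl⟩ := hr
    dsimp only
    split_ifs with hx
    · have := (D.leafEquiv ⟨x, hx⟩).2
      rw [sz_cons, sz_nil, sz_nat]
      omega
    · simp
  simpa [tabOf] using h

theorem pow_le_pow_mul_pow_self (a k : ℕ) (ha : 1 ≤ a) : a ^ k ≤ a ^ a * k ^ k := by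
  rcases le_total k a with h | h
  · refine (Nat.pow_le_pow_right ha h).trans (Nat.le_mul_of_pos_right _ ?_)
    rcases Nat.eq_zero_or_pos k with rfl | hk
    · simp
    · exact Nat.pow_pos hk
  · exact (Nat.pow_le_pow_left h k).trans (Nat.le_mul_of_pos_left _ (Nat.pow_pos ha))

theorem exponential_le {K k : ℕ} (h : K ≤ max 1 k) :
    (3 * K) ^ (4 * K) ≤ 81 ^ 81 * k ^ (5 * k) := by
  rcases Nat.eq_zero_or_pos k with rfl | hk
  · have h1 : (3 * K) ^ (4 * K) ≤ 81 ^ 1 := by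
      have : K ≤ 1 := by simpa using h
      interval_cases K <;> norm_num
    have h2 : 81 ^ 1 ≤ 81 ^ 81 := Nat.pow_le_pow_right (by norm_num) (by norm_num)
    exact h1.trans (h2.trans (Nat.le_mul_of_pos_right _ (by simp)))
  · have hK : K ≤ k := by omega
    calc (3 * K) ^ (4 * K) ≤ (3 * k) ^ (4 * k) := (Nat.pow_le_pow_left (by omega) _).trans
          (Nat.pow_le_pow_right (by omega) (by omega))
      _ = 81 ^ k * k ^ (4 * k) := by rw [mul_pow, pow_mul 3]; norm_num
      _ ≤ 81 ^ 81 * k ^ k * k ^ (4 * k) :=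
          Nat.mul_le_mul_right _ (pow_le_pow_mul_pow_self 81 k (by norm_num))
      _ = 81 ^ 81 * k ^ (5 * k) := by rw [mul_assoc, ← pow_add]; congr 2; ring

theorem exists_chromatic_search {n m : ℕ} (G : SimpleGraph (Fin n))
    (D : BranchDecomposition (Fin n) (Fin m)) :
    ∃ χ : ℕ, 1 ≤ χ ∧ G.chromaticNumber = χ ∧ ∃ K l, 1 ≤ n ∧ K ≤ max 1 (D.smWidth G) ∧
      candidates n = candidatesTo n K ++ l ∧
      (candidatesTo n K).foldl (chromStep (matOf G) (postorder (matOf D.tree) (tabOf D))) 0 = χ := by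
  obtain ⟨x, hx⟩ := exists_isLeaf D.isTree
  have hn : 1 ≤ n := Nat.one_le_iff_ne_zero.2 fun e => by have := (D.leafEquiv ⟨x, hx⟩).2; omega
  have hcol : G.Colorable n := by simpa using G.colorable_of_fintype
  obtain ⟨χ, hχ⟩ := ENat.ne_top_iff_exists.1 (SimpleGraph.chromaticNumber_ne_top_iff_exists.2 ⟨n, hcol⟩)
  have hiff : ∀ t : ℕ, G.Colorable t ↔ χ ≤ t := fun t => by
    rw [← SimpleGraph.chromaticNumber_le_iff_colorable, ← hχ, Nat.cast_le]
  have hχ1 : 1 ≤ χ := by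
    by_contra h
    obtain ⟨c⟩ := (hiff 0).2 (by omega)
    exact (c ⟨0, hn⟩).elim0
  obtain ⟨K, hK⟩ : ∃ K, K = max 1 (min (D.smWidth G) n) := ⟨_, rfl⟩
  obtain ⟨t, ht, hnd, hlist, hok⟩ := (represents_matOf D).postorder_eq (P := CutOk (matOf G) K)
    (fun v => cutInfo_ok (isGraph_matOf G) (Or.inl ⟨{(v : ℕ)}, fun u hu w _ _ => by
      simp at hu; simp [hu], by simp; omega⟩))
    (fun A a b hab hA => hK ▸ cutOk_of_cut le_rfl hab hA)
    (fun A hA => cutInfo_ok (isGraph_matOf G) (Or.inl ⟨∅, fun u hu w hw huw => by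
      obtain ⟨-, hw', -⟩ := rel_matOf.1 huw
      exact absurd (List.mem_toFinset.2 ((hA w).2 ⟨⟨w, hw'⟩, rfl, trivial⟩)) hw, by simp⟩))
  obtain ⟨l, hl⟩ := candidates_eq_append (n := n) (κ := K) (by omega)
  refine ⟨χ, hχ1, hχ.symm, K, l, hn, by omega, hl, ?_⟩
  rw [ht]
  refine foldl_candidatesTo_eq (ok := fun κ => t.AllSub (CutOk (matOf G) κ)) hχ1 ((hiff n).1 hcol)
    (fun κ j hκ hj => ?_) (by omega) hok
  rw [decideCol_iff (isGraph_matOf G) hκ hj t hnd fun u v huv => ?_, exists_colOn_iff hlist, hiff]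
  obtain ⟨-, hv, -⟩ := rel_matOf.1 huv
  exact (hlist v).2 ⟨⟨v, hv⟩, rfl, trivial⟩

end WhileLang

theorem mainTheorem3 :
    ∃ (p : WhileLang.Prog) (c d : ℕ),
      ∀ (n m : ℕ) (G : SimpleGraph (Fin n))
        (D : SplitMatching.BranchDecomposition (Fin n) (Fin m)) (k : ℕ), D.smWidth G = k →
        ∃ χ : ℕ, G.chromaticNumber = (χ : ℕ∞) ∧
          p.OutputsWithin
            (.cons (WhileLang.Dat.ofGraph G) (WhileLang.Dat.ofBranchDecomposition D))
            (WhileLang.Dat.ofNat χ)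
            (c * (n + m) ^ d * k ^ (5 * k)) := by
  obtain ⟨T, c, ⟨p, w, hp⟩, hT⟩ := WhileLang.within_solve
  refine ⟨p, 25 ^ c * 81 ^ 81, 2 * c, fun n m G D k hk => ?_⟩
  subst hk
  obtain ⟨χ, hχ1, hχ, K, l, hn, hK, hl, hfold⟩ := WhileLang.exists_chromatic_search G D
  refine ⟨χ, hχ, ?_⟩
  obtain ⟨t, s, h1, h2, h3, -⟩ := hp (fun i => if i = 0 then .cons (WhileLang.Dat.ofGraph G)
    (WhileLang.Dat.ofBranchDecomposition D) else .nil)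
    (WhileLang.matOf G, WhileLang.matOf D.tree, WhileLang.tabOf D) (by
      rw [WhileLang.enc_pair, WhileLang.enc_tabOf, WhileLang.enc_matOf]; rfl)
  refine ⟨t, s, ?_, h1, ?_⟩
  · refine h2.trans ((hT _ (23 * (n + m) ^ 2) (81 ^ 81 * D.smWidth G ^ (5 * D.smWidth G))
      ?_ ⟨?_, WhileLang.candidatesTo n K, l, K, ?_, ?_, ?_, WhileLang.exponential_le hK⟩).trans ?_)
    · refine Nat.mul_pos (Nat.pow_pos (by norm_num)) ?_
      rcases Nat.eq_zero_or_pos (D.smWidth G) with h | h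
      · rw [h]; simp
      · exact Nat.pow_pos h
    · have h4 := WhileLang.sz_matOf_le G
      have h5 := WhileLang.sz_matOf_le D.tree
      have h6 := WhileLang.sz_tabOf_le D
      rw [WhileLang.sz_pair, WhileLang.sz_pair]
      nlinarith
    · rw [WhileLang.length_matOf]; exact hl
    · dsimp only; rw [hfold]; omega
    · intro q hq
      simp only [WhileLang.candidatesTo, List.mem_flatMap, List.mem_range, List.mem_map] at hq
      obtain ⟨κ, hκ, j, -, rfl⟩ := hq
      dsimp only
      omega
    · have h7 : 23 * (n + m) ^ 2 + 2 ≤ 25 * (n + m) ^ 2 := by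
        have : 1 ≤ (n + m) ^ 2 := Nat.one_le_pow _ _ (by omega)
        omega
      calc (23 * (n + m) ^ 2 + 2) ^ c * (81 ^ 81 * D.smWidth G ^ (5 * D.smWidth G))
          ≤ (25 * (n + m) ^ 2) ^ c * (81 ^ 81 * D.smWidth G ^ (5 * D.smWidth G)) :=
            Nat.mul_le_mul_right _ (Nat.pow_le_pow_left h7 c)
        _ = 25 ^ c * 81 ^ 81 * (n + m) ^ (2 * c) * D.smWidth G ^ (5 * D.smWidth G) := by
            rw [mul_pow, ← pow_mul]
            generalize 81 ^ 81 = a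
            ring
  · rw [h3]
    have : WhileLang.solve (WhileLang.matOf G, WhileLang.matOf D.tree, WhileLang.tabOf D) = χ := by
      rw [WhileLang.solve, WhileLang.chromatic_eq, WhileLang.length_matOf, hl, List.foldl_append,
        hfold, WhileLang.foldl_chromStep_pos (by omega)]
    rw [this]
    rfl
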